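/- All graphs are finite, simple and undirected. A hole of a graph $G$ is an induced cycle of $G$ of length at least $4$; it is odd (even) if its length is odd (even). Let $\mathcal{G}_4$ be the family of graphs that have girth $9$ and have no odd hole of length at least $11$. A $2$-edge-cut of $G$ is a set of exactly two edges which, for some $S\subseteq V(G)$, is the set of all edges with exactly one end in $S$. A vertex cut of $G$ is a set $X\subseteq V(G)$ such that some two vertices outside $X$ lie in the same component of $G$ but in different components of $G-X$ (for connected $G$: $G-X$ is disconnected). A $K_2$-cut (respectively $P_3$-cut) is a vertex cut $X$ such that $G[X]$ is isomorphic to $K_2$ (respectively to the path $P_3$ on three vertices). A $K_4$-subdivision in $G$ is a subgraph $H=(u_1,u_2,u_3,u_4,P_1,P_2,Q_1,Q_2,L_1,L_2)$ of $G$ consisting of four distinct vertices $u_1,u_2,u_3,u_4$ and six paths, where $P_1$ joins $u_1,u_2$; $P_2$ joins $u_3,u_4$; $Q_1$ joins $u_2,u_3$; $Q_2$ joins $u_1,u_4$; $L_1$ joins $u_1,u_3$; $L_2$ joins $u_2,u_4$; the interiors of the six paths are pairwise disjoint and contain none of the $u_i$. Put $$C_1=P_1\cup Q_1\cup L_1,\quad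 C_2=P_1\cup Q_2\cup L_2,\quad C_3=P_2\cup Q_1\cup L_2,\quad C_4=C_1\triangle C_2\triangle C_3=P_2\cup Q_2\cup L_1 .$$ $H$ is an odd $K_4$-subdivision if $C_1,C_2,C_3,C_4$ are all odd holes of $G$. $H$ is a balanced $K_4$-subdivision of type $(1,2)$ if $C_1,C_2$ are odd holes of $G$, $C_3,C_4$ are even holes of $G$, $Q_1$ has length $1$ and $L_2$ has length at least $2$. **Theorem.** Let $G\in\mathcal{G}_4$ have no $2$-edge-cut and no $K_2$-cut. Then at least one of the following holds: 1. $G$ has an odd $K_4$-subdivision. 2. $G$ contains a balanced $K_4$-subdivision of type $(1,2)$. 3. $G$ has a $P_3$-cut. 4. $G$ has a vertex of degree $2$. -/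

import Mathlib

namespace OddHoles

open SimpleGraph

variable {V : Type*}

/-- A hole of `G`, given as a closed walk running once around it: an induced cycle of `G` of
length at least 4. Chords are edges of the ambient graph `G`. -/
def IsHole {G : SimpleGraph V} {v : V} (c : G.Walk v v) : Prop :=
  c.IsCycle ∧ 4 ≤ c.length ∧ c.toSubgraph.IsInduced

/-- A hole of odd length. -/
def IsOddHole {G : SimpleGraph V} {v : V} (c : G.Walk v v) : Prop :=
  IsHole c ∧ Odd c.length

/-- A hole of even length. -/
def IsEvenHole {G : SimpleGraph V} {v : V} (c : G.Walk v v) : Prop :=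
  IsHole c ∧ Even c.length

/-- The family `𝒢_l` (for `l ≥ 2`): graphs of girth `2l+1` without odd holes of length at
least `2l+3`. (`SimpleGraph.girth` is `0` for acyclic graphs, so these are excluded.) -/
def InFamily (l : ℕ) (G : SimpleGraph V) : Prop :=
  G.girth = 2 * l + 1 ∧ ∀ (v : V) (c : G.Walk v v), IsOddHole c → ¬ 2 * l + 3 ≤ c.length

/-- The edge cut determined by a vertex set `S`: all edges with exactly one end in `S`. -/
def edgeCut (G : SimpleGraph V) (S : Set V) : Set (Sym2 V) :=
  {e | ∃ a ∈ S, ∃ b ∉ S, G.Adj a b ∧ e = s(a, b)}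

/-- `G` has an edge cut consisting of exactly two edges. -/
def HasTwoEdgeCut (G : SimpleGraph V) : Prop :=
  ∃ S : Set V, (edgeCut G S).ncard = 2

/-- `X` is a vertex cut: deleting it separates two vertices lying in the same component of `G`.
For connected `G` this says that `G - X` is disconnected. -/
def IsVertexCut (G : SimpleGraph V) (X : Set V) : Prop :=
  ∃ a b : ↥(Xᶜ), G.Reachable a b ∧ ¬ (G.induce Xᶜ).Reachable a b

/-- `G` has an `F`-cut: a vertex cut inducing a subgraph isomorphic to `F`. -/
def HasCut {W : Type*} (G : SimpleGraph V) (F : SimpleGraph W) : Prop :=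
  ∃ X : Set V, IsVertexCut G X ∧ Nonempty (G.induce X ≃g F)

/-- `K₂`-cuts. -/
def HasK2Cut (G : SimpleGraph V) : Prop := HasCut G (completeGraph (Fin 2))

/-- `P₃`-cuts, where `P₃` is the path on three vertices. -/
def HasP3Cut (G : SimpleGraph V) : Prop := HasCut G (pathGraph 3)

/-- The internal vertices of a path. -/
def pathInterior {G : SimpleGraph V} {a b : V} (p : G.Walk a b) : Set V :=
  {x | x ∈ p.support ∧ x ≠ a ∧ x ≠ b}

/-- A (labelled) subgraph of `G` that is a subdivision of `K₄`: four distinct branch vertices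
and six paths of `G` (the arrises) joining the pairs of them, such that the interiors of the
paths are pairwise disjoint and contain no branch vertex. -/
structure K4Subdivision (G : SimpleGraph V) where
  (u₁ u₂ u₃ u₄ : V)
  P₁ : G.Walk u₁ u₂
  P₂ : G.Walk u₃ u₄
  Q₁ : G.Walk u₂ u₃
  Q₂ : G.Walk u₁ u₄
  L₁ : G.Walk u₁ u₃
  L₂ : G.Walk u₂ u₄
  branch_nodup : [u₁, u₂, u₃, u₄].Nodup
  isPath_P₁ : P₁.IsPath
  isPath_P₂ : P₂.IsPath
  isPath_Q₁ : Q₁.IsPath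
  isPath_Q₂ : Q₂.IsPath
  isPath_L₁ : L₁.IsPath
  isPath_L₂ : L₂.IsPath
  internally_disjoint :
    [({u₁, u₂, u₃, u₄} : Set V), pathInterior P₁, pathInterior P₂, pathInterior Q₁, pathInterior Q₂,
      pathInterior L₁, pathInterior L₂].Pairwise Disjoint

namespace K4Subdivision

variable {G : SimpleGraph V} (H : K4Subdivision G)

/-- The cycle `P₁ ∪ Q₁ ∪ L₁`. -/
def C₁ : G.Walk H.u₁ H.u₁ := (H.P₁.append H.Q₁).append H.L₁.reverse

/-- The cycle `P₁ ∪ Q₂ ∪ L₂`. -/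
def C₂ : G.Walk H.u₁ H.u₁ := (H.P₁.append H.L₂).append H.Q₂.reverse

/-- The cycle `P₂ ∪ Q₁ ∪ L₂`. -/
def C₃ : G.Walk H.u₂ H.u₂ := (H.Q₁.append H.P₂).append H.L₂.reverse

/-- The cycle `P₂ ∪ Q₂ ∪ L₁`, which is the symmetric difference `C₁ △ C₂ △ C₃`: each of
`P₁`, `Q₁`, `L₂` lies in exactly two of `C₁, C₂, C₃`, each of `P₂`, `Q₂`, `L₁` in exactly one. -/
def C₄ : G.Walk H.u₁ H.u₁ := (H.L₁.append H.P₂).append H.Q₂.reverse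

/-- An odd `K₄`-subdivision: all four face cycles are odd holes of `G`. -/
def IsOdd : Prop :=
  IsOddHole H.C₁ ∧ IsOddHole H.C₂ ∧ IsOddHole H.C₃ ∧ IsOddHole H.C₄

/-- A balanced `K₄`-subdivision of type `(1, 2)`. -/
def IsBalancedOneTwo : Prop :=
  IsOddHole H.C₁ ∧ IsOddHole H.C₂ ∧ IsEvenHole H.C₃ ∧ IsEvenHole H.C₄ ∧
    H.Q₁.length = 1 ∧ 2 ≤ H.L₂.length

end K4Subdivision

end OddHoles

/-!
Call a hole of length `9` a nonagon. In a graph of girth `9` all of whose odd holes are nonagons, two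
facts are used over and over: two distinct paths with the same ends have total length at least `9`
(`Nonagonal.nine_le_of_ne`), and two internally disjoint paths with the same ends and no chords,
whose total length is odd, have total length exactly `9` (`Nonagonal.add_length_eq_nine`). Assume
that there is no `P₃`-cut and no vertex of degree `2`.

**Thetas exist** (`exists_isTheta`). A theta is an induced subgraph consisting of three internally
disjoint paths `S`, `A`, `P` with the same ends, of lengths `d`, `9 - d`, `9 - d` with `2 ≤ d ≤ 4`;
thus `S ∪ A` and `S ∪ P` are nonagons. Suppose that there is none. Then a path that is attached to a
nonagon `c` only by its two ends joins equal or consecutive vertices of `c`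
(`IsNonagon.adj_of_isAttached`). Choose `c` and a component `K` of its complement with `K` as large
as possible. If a neighbour of `c` lay in another component `D`, a shortest path avoiding three
consecutive vertices of `c`, which exists as these form no cut, would give a nonagon within `D` and
three consecutive vertices of `c` (`IsNonagon.exists_isNonagon_outside`), whose complement has a
component that properly contains `K`. So all outside neighbours of `c` are in `K`
(`IsNonagon.exists_outside_eq`), and a shortest path in `K` between neighbours of two vertices of `c`
at distance `4` exists. Its attachments to `c` move by at most one step at a time, and the parities
of the holes that it forms with arcs of `c` contradict each other (`IsNonagon.not_isInducedSeq`).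

**Thetas give subdivisions of `K₄`.** An induced subdivision of `K₄` in which the two faces at one
arris are odd is odd or balanced of type `(1, 2)`, up to relabelling and with one kind of exception
(`IsInducedK4.odd_or_balanced`). Take a theta with `d` as large as possible and assume that there is
no such subdivision. Then no path attached to the theta by its ends alone joins an inner vertex of
`A` to one of `S` (`IsTheta.not_isAttached_short`) or `P` (`IsTheta.eq_one_or_of_isAttached`, unless
these are neighbours of the same end), or two vertices of `A` at distance at least `2`, other than
both its ends (`IsTheta.not_isAttached_near`, `IsTheta.exists_larger`), and a vertex off the theta has
at most one neighbour on it (`IsTheta.eq_of_adj`). Let `u, a₁, a₂, a₃, …` be the vertices of `A`. As `a₂` has a third neighbour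
and `{a₁, a₂, a₃}` is no `P₃`-cut, a shortest path leads from `a₂` to another vertex of the theta
(`IsTheta.false_of_forall_gt`). It contains an attached path of one of the forbidden kinds, or it is
itself excluded by the parities of the holes through it, as `a₁` or `a₃` is its only further
attachment (`IsTheta.not_isAttached_near`, `IsTheta.not_isAttached_corner`).
-/

namespace OddHoles

open SimpleGraph

variable {V : Type*} {G : SimpleGraph V}

/-- Every cycle of `G` has length at least `9` and every odd hole has length exactly `9`. -/
structure Nonagonal (G : SimpleGraph V) : Prop where
  nine_le_of_isCycle : ∀ (v : V) (c : G.Walk v v), c.IsCycle → 9 ≤ c.length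
  eq_nine_of_isOddHole : ∀ (v : V) (c : G.Walk v v), IsOddHole c → c.length = 9

theorem InFamily.nonagonal (h : InFamily 4 G) : Nonagonal G := by
  have h9 : ∀ (v : V) (c : G.Walk v v), c.IsCycle → 9 ≤ c.length := fun v c hc => by
    have := girth_le_length hc
    have := h.1
    omega
  refine ⟨h9, fun v c hc => ?_⟩
  have h1 := h.2 v c hc
  have h2 := h9 v c hc.1.1
  have h3 := hc.2
  rw [Nat.odd_iff] at h3
  omega

theorem InFamily.exists_isCycle (h : InFamily 4 G) :
    ∃ (v : V) (c : G.Walk v v), c.IsCycle ∧ c.length = 9 := by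
  have hac : ¬ G.IsAcyclic := fun hac => by
    have := girth_eq_zero.2 hac
    have := h.1
    omega
  obtain ⟨v, c, hc, hl⟩ := exists_girth_eq_length.2 hac
  exact ⟨v, c, hc, by rw [← hl, h.1]⟩

/-! ### Walks along sequences of vertices -/

theorem exists_walk_of_fun {f : ℕ → V} : ∀ {n : ℕ}, (∀ i < n, G.Adj (f i) (f (i + 1))) →
    ∃ w : G.Walk (f 0) (f n), w.length = n ∧ ∀ i ≤ n, w.getVert i = f i
  | 0, _ => ⟨.nil, rfl, fun i hi => by simp [Nat.le_zero.1 hi]⟩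
  | n + 1, h => by
    obtain ⟨w, hw, hv⟩ := exists_walk_of_fun (n := n) fun i hi => h i (by omega)
    refine ⟨w.concat (h n (by omega)), by simp [hw], fun i hi => ?_⟩
    rw [Walk.concat_eq_append, Walk.getVert_append]
    split_ifs with hlt
    · exact hv i (by omega)
    · rcases Nat.lt_or_ge n i with h1 | h1
      · obtain rfl : n + 1 = i := by omega
        simp [hw]
      · obtain rfl : n = i := by omega
        simp [hw]

/-- A walk running through the values `f s, …, f t` of a sequence. -/
theorem exists_segment {f : ℕ → V} {s t : ℕ} (hst : s ≤ t)
    (h : ∀ i, s ≤ i → i < t → G.Adj (f i) (f (i + 1))) :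
    ∃ w : G.Walk (f s) (f t), w.length = t - s ∧
      (∀ x, x ∈ w.support ↔ ∃ i, s ≤ i ∧ i ≤ t ∧ x = f i) ∧
      (∀ i, s ≤ i → i < t → s(f i, f (i + 1)) ∈ w.edges) ∧
      ((∀ i j, s ≤ i → i < j → j ≤ t → f i ≠ f j) → w.IsPath) := by
  obtain ⟨n, rfl⟩ := Nat.exists_eq_add_of_le hst
  obtain ⟨w, hl, hv⟩ := exists_walk_of_fun (G := G) (f := fun i => f (s + i)) (n := n)
    fun i hi => h (s + i) (by omega) (by omega)
  refine ⟨w, by simp [hl], fun x => ?_, fun i hi hit => ?_, fun hinj => ?_⟩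
  · rw [Walk.mem_support_iff_exists_getVert]
    constructor
    · rintro ⟨i, hi, hil⟩
      exact ⟨s + i, by omega, by omega, by rw [← hi, hv i (by omega)]⟩
    · rintro ⟨i, hsi, hit, rfl⟩
      refine ⟨i - s, ?_, by omega⟩
      rw [hv _ (by omega)]
      congr 1; omega
  · rw [← Walk.adj_toSubgraph_iff_mem_edges, Walk.toSubgraph_adj_iff]
    refine ⟨i - s, ?_, by omega⟩
    rw [hv _ (by omega), hv _ (by omega), show s + (i - s) = i by omega,
      show s + (i - s + 1) = i + 1 by omega]
  · rw [← Walk.IsPath.getVert_injOn_iff]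
    intro i hi j hj hij
    simp only [Set.mem_ofPred_eq] at hi hj
    rw [hv i (by omega), hv j (by omega)] at hij
    by_contra hne
    rcases Nat.lt_or_gt_of_ne hne with h1 | h1
    · exact hinj (s + i) (s + j) (by omega) (by omega) (by omega) hij
    · exact hinj (s + j) (s + i) (by omega) (by omega) (by omega) hij.symm

/-! ### Cycles made of two paths -/

theorem Nonagonal.nine_le_of_ne (hG : Nonagonal G) {a b : V} {p q : G.Walk a b} (hp : p.IsPath)
    (hq : q.IsPath) (h : p ≠ q) : 9 ≤ p.length + q.length := by
  obtain ⟨v, -, -, c, hc, hl⟩ := hp.exists_isCycle_length_le_add_of_ne hq h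
  exact (hG.nine_le_of_isCycle _ _ hc).trans hl

theorem isCycle_append_reverse {a b : V} {p q : G.Walk a b} (hp : p.IsPath) (hq : q.IsPath)
    (hab : a ≠ b) (hd : ∀ x ∈ p.support, x ∈ q.support → x = a ∨ x = b)
    (hl : 3 ≤ p.length + q.length) : (p.append q.reverse).IsCycle := by
  refine hp.isCycle_append hq.reverse ?_ (by rw [Walk.length_reverse]; omega)
  rw [List.disjoint_left]
  intro x hx hx'
  have hxp := List.mem_of_mem_tail hx
  have hxq : x ∈ q.support := by simpa using List.mem_of_mem_tail hx'
  have h1 := hp.support_nodup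
  have h2 := hq.reverse.support_nodup
  rw [← Walk.cons_tail_support, List.nodup_cons] at h1 h2
  rcases hd x hxp hxq with rfl | rfl
  · exact h1.1 hx
  · exact h2.1 hx'

/-- Two internally disjoint paths with the same ends, without chords of their union, form a hole. -/
theorem Nonagonal.isHole_append_reverse (hG : Nonagonal G) {a b : V} {p q : G.Walk a b}
    (hp : p.IsPath) (hq : q.IsPath) (hab : a ≠ b)
    (hd : ∀ x ∈ p.support, x ∈ q.support → x = a ∨ x = b)
    (hl : 3 ≤ p.length + q.length)
    (hc : ∀ x y, x ∈ p.support ∨ x ∈ q.support → y ∈ p.support ∨ y ∈ q.support → G.Adj x y →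
      s(x, y) ∈ p.edges ∨ s(x, y) ∈ q.edges) : IsHole (p.append q.reverse) := by
  have hcyc := isCycle_append_reverse hp hq hab hd hl
  refine ⟨hcyc, by have := hG.nine_le_of_isCycle _ _ hcyc; omega, ?_⟩
  rw [Walk.isInduced_toSubgraph, Walk.isChordless_iff_forall_mem_edges]
  intro x y hx hy hxy
  simp only [Walk.mem_support_append_iff, Walk.support_reverse, List.mem_reverse] at hx hy
  simpa using hc x y hx hy hxy

theorem Nonagonal.add_length_eq_nine (hG : Nonagonal G) {a b : V} {p q : G.Walk a b}
    (hp : p.IsPath) (hq : q.IsPath) (hab : a ≠ b)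
    (hd : ∀ x ∈ p.support, x ∈ q.support → x = a ∨ x = b)
    (hc : ∀ x y, x ∈ p.support ∨ x ∈ q.support → y ∈ p.support ∨ y ∈ q.support → G.Adj x y →
      s(x, y) ∈ p.edges ∨ s(x, y) ∈ q.edges)
    (hodd : (p.length + q.length) % 2 = 1) : p.length + q.length = 9 := by
  have h1 : p.length ≠ 0 := fun h => hab (Walk.eq_of_length_eq_zero h)
  have h2 : q.length ≠ 0 := fun h => hab (Walk.eq_of_length_eq_zero h)
  have := hG.eq_nine_of_isOddHole _ _
    ⟨hG.isHole_append_reverse hp hq hab hd (by omega) hc, by simpa [Nat.odd_iff] using hodd⟩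
  simpa using this

/-! ### Nonagons -/

/-- A hole of length `9`, given as a `9`-periodic sequence of vertices. -/
structure IsNonagon (G : SimpleGraph V) (c : ℕ → V) : Prop where
  eq_iff : ∀ i j, c i = c j ↔ i % 9 = j % 9
  adj_iff : ∀ i j, G.Adj (c i) (c j) ↔ (i + 1) % 9 = j % 9 ∨ (j + 1) % 9 = i % 9

/-- A shortest odd closed walk in a vertex set is a hole, hence has length `9`. -/
theorem Nonagonal.exists_isNonagon (hG : Nonagonal G) {X : Set V} {f : ℕ → V} {n : ℕ}
    (hn : n % 2 = 1) (hadj : ∀ i < n, G.Adj (f i) (f (i + 1))) (hclosed : f n = f 0)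
    (hX : ∀ i ≤ n, f i ∈ X) : ∃ c, IsNonagon G c ∧ ∀ i, c i ∈ X := by
  classical
  have hex : ∃ n, n % 2 = 1 ∧ ∃ f : ℕ → V, (∀ i < n, G.Adj (f i) (f (i + 1))) ∧ f n = f 0 ∧
      ∀ i ≤ n, f i ∈ X := ⟨n, hn, f, hadj, hclosed, hX⟩
  clear hn hadj hclosed hX
  obtain ⟨hn, f, hadj, hclosed, hX⟩ := Nat.find_spec hex
  have hmin := fun m => Nat.find_min (H := hex) (m := m)
  generalize Nat.find hex = n at *
  have hn1 : n ≠ 1 := by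
    rintro rfl
    have := hadj 0 (by omega)
    rw [hclosed] at this
    exact G.loopless.irrefl _ this
  -- Two equal (`e = 0`) or adjacent (`e = 1`) vertices split the closed walk into two shorter
  -- ones, one of which is odd.
  have key : ∀ i j, i < j → j < n → (f i = f j → False) ∧
      (G.Adj (f i) (f j) → j = i + 1 ∨ (i = 0 ∧ j + 1 = n)) := by
    intro i j hij hjn
    constructor
    · intro heq
      by_cases hpar : (j - i) % 2 = 1
      · refine hmin (j - i) (by omega) ⟨hpar, fun k => f (i + k), fun k hk => ?_, ?_, fun k hk => ?_⟩
        · exact hadj (i + k) (by omega)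
        · simp only [add_zero]; rw [heq]; congr 1; omega
        · exact hX _ (by omega)
      · refine hmin (n - (j - i)) (by omega) ⟨by omega,
          fun k => if k ≤ i then f k else f (k + (j - i)), fun k hk => ?_, ?_, fun k hk => ?_⟩
        · dsimp only
          split_ifs with h1 h2 h2
          · exact hadj k (by omega)
          · obtain rfl : k = i := by omega
            rw [heq, show k + 1 + (j - k) = j + 1 by omega]
            exact hadj j hjn
          · omega
          · rw [show k + 1 + (j - i) = k + (j - i) + 1 by omega]
            exact hadj _ (by omega)
        · dsimp only
          rw [if_neg (by omega), if_pos (by omega), show n - (j - i) + (j - i) = n by omega, hclosed]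
        · dsimp only
          split_ifs
          · exact hX _ (by omega)
          · exact hX _ (by omega)
    · intro hA
      by_contra hcon
      by_cases hpar : (j - i) % 2 = 0
      · refine hmin (j - i + 1) (by omega) ⟨by omega,
          fun k => if k ≤ j - i then f (i + k) else f i, fun k hk => ?_, ?_, fun k hk => ?_⟩
        · dsimp only
          split_ifs with h1 h2 h2
          · exact hadj (i + k) (by omega)
          · obtain rfl : k = j - i := by omega
            rw [show i + (j - i) = j by omega]
            exact hA.symm
          · omega
          · omega
        · dsimp only
          rw [if_neg (by omega), if_pos (by omega), add_zero]
        · dsimp only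
          split_ifs
          · exact hX _ (by omega)
          · exact hX _ (by omega)
      · refine hmin (n - (j - i) + 1) (by omega) ⟨by omega,
          fun k => if k ≤ i then f k else f (k + (j - i) - 1), fun k hk => ?_, ?_, fun k hk => ?_⟩
        · dsimp only
          split_ifs with h1 h2 h2
          · exact hadj k (by omega)
          · obtain rfl : k = i := by omega
            rw [show k + 1 + (j - k) - 1 = j by omega]
            exact hA
          · omega
          · rw [show k + 1 + (j - i) - 1 = k + (j - i) - 1 + 1 by omega]
            exact hadj _ (by omega)
        · dsimp only
          rw [if_neg (by omega), if_pos (by omega), show n - (j - i) + 1 + (j - i) - 1 = n by omega,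
            hclosed]
        · dsimp only
          split_ifs
          · exact hX _ (by omega)
          · exact hX _ (by omega)
  have hlast : G.Adj (f 0) (f (n - 1)) := by
    have := hadj (n - 1) (by omega)
    rw [show n - 1 + 1 = n by omega, hclosed] at this
    exact this.symm
  obtain ⟨p, hpl, hps, hpe, hpp⟩ := exists_segment (G := G) (f := f) (s := 0) (t := n - 1)
    (by omega) fun i _ hi => hadj i (by omega)
  have hp : p.IsPath := hpp fun i j _ hij hj => (key i j hij (by omega)).1
  have h9 : n = 9 := by
    have := hG.add_length_eq_nine hp (q := hlast.toWalk) (by simp [hlast.ne]) hlast.ne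
      (by intro x _ hx; simpa using hx) ?_ (by simp [hpl]; omega)
    · simp [hpl] at this; omega
    · intro x y hx hy hxy
      have hmem : ∀ x, x ∈ p.support ∨ x ∈ hlast.toWalk.support → ∃ i, i < n ∧ x = f i := by
        intro x hx
        rcases hx with hx | hx
        · obtain ⟨i, _, hi, rfl⟩ := (hps x).1 hx
          exact ⟨i, by omega, rfl⟩
        · have : x = f 0 ∨ x = f (n - 1) := by simpa using hx
          rcases this with rfl | rfl
          · exact ⟨0, by omega, rfl⟩
          · exact ⟨n - 1, by omega, rfl⟩
      obtain ⟨i, hi, rfl⟩ := hmem x hx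
      obtain ⟨j, hj, rfl⟩ := hmem y hy
      have main : ∀ i j, i < j → j < n → G.Adj (f i) (f j) →
          s(f i, f j) ∈ p.edges ∨ s(f i, f j) ∈ hlast.toWalk.edges := by
        intro i j hij hj hA
        rcases (key i j hij hj).2 hA with rfl | ⟨rfl, hj'⟩
        · exact Or.inl (hpe i (by omega) (by omega))
        · obtain rfl : j = n - 1 := by omega
          right; simp
      rcases lt_trichotomy i j with h | rfl | h
      · exact main i j h hj hxy
      · exact (G.loopless.irrefl _ hxy).elim
      · rw [Sym2.eq_swap]; exact main j i h hi hxy.symm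
  subst h9
  refine ⟨fun i => f (i % 9), ⟨fun i j => ?_, fun i j => ?_⟩, fun i => hX _ (by omega)⟩
  · constructor
    · intro h
      by_contra hne
      rcases Nat.lt_or_gt_of_ne hne with h1 | h1
      · exact (key _ _ h1 (by omega)).1 h
      · exact (key _ _ h1 (by omega)).1 h.symm
    · intro h; rw [h]
  · constructor
    · intro h
      rcases lt_trichotomy (i % 9) (j % 9) with h1 | h1 | h1
      · have := (key _ _ h1 (by omega)).2 h; omega
      · rw [h1] at h; exact (G.loopless.irrefl _ h).elim
      · have := (key _ _ h1 (by omega)).2 h.symm; omega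
    · have step : ∀ a b, (a + 1) % 9 = b % 9 → G.Adj (f (a % 9)) (f (b % 9)) := by
        intro a b hab
        by_cases h8 : a % 9 = 8
        · rw [h8, show b % 9 = 0 by omega]; exact hlast.symm
        · rw [show b % 9 = a % 9 + 1 by omega]; exact hadj _ (by omega)
      rintro (h | h)
      · exact step _ _ h
      · exact (step _ _ h).symm

/-! ### Induced sequences and shortest connections -/

/-- The vertices `p s, …, p t` induce a path of `G`, in this order. -/
structure IsInducedSeq (G : SimpleGraph V) (p : ℕ → V) (s t : ℕ) : Prop where
  adj : ∀ i, s ≤ i → i < t → G.Adj (p i) (p (i + 1))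
  ne : ∀ i j, s ≤ i → i < j → j ≤ t → p i ≠ p j
  chord : ∀ i j, s ≤ i → i < j → j ≤ t → G.Adj (p i) (p j) → j = i + 1

theorem IsInducedSeq.mono {p : ℕ → V} {s t s' t' : ℕ} (h : IsInducedSeq G p s t) (hs : s ≤ s')
    (ht : t' ≤ t) : IsInducedSeq G p s' t' :=
  ⟨fun i hi hit => h.adj i (by omega) (by omega),
    fun i j hi hij hj => h.ne i j (by omega) hij (by omega),
    fun i j hi hij hj => h.chord i j (by omega) hij (by omega)⟩

/-- A shortest walk inside `U` among those whose ends are related by `Rel`: it is induced, and no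
proper segment of it joins related vertices. -/
theorem exists_geodesic (U : Set V) (Rel : V → V → Prop) {x y : V} (w : G.Walk x y)
    (hw : ∀ z ∈ w.support, z ∈ U) (hxy : Rel x y) :
    ∃ (k : ℕ) (p : ℕ → V), IsInducedSeq G p 0 k ∧ (∀ i ≤ k, p i ∈ U) ∧ Rel (p 0) (p k) ∧
      ∀ i j, i ≤ j → j ≤ k → Rel (p i) (p j) → i = 0 ∧ j = k := by
  classical
  have hex : ∃ k, ∃ p : ℕ → V, (∀ i < k, G.Adj (p i) (p (i + 1))) ∧ (∀ i ≤ k, p i ∈ U) ∧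
      Rel (p 0) (p k) :=
    ⟨w.length, w.getVert, fun i hi => w.adj_getVert_succ hi,
      fun i _ => hw _ (w.getVert_mem_support i), by simpa using hxy⟩
  obtain ⟨p, hadj, hU, hrel⟩ := Nat.find_spec hex
  have hmin := fun m => Nat.find_min (H := hex) (m := m)
  generalize Nat.find hex = k at *
  refine ⟨k, p, ⟨fun i _ hi => hadj i hi, fun i j _ hij hj heq => ?_, fun i j _ hij hj hA => ?_⟩,
    hU, hrel, fun i j hij hj hR => ?_⟩
  · refine hmin (k - (j - i)) (by omega) ⟨fun m => if m ≤ i then p m else p (m + (j - i)),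
      fun m hm => ?_, fun m hm => ?_, ?_⟩
    · dsimp only
      split_ifs with h1 h2 h2
      · exact hadj m (by omega)
      · obtain rfl : m = i := by omega
        rw [heq, show m + 1 + (j - m) = j + 1 by omega]
        exact hadj j (by omega)
      · omega
      · rw [show m + 1 + (j - i) = m + (j - i) + 1 by omega]
        exact hadj _ (by omega)
    · dsimp only
      split_ifs <;> exact hU _ (by omega)
    · dsimp only
      rw [if_pos (by omega)]
      split_ifs with h1
      · obtain rfl : j = k := by omega
        rw [show j - (j - i) = i by omega, heq]; exact hrel
      · rw [show k - (j - i) + (j - i) = k by omega]; exact hrel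
  · by_contra hne
    refine hmin (k - (j - i) + 1) (by omega) ⟨fun m => if m ≤ i then p m else p (m + (j - i) - 1),
      fun m hm => ?_, fun m hm => ?_, ?_⟩
    · dsimp only
      split_ifs with h1 h2 h2
      · exact hadj m (by omega)
      · obtain rfl : m = i := by omega
        rw [show m + 1 + (j - m) - 1 = j by omega]
        exact hA
      · omega
      · rw [show m + 1 + (j - i) - 1 = m + (j - i) - 1 + 1 by omega]
        exact hadj _ (by omega)
    · dsimp only
      split_ifs <;> exact hU _ (by omega)
    · dsimp only
      rw [if_pos (by omega), if_neg (by omega), show k - (j - i) + 1 + (j - i) - 1 = k by omega]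
      exact hrel
  · by_contra hne
    refine hmin (j - i) (by omega) ⟨fun m => p (i + m), fun m hm => hadj (i + m) (by omega),
      fun m hm => hU _ (by omega), ?_⟩
    dsimp only
    rw [add_zero, show i + (j - i) = j by omega]
    exact hR

/-! ### Paths attached to a vertex set -/

/-- `R` is an induced path with both ends in `F` and all other vertices outside `F`, and each edge
between its interior and `F` is an edge of `R` or has its end of `F` in `Z`. -/
structure IsAttached (F Z : Set V) {a b : V} (R : G.Walk a b) : Prop where
  isPath : R.IsPath
  ne : a ≠ b
  left_mem : a ∈ F
  right_mem : b ∈ F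
  meets : ∀ x ∈ R.support, x ∈ F → x = a ∨ x = b
  chord : ∀ x ∈ R.support, ∀ y ∈ R.support, G.Adj x y → s(x, y) ∈ R.edges ∨ (x ∈ F ∧ y ∈ F)
  attach : ∀ x ∈ R.support, ∀ y ∈ F, G.Adj x y → s(x, y) ∈ R.edges ∨ x ∈ F ∨ y ∈ Z

theorem IsAttached.mono {F Z F' Z' : Set V} {a b : V} {R : G.Walk a b} (h : IsAttached F Z R)
    (hF : F' ⊆ F) (ha : a ∈ F') (hb : b ∈ F') (hZ : ∀ x ∈ F', x ∈ Z → x ∈ Z') :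
    IsAttached F' Z' R := by
  have key : ∀ x ∈ R.support, x ∈ F → x ∈ F' := fun x hx hxF => by
    rcases h.meets x hx hxF with rfl | rfl <;> assumption
  refine ⟨h.isPath, h.ne, ha, hb, fun x hx hxF => h.meets x hx (hF hxF), fun x hx y hy hxy => ?_,
    fun x hx y hy hxy => ?_⟩
  · rcases h.chord x hx y hy hxy with h1 | h1
    · exact Or.inl h1
    · exact Or.inr ⟨key x hx h1.1, key y hy h1.2⟩
  · rcases h.attach x hx y (hF hy) hxy with h1 | h1 | h1
    · exact Or.inl h1
    · exact Or.inr (Or.inl (key x hx h1))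
    · exact Or.inr (Or.inr (hZ y hy h1))

theorem IsAttached.reverse {F Z : Set V} {a b : V} {R : G.Walk a b} (h : IsAttached F Z R) :
    IsAttached F Z R.reverse := by
  refine ⟨h.isPath.reverse, h.ne.symm, h.right_mem, h.left_mem, fun x hx hxF => ?_,
    fun x hx y hy hxy => ?_, fun x hx y hy hxy => ?_⟩ <;>
    simp only [Walk.support_reverse, List.mem_reverse, Walk.edges_reverse] at *
  · exact (h.meets x hx hxF).symm
  · exact h.chord x hx y hy hxy
  · exact h.attach x hx y hy hxy

theorem IsAttached.add_length_eq_nine (hG : Nonagonal G) {F Z : Set V} {a b : V} {R q : G.Walk a b}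
    (hR : IsAttached F Z R) (hq : q.IsPath) (hqF : ∀ x ∈ q.support, x ∈ F)
    (hqZ : ∀ x ∈ q.support, x ∉ Z)
    (hqc : ∀ x ∈ q.support, ∀ y ∈ q.support, G.Adj x y → s(x, y) ∈ q.edges)
    (hodd : (R.length + q.length) % 2 = 1) : R.length + q.length = 9 := by
  have hend : ∀ x ∈ R.support, x ∈ F → x ∈ q.support := fun x hx hxF => by
    rcases hR.meets x hx hxF with rfl | rfl <;> simp
  have hmix : ∀ x ∈ R.support, ∀ y ∈ q.support, G.Adj x y →
      s(x, y) ∈ R.edges ∨ s(x, y) ∈ q.edges := fun x hx y hy hxy => by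
    rcases hR.attach x hx y (hqF y hy) hxy with h1 | h1 | h1
    · exact Or.inl h1
    · exact Or.inr (hqc x (hend x hx h1) y hy hxy)
    · exact (hqZ y hy h1).elim
  refine hG.add_length_eq_nine hR.isPath hq hR.ne (fun x hx hx' => hR.meets x hx (hqF x hx')) ?_ hodd
  intro x y hx hy hxy
  rcases hx with hx | hx <;> rcases hy with hy | hy
  · rcases hR.chord x hx y hy hxy with h1 | h1
    · exact Or.inl h1
    · exact Or.inr (hqc x (hend x hx h1.1) y (hend y hy h1.2) hxy)
  · exact hmix x hx y hy hxy
  · rw [Sym2.eq_swap]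
    exact hmix y hy x hx hxy.symm
  · exact Or.inr (hqc x hx y hy hxy)

/-- An induced sequence outside `F` whose ends see `f` and `g` in `F` yields an attached path. -/
theorem IsAttached.of_seq {F Z : Set V} {p : ℕ → V} {s t : ℕ} (hst : s ≤ t)
    (hp : IsInducedSeq G p s t) (hF : ∀ i, s ≤ i → i ≤ t → p i ∉ F) {f g : V} (hf : f ∈ F)
    (hg : g ∈ F) (hfg : f ≠ g) (hfZ : f ∉ Z) (hgZ : g ∉ Z) (hfs : G.Adj f (p s)) (hgt : G.Adj (p t) g)
    (hatt : ∀ i, s ≤ i → i ≤ t → ∀ h ∈ F, G.Adj (p i) h → (i = s ∧ h = f) ∨ (i = t ∧ h = g) ∨ h ∈ Z) :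
    ∃ R : G.Walk f g, IsAttached F Z R ∧ R.length = t - s + 2 ∧
      ∀ x, x ∈ R.support ↔ x = f ∨ x = g ∨ ∃ i, s ≤ i ∧ i ≤ t ∧ x = p i := by
  obtain ⟨w, hl, hs, he, hpath⟩ := exists_segment hst hp.adj
  have hw := hpath hp.ne
  have hout : ∀ x ∈ w.support, x ∉ F := fun x hx => by
    obtain ⟨i, h1, h2, rfl⟩ := (hs x).1 hx
    exact hF i h1 h2
  have hsup : ∀ x, x ∈ (Walk.cons hfs (w.concat hgt)).support ↔ x = f ∨ x = g ∨ x ∈ w.support := by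
    intro x
    simp [Walk.support_concat]
    tauto
  have hedge : ∀ e, e ∈ (Walk.cons hfs (w.concat hgt)).edges ↔
      e = s(f, p s) ∨ e = s(p t, g) ∨ e ∈ w.edges := by
    intro e
    simp [Walk.edges_concat]
    tauto
  have hend : ∀ x ∈ w.support, ∀ y ∈ F, G.Adj x y →
      s(x, y) ∈ (Walk.cons hfs (w.concat hgt)).edges ∨ y ∈ Z := by
    intro x hx y hy hxy
    obtain ⟨i, h1, h2, rfl⟩ := (hs x).1 hx
    rcases hatt i h1 h2 y hy hxy with ⟨rfl, rfl⟩ | ⟨rfl, rfl⟩ | h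
    · rw [hedge, Sym2.eq_swap]; exact Or.inl (Or.inl rfl)
    · rw [hedge]; exact Or.inl (Or.inr (Or.inl rfl))
    · exact Or.inr h
  refine ⟨Walk.cons hfs (w.concat hgt), ⟨?_, hfg, hf, hg, ?_, ?_, ?_⟩, by simp [hl], ?_⟩
  · rw [Walk.cons_isPath_iff, Walk.concat_isPath_iff]
    refine ⟨⟨hw, fun h => hout g h hg⟩, fun h => ?_⟩
    rw [Walk.support_concat] at h
    simp only [List.mem_append, List.mem_singleton] at h
    rcases h with h | h
    · exact hout f h hf
    · exact hfg h
  · intro x hx hxF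
    rcases (hsup x).1 hx with h | h | h
    · exact Or.inl h
    · exact Or.inr h
    · exact (hout x h hxF).elim
  · have hww : ∀ x ∈ w.support, ∀ y ∈ w.support, G.Adj x y → s(x, y) ∈ w.edges := by
      intro x hx y hy hxy
      obtain ⟨i, h1, h2, rfl⟩ := (hs x).1 hx
      obtain ⟨j, h3, h4, rfl⟩ := (hs y).1 hy
      rcases lt_trichotomy i j with hij | rfl | hij
      · obtain rfl := hp.chord i j h1 hij h4 hxy
        exact he i h1 (by omega)
      · exact (G.loopless.irrefl _ hxy).elim
      · obtain rfl := hp.chord j i h3 hij h2 hxy.symm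
        rw [Sym2.eq_swap]
        exact he j h3 (by omega)
    have hwe : ∀ x ∈ w.support, ∀ y, y = f ∨ y = g → G.Adj x y →
        s(x, y) ∈ (Walk.cons hfs (w.concat hgt)).edges := by
      rintro x hx y hy hxy
      rcases hend x hx y (by rcases hy with rfl | rfl <;> assumption) hxy with h | h
      · exact h
      · rcases hy with rfl | rfl
        · exact (hfZ h).elim
        · exact (hgZ h).elim
    intro x hx y hy hxy
    have hends : ∀ z, z = f ∨ z = g → z ∈ F := by rintro z (rfl | rfl) <;> assumption
    rw [hsup, ← or_assoc] at hx hy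
    rcases hx with hx | hx <;> rcases hy with hy | hy
    · exact Or.inr ⟨hends x hx, hends y hy⟩
    · rw [Sym2.eq_swap]
      exact Or.inl (hwe y hy x hx hxy.symm)
    · exact Or.inl (hwe x hx y hy hxy)
    · exact Or.inl ((hedge _).2 (Or.inr (Or.inr (hww x hx y hy hxy))))
  · intro x hx y hy hxy
    rcases (hsup x).1 hx with rfl | rfl | h
    · exact Or.inr (Or.inl hf)
    · exact Or.inr (Or.inl hg)
    · rcases hend x h y hy hxy with h1 | h1
      · exact Or.inl h1
      · exact Or.inr (Or.inr h1)
  · intro x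
    rw [hsup, hs]

theorem IsAttached.mem_edges_or {F : Set V} {a b x y : V} {R : G.Walk a b} (hR : IsAttached F ∅ R)
    (hx : x ∈ F ∨ x ∈ R.support) (hy : y ∈ F ∨ y ∈ R.support) (hxy : G.Adj x y) :
    s(x, y) ∈ R.edges ∨ x ∈ F ∧ y ∈ F := by
  have key : ∀ x ∈ R.support, ∀ y, y ∈ F ∨ y ∈ R.support → G.Adj x y →
      s(x, y) ∈ R.edges ∨ x ∈ F ∧ y ∈ F := by
    intro x hx y hy hxy
    rcases hy with hy | hy
    · rcases hR.attach x hx y hy hxy with h | h | h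
      · exact Or.inl h
      · exact Or.inr ⟨h, hy⟩
      · exact h.elim
    · exact hR.chord x hx y hy hxy
  rcases hx with hx | hx
  · rcases hy with hy | hy
    · exact Or.inr ⟨hx, hy⟩
    · rw [Sym2.eq_swap, and_comm]
      exact key y hy x (Or.inl hx) hxy.symm
  · exact key x hx y hy hxy

/-! ### Avoiding an induced path on three vertices -/

/-- The vertex set of the component of `G - F` containing `z`. -/
def outside (G : SimpleGraph V) (F : Set V) (z : V) : Set V :=
  {x | ∃ w : G.Walk z x, ∀ y ∈ w.support, y ∉ F}

theorem mem_outside_self {F : Set V} {z : V} (hz : z ∉ F) : z ∈ outside G F z :=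
  ⟨.nil, by simpa using hz⟩

theorem notMem_of_mem_outside {F : Set V} {z x : V} (hx : x ∈ outside G F z) : x ∉ F := by
  obtain ⟨w, hw⟩ := hx
  exact hw _ w.end_mem_support

theorem mem_outside_of_adj {F : Set V} {z x y : V} (hx : x ∈ outside G F z) (hxy : G.Adj x y)
    (hy : y ∉ F) : y ∈ outside G F z := by
  obtain ⟨w, hw⟩ := hx
  refine ⟨w.concat hxy, fun u hu => ?_⟩
  rw [Walk.support_concat] at hu
  simp only [List.mem_append, List.mem_singleton] at hu
  rcases hu with hu | rfl
  · exact hw u hu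
  · exact hy

theorem mem_outside_of_walk {F : Set V} {z x y : V} (hx : x ∈ outside G F z) (w : G.Walk x y)
    (hw : ∀ u ∈ w.support, u ∉ F) : ∀ u ∈ w.support, u ∈ outside G F z := by
  induction w with
  | nil => intro u hu; rw [Walk.support_nil, List.mem_singleton] at hu; exact hu ▸ hx
  | cons h w ih =>
    intro u hu
    rw [Walk.support_cons, List.mem_cons] at hu
    rcases hu with rfl | hu
    · exact hx
    · exact ih (mem_outside_of_adj hx h (hw _ (by simp))) (fun v hv => hw v (by simp [hv])) u hu

theorem outside_connected {F : Set V} {z x y : V} (hx : x ∈ outside G F z)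
    (hy : y ∈ outside G F z) : ∃ w : G.Walk x y, ∀ u ∈ w.support, u ∈ outside G F z := by
  have hz : z ∈ outside G F z := by
    obtain ⟨w, hw⟩ := hx
    exact mem_outside_self (hw z w.start_mem_support)
  obtain ⟨w, hw⟩ := hx
  obtain ⟨w', hw'⟩ := hy
  refine ⟨w.reverse.append w', fun u hu => ?_⟩
  simp only [Walk.mem_support_append_iff, Walk.support_reverse, List.mem_reverse] at hu
  rcases hu with hu | hu
  · exact mem_outside_of_walk hz w hw u hu
  · exact mem_outside_of_walk hz w' hw' u hu

/-- A walk from outside `F` into `F` avoiding `X` first meets `F` in a vertex not in `X`. -/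
theorem exists_first_hit {F X : Set V} {z b : V} (w : G.Walk z b) (hz : z ∉ F) (hb : b ∈ F)
    (hw : ∀ y ∈ w.support, y ∉ X) : ∃ x ∈ outside G F z, ∃ f ∈ F, f ∉ X ∧ G.Adj x f := by
  suffices h : ∀ {z' : V} (w : G.Walk z' b), z' ∈ outside G F z → (∀ y ∈ w.support, y ∉ X) →
      ∃ x ∈ outside G F z, ∃ f ∈ F, f ∉ X ∧ G.Adj x f from h w (mem_outside_self hz) hw
  clear w hw
  intro z' w hz' hw
  induction w with
  | nil => exact (notMem_of_mem_outside hz' hb).elim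
  | @cons u v _ h w ih =>
    by_cases hv : v ∈ F
    · exact ⟨u, hz', v, hv, hw v (by simp), h⟩
    · exact ih hb (mem_outside_of_adj hz' h hv) fun y hy => hw y (by simp [hy])

theorem nonempty_induce_iso_pathGraph {x₁ x₂ x₃ : V} (h12 : G.Adj x₁ x₂) (h23 : G.Adj x₂ x₃)
    (hne : x₁ ≠ x₃) (h13 : ¬ G.Adj x₁ x₃) :
    Nonempty (G.induce ({x₁, x₂, x₃} : Set V) ≃g pathGraph 3) := by
  have hmem : ∀ i : Fin 3, ![x₁, x₂, x₃] i ∈ ({x₁, x₂, x₃} : Set V) := by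
    intro i; fin_cases i <;> simp
  have hinj : ∀ i j : Fin 3, ![x₁, x₂, x₃] i = ![x₁, x₂, x₃] j → i = j := by
    intro i j hij
    fin_cases i <;> fin_cases j <;>
      simp [h12.ne, h12.ne.symm, h23.ne, h23.ne.symm, hne, hne.symm] at hij ⊢
  have hadj : ∀ i j : Fin 3, G.Adj (![x₁, x₂, x₃] i) (![x₁, x₂, x₃] j) ↔ (pathGraph 3).Adj i j := by
    have h31 : ¬ G.Adj x₃ x₁ := fun h => h13 h.symm
    intro i j
    fin_cases i <;> fin_cases j <;> simp [pathGraph_adj, h12, h23, h13, h31, h12.symm, h23.symm]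
  let φ : Fin 3 ≃ ({x₁, x₂, x₃} : Set V) := Equiv.ofBijective (fun i => ⟨_, hmem i⟩)
    ⟨fun i j hij => hinj i j (congrArg Subtype.val hij), by
      rintro ⟨x, rfl | rfl | rfl⟩
      exacts [⟨0, rfl⟩, ⟨1, rfl⟩, ⟨2, rfl⟩]⟩
  exact ⟨RelIso.symm ⟨φ, fun {i j} => hadj i j⟩⟩

theorem exists_walk_of_not_hasP3Cut (hP3 : ¬ HasP3Cut G) {x₁ x₂ x₃ z b : V} (h12 : G.Adj x₁ x₂)
    (h23 : G.Adj x₂ x₃) (hne : x₁ ≠ x₃) (h13 : ¬ G.Adj x₁ x₃)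
    (hz : z ∉ ({x₁, x₂, x₃} : Set V)) (hb : b ∉ ({x₁, x₂, x₃} : Set V)) (hr : G.Reachable z b) :
    ∃ w : G.Walk z b, ∀ y ∈ w.support, y ∉ ({x₁, x₂, x₃} : Set V) := by
  set X : Set V := {x₁, x₂, x₃}
  have hreach : (G.induce Xᶜ).Reachable ⟨z, hz⟩ ⟨b, hb⟩ := by
    by_contra hcon
    exact hP3 ⟨X, ⟨⟨z, hz⟩, ⟨b, hb⟩, hr, hcon⟩, nonempty_induce_iso_pathGraph h12 h23 hne h13⟩
  obtain ⟨w⟩ := hreach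
  refine ⟨w.map (Embedding.induce Xᶜ).toHom, fun y hy => ?_⟩
  obtain ⟨y', -, rfl⟩ := List.mem_map.1
    ((congrArg (y ∈ ·) (Walk.support_map (Embedding.induce (G := G) Xᶜ).toHom w)).mp hy)
  exact y'.2

/-- If the induced path `x₁x₂x₃` in `F` is no cut, a shortest path outside `F` leads from a
neighbour of `x₂` to a neighbour of `F \ {x₁, x₂, x₃}`. -/
theorem exists_escape (hP3 : ¬ HasP3Cut G) {F : Set V} {x₁ x₂ x₃ z b : V} (h12 : G.Adj x₁ x₂)
    (h23 : G.Adj x₂ x₃) (hne : x₁ ≠ x₃) (h13 : ¬ G.Adj x₁ x₃) (hX : ({x₁, x₂, x₃} : Set V) ⊆ F)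
    (hzF : z ∉ F) (hz : G.Adj z x₂) (hbF : b ∈ F) (hb : b ∉ ({x₁, x₂, x₃} : Set V))
    (hr : G.Reachable x₂ b) :
    ∃ (k : ℕ) (p : ℕ → V), IsInducedSeq G p 0 k ∧ (∀ i ≤ k, p i ∈ outside G F z) ∧
      G.Adj (p 0) x₂ ∧ (∃ y ∈ F, y ∉ ({x₁, x₂, x₃} : Set V) ∧ G.Adj (p k) y) ∧
      (∀ i ≤ k, G.Adj (p i) x₂ → i = 0) ∧
      (∀ i ≤ k, ∀ y ∈ F, y ∉ ({x₁, x₂, x₃} : Set V) → G.Adj (p i) y → i = k) := by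
  obtain ⟨w, hw⟩ := exists_walk_of_not_hasP3Cut hP3 h12 h23 hne h13 (fun h => hzF (hX h)) hb
    (hz.reachable.trans hr)
  obtain ⟨x, hx, f, hf, hfX, hxf⟩ := exists_first_hit w hzF hbF hw
  obtain ⟨w', hw'⟩ := outside_connected (mem_outside_self hzF) hx
  obtain ⟨k, p, hp, hU, ⟨h0, hk⟩, hmin⟩ := exists_geodesic (outside G F z)
    (fun x y => G.Adj x x₂ ∧ ∃ f ∈ F, f ∉ ({x₁, x₂, x₃} : Set V) ∧ G.Adj y f) w' hw'
    ⟨hz, f, hf, hfX, hxf⟩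
  exact ⟨k, p, hp, hU, h0, hk, fun i hi h => (hmin i k hi le_rfl ⟨h, hk⟩).1,
    fun i hi y hy hyX h => (hmin 0 i (by omega) hi ⟨h0, y, hy, hyX, h⟩).2⟩

/-! ### Induced theta graphs -/

/-- Three internally disjoint paths `S`, `A`, `P` with the same ends, without chords of their
union, of lengths `d`, `9 - d`, `9 - d` where `2 ≤ d ≤ 4`: two nonagons that share the short
path `S`. -/
structure IsTheta (d : ℕ) {u v : V} (S A P : G.Walk u v) : Prop where
  two_le : 2 ≤ d
  le_four : d ≤ 4
  isPath_S : S.IsPath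
  isPath_A : A.IsPath
  isPath_P : P.IsPath
  length_S : S.length = d
  length_A : A.length = 9 - d
  length_P : P.length = 9 - d
  disj_SA : ∀ x ∈ S.support, x ∈ A.support → x = u ∨ x = v
  disj_SP : ∀ x ∈ S.support, x ∈ P.support → x = u ∨ x = v
  disj_AP : ∀ x ∈ A.support, x ∈ P.support → x = u ∨ x = v
  chord : ∀ x y, x ∈ S.support ∨ x ∈ A.support ∨ x ∈ P.support →
    y ∈ S.support ∨ y ∈ A.support ∨ y ∈ P.support → G.Adj x y →
    s(x, y) ∈ S.edges ∨ s(x, y) ∈ A.edges ∨ s(x, y) ∈ P.edges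

theorem length_eq_one_of_edge_ends {a b x y : V} {p : G.Walk a b} (hp : p.IsPath)
    (he : s(x, y) ∈ p.edges) (hx : x = a ∨ x = b) (hy : y = a ∨ y = b) : p.length = 1 := by
  have hne := (p.adj_of_mem_edges he).ne
  rcases hx with rfl | rfl <;> rcases hy with rfl | rfl
  · exact (hne rfl).elim
  · exact hp.length_eq_one_of_mem_edges he
  · exact hp.length_eq_one_of_mem_edges (Sym2.eq_swap ▸ he)
  · exact (hne rfl).elim

theorem IsAttached.ne_walk {F Z : Set V} {a b : V} {R q : G.Walk a b} (hR : IsAttached F Z R)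
    (hq : ∀ x ∈ q.support, x ∈ F) (hl : 2 ≤ q.length) : R ≠ q := by
  rintro rfl
  have h1 := R.getVert_mem_support 1
  rcases hR.meets _ h1 (hq _ h1) with h | h
  · have := (hR.isPath.getVert_eq_start_iff (by omega)).1 h; omega
  · have := (hR.isPath.getVert_eq_end_iff (by omega)).1 h; omega

/-- A path that joins two vertices of a nonagon at distance `d ≥ 2` and is otherwise unrelated to
it has length `9 - d`: by parity it replaces one of the two arcs, and girth excludes the short
one. -/
theorem IsTheta.of_isAttached (hG : Nonagonal G) {d : ℕ} {a b : V} {B B' R : G.Walk a b}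
    (h2 : 2 ≤ d) (h4 : d ≤ 4) (hB : B.IsPath) (hB' : B'.IsPath) (hBl : B.length = d)
    (hBl' : B'.length = 9 - d) (hd : ∀ x ∈ B.support, x ∈ B'.support → x = a ∨ x = b)
    (hc : ∀ x y, x ∈ B.support ∨ x ∈ B'.support → y ∈ B.support ∨ y ∈ B'.support → G.Adj x y →
      s(x, y) ∈ B.edges ∨ s(x, y) ∈ B'.edges)
    (hR : IsAttached {x | x ∈ B.support ∨ x ∈ B'.support} ∅ R) : IsTheta d B B' R := by
  have hRl : R.length = 9 - d := by
    by_cases hpar : (R.length + B.length) % 2 = 1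
    · have := hR.add_length_eq_nine hG hB (fun x hx => Or.inl hx) (by simp) ?_ hpar
      · omega
      · intro x hx y hy hxy
        refine (hc x y (Or.inl hx) (Or.inl hy) hxy).resolve_right fun he => ?_
        have := length_eq_one_of_edge_ends hB' he (hd x hx (B'.fst_mem_support_of_mem_edges he))
          (hd y hy (B'.snd_mem_support_of_mem_edges he))
        omega
    · have h1 := hR.add_length_eq_nine hG hB' (fun x hx => Or.inr hx) (by simp) ?_ (by omega)
      · have := hG.nine_le_of_ne hR.isPath hB
          (hR.ne_walk (fun x hx => Or.inl hx) (by omega))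
        omega
      · intro x hx y hy hxy
        refine (hc x y (Or.inr hx) (Or.inr hy) hxy).resolve_left fun he => ?_
        have := length_eq_one_of_edge_ends hB he (hd x (B.fst_mem_support_of_mem_edges he) hx)
          (hd y (B.snd_mem_support_of_mem_edges he) hy)
        omega
  refine ⟨h2, h4, hB, hB', hR.isPath, hBl, hBl', hRl, hd, fun x hx hx' => hR.meets x hx' (Or.inl hx),
    fun x hx hx' => hR.meets x hx' (Or.inr hx), fun x y hx hy hxy => ?_⟩
  rcases hR.mem_edges_or (by rwa [Set.mem_ofPred_eq, or_assoc])
    (by rwa [Set.mem_ofPred_eq, or_assoc]) hxy with h | h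
  · exact Or.inr (Or.inr h)
  · have := hc x y h.1 h.2 hxy
    tauto

/-! ### Arcs of nonagons -/

theorem exists_offset (i j : ℕ) : ∃ m m', (m + m' = 9 ∨ m = 0 ∧ m' = 0) ∧ j % 9 = (i + m) % 9 ∧
    i % 9 = (j + m') % 9 := by
  rcases lt_trichotomy (i % 9) (j % 9) with h | h | h
  · exact ⟨j % 9 - i % 9, 9 - (j % 9 - i % 9), by omega, by omega, by omega⟩
  · exact ⟨0, 0, by omega, by omega, by omega⟩
  · exact ⟨9 - (i % 9 - j % 9), i % 9 - j % 9, by omega, by omega, by omega⟩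

namespace IsNonagon

variable {c : ℕ → V}

theorem shift (hc : IsNonagon G c) (k : ℕ) : IsNonagon G fun i => c (k + i) :=
  ⟨fun i j => by rw [hc.eq_iff]; omega, fun i j => by rw [hc.adj_iff]; omega⟩

/-- The same nonagon, traversed in the opposite direction. -/
theorem reflect (hc : IsNonagon G c) : IsNonagon G fun i => c (8 * i) :=
  ⟨fun i j => by rw [hc.eq_iff]; omega, fun i j => by rw [hc.adj_iff]; omega⟩

theorem range_shift (hc : IsNonagon G c) (k : ℕ) :
    Set.range (fun i => c (k + i)) = Set.range c := by
  ext x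
  constructor
  · rintro ⟨i, rfl⟩; exact ⟨_, rfl⟩
  · rintro ⟨i, rfl⟩; exact ⟨i + 8 * k, (hc.eq_iff _ _).2 (by omega)⟩

theorem range_reflect (hc : IsNonagon G c) :
    Set.range (fun i => c (8 * i)) = Set.range c := by
  ext x
  constructor
  · rintro ⟨i, rfl⟩; exact ⟨_, rfl⟩
  · rintro ⟨i, rfl⟩; exact ⟨8 * i, (hc.eq_iff _ _).2 (by omega)⟩

/-- Two vertices split a nonagon into two arcs. -/
theorem exists_arcs (hc : IsNonagon G c) (i : ℕ) {m : ℕ} (h1 : 1 ≤ m) (h8 : m ≤ 8) :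
    ∃ B B' : G.Walk (c i) (c (i + m)), B.IsPath ∧ B'.IsPath ∧ B.length = m ∧ B'.length = 9 - m ∧
      (∀ x, x ∈ B.support ↔ ∃ k ≤ m, x = c (i + k)) ∧
      (∀ x, x ∈ B'.support ↔ ∃ k, m ≤ k ∧ k ≤ 9 ∧ x = c (i + k)) ∧
      (∀ x ∈ Set.range c, ∀ y ∈ Set.range c, G.Adj x y → s(x, y) ∈ B.edges ∨ s(x, y) ∈ B'.edges) := by
  obtain ⟨B, hBl, hBs, hBe, hBp⟩ := exists_segment (G := G) (f := c) (s := i) (t := i + m)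
    (by omega) fun j _ _ => (hc.adj_iff _ _).2 (Or.inl rfl)
  obtain ⟨D, hDl, hDs, hDe, hDp⟩ := exists_segment (G := G) (f := c) (s := i + m) (t := i + 9)
    (by omega) fun j _ _ => (hc.adj_iff _ _).2 (Or.inl rfl)
  have h9 : c (i + 9) = c i := (hc.eq_iff _ _).2 (by omega)
  refine ⟨B, D.reverse.copy h9 rfl, hBp fun j k _ _ _ h => ?_, ?_, by omega,
    by simp [hDl]; omega, fun x => ?_, fun x => ?_, ?_⟩
  · rw [hc.eq_iff] at h; omega
  · rw [Walk.isPath_copy, Walk.isPath_reverse_iff]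
    exact hDp fun j k _ _ _ h => by rw [hc.eq_iff] at h; omega
  · rw [hBs]
    constructor
    · rintro ⟨j, h1, h2, rfl⟩; exact ⟨j - i, by omega, by congr 1; omega⟩
    · rintro ⟨k, h1, rfl⟩; exact ⟨i + k, by omega, by omega, rfl⟩
  · simp only [Walk.support_copy, Walk.support_reverse, List.mem_reverse]
    rw [hDs]
    constructor
    · rintro ⟨j, h1, h2, rfl⟩; exact ⟨j - i, by omega, by omega, by congr 1; omega⟩
    · rintro ⟨k, h1, h2, rfl⟩; exact ⟨i + k, by omega, by omega, rfl⟩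
  · have main : ∀ j k, (j + 1) % 9 = k % 9 → s(c j, c k) ∈ B.edges ∨
        s(c j, c k) ∈ (D.reverse.copy h9 rfl).edges := by
      intro j k hjk
      obtain ⟨r, hr, hrj⟩ : ∃ r < 9, (i + r) % 9 = j % 9 := ⟨(j + 8 * i) % 9, by omega, by omega⟩
      rw [(hc.eq_iff _ _).2 hrj.symm, (hc.eq_iff k (i + r + 1)).2 (by omega)]
      by_cases hrm : r < m
      · exact Or.inl (hBe _ (by omega) (by omega))
      · right
        simpa using hDe (i + r) (by omega) (by omega)
    rintro _ ⟨j, rfl⟩ _ ⟨k, rfl⟩ hjk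
    rcases (hc.adj_iff _ _).1 hjk with h | h
    · exact main j k h
    · rw [Sym2.eq_swap]; exact main k j h

/-- A vertex outside a nonagon has at most one neighbour on it. -/
theorem eq_of_adj (hG : Nonagonal G) (hc : IsNonagon G c) {z : V} (hz : z ∉ Set.range c) {i j : ℕ}
    (hi : G.Adj z (c i)) (hj : G.Adj z (c j)) : c i = c j := by
  by_contra hne
  have main : ∀ i m, 1 ≤ m → m ≤ 4 → G.Adj z (c i) → G.Adj z (c (i + m)) → False := by
    intro i m h1 h4 hi hj
    obtain ⟨B, -, hBp, -, hBl, -, hBs, -, -⟩ := hc.exists_arcs i h1 (by omega)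
    have hne : c i ≠ c (i + m) := fun h => by rw [hc.eq_iff] at h; omega
    have := hG.nine_le_of_ne (p := Walk.cons hi.symm hj.toWalk) (q := B)
      (by simp [hi.ne.symm, hj.ne, hne]) hBp ?_
    · simp at this; omega
    · rintro rfl
      obtain ⟨k, -, hk⟩ := (hBs z).1 (by simp)
      exact hz ⟨_, hk.symm⟩
  rw [hc.eq_iff] at hne
  obtain ⟨m, m', hm, hj', hi'⟩ := exists_offset i j
  by_cases h : m ≤ 4
  · refine main i m (by omega) h hi ?_
    rwa [(hc.eq_iff _ j).2 hj'.symm]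
  · refine main j m' (by omega) (by omega) hj ?_
    rwa [(hc.eq_iff _ i).2 hi'.symm]

/-- A path closing up to a hole with the long arc between two vertices has the parity of that
arc. -/
theorem odd_of_isAttached (hG : Nonagonal G) (hc : IsNonagon G c) {i m : ℕ} (h2 : 2 ≤ m)
    (h4 : m ≤ 4) {R : G.Walk (c i) (c (i + m))}
    (hR : IsAttached {x | ∃ k, m ≤ k ∧ k ≤ 9 ∧ x = c (i + k)} ∅ R)
    (hx : ∃ x ∈ R.support, x ∉ Set.range c) : (R.length + m) % 2 = 1 := by
  obtain ⟨B, B', hB, hB', hBl, hBl', hBs, hBs', hBe⟩ := hc.exists_arcs i (m := m) (by omega) (by omega)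
  have hends : ∀ x ∈ B.support, x ∈ B'.support → x = c i ∨ x = c (i + m) := by
    intro x hx hx'
    obtain ⟨k, hk, rfl⟩ := (hBs x).1 hx
    obtain ⟨l, hl, hl', he⟩ := (hBs' _).1 hx'
    rw [hc.eq_iff] at he ⊢
    rw [hc.eq_iff]
    omega
  by_contra hpar
  have h1 := hR.add_length_eq_nine hG hB' (fun x hx => (hBs' x).1 hx) (by simp) ?_ (by omega)
  · have := hG.nine_le_of_ne hR.isPath hB ?_
    · omega
    · rintro rfl
      obtain ⟨x, hxR, hxc⟩ := hx
      obtain ⟨k, -, rfl⟩ := (hBs x).1 hxR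
      exact hxc ⟨_, rfl⟩
  · intro x hx y hy hxy
    have hrange : ∀ x ∈ B'.support, x ∈ Set.range c := fun x hx => by
      obtain ⟨k, -, -, rfl⟩ := (hBs' x).1 hx
      exact ⟨_, rfl⟩
    refine (hBe x (hrange x hx) y (hrange y hy) hxy).resolve_left fun he => ?_
    have := length_eq_one_of_edge_ends hB he (hends x (B.fst_mem_support_of_mem_edges he) hx)
      (hends y (B.snd_mem_support_of_mem_edges he) hy)
    omega

/-- In the absence of induced thetas, a path attached to a nonagon only at its ends joins
consecutive vertices. -/
theorem adj_of_isAttached (hG : Nonagonal G)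
    (hJ : ∀ (d : ℕ) (u v : V) (S A P : G.Walk u v), ¬ IsTheta d S A P) (hc : IsNonagon G c)
    {i j : ℕ} {R : G.Walk (c i) (c j)} (hR : IsAttached (Set.range c) ∅ R) :
    (i + 1) % 9 = j % 9 ∨ (j + 1) % 9 = i % 9 := by
  have main : ∀ {i m : ℕ} {a b : V} {R : G.Walk a b}, a = c i → b = c (i + m) → 2 ≤ m → m ≤ 4 →
      ¬ IsAttached (Set.range c) ∅ R := by
    rintro i m _ _ R rfl rfl h2 h4 hR
    obtain ⟨B, B', hB, hB', hBl, hBl', hBs, hBs', hBe⟩ :=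
      hc.exists_arcs i (m := m) (by omega) (by omega)
    have hrange : ∀ x, x ∈ B.support ∨ x ∈ B'.support → x ∈ Set.range c := fun x hx => by
      rcases hx with hx | hx
      · obtain ⟨k, -, rfl⟩ := (hBs x).1 hx
        exact ⟨_, rfl⟩
      · obtain ⟨k, -, -, rfl⟩ := (hBs' x).1 hx
        exact ⟨_, rfl⟩
    refine hJ m _ _ B B' R (IsTheta.of_isAttached hG h2 h4 hB hB' hBl hBl' ?_
      (fun x y hx hy => hBe x (hrange x hx) y (hrange y hy))
      (hR.mono hrange (Or.inl (by simp)) (Or.inl (by simp)) (by simp)))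
    intro x hx hx'
    obtain ⟨k, hk, rfl⟩ := (hBs x).1 hx
    obtain ⟨l, hl, hl', he⟩ := (hBs' _).1 hx'
    rw [hc.eq_iff] at he ⊢
    rw [hc.eq_iff]
    omega
  have hne := hR.ne
  rw [Ne, hc.eq_iff] at hne
  by_contra hcon
  obtain ⟨m, m', hm, hj', hi'⟩ := exists_offset i j
  by_cases h : m ≤ 4
  · exact main rfl ((hc.eq_iff j (i + m)).2 hj') (by omega) h hR
  · exact main rfl ((hc.eq_iff i (j + m')).2 hi') (by omega) (by omega) hR.reverse

end IsNonagon

/-! ### Existence of an induced theta -/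

theorem exists_first (P : ℕ → Prop) {a b : ℕ} (hab : a ≤ b) (hb : P b) :
    ∃ s, a ≤ s ∧ s ≤ b ∧ P s ∧ ∀ r, a ≤ r → r < s → ¬ P r := by
  classical
  have hex : ∃ s, a ≤ s ∧ P s := ⟨b, hab, hb⟩
  exact ⟨Nat.find hex, (Nat.find_spec hex).1, Nat.find_min' hex ⟨hab, hb⟩, (Nat.find_spec hex).2,
    fun r har hr h => Nat.find_min hex hr ⟨har, h⟩⟩

theorem exists_last (P : ℕ → Prop) {a b : ℕ} (hab : a ≤ b) (ha : P a) :
    ∃ s, a ≤ s ∧ s ≤ b ∧ P s ∧ ∀ r, s < r → r ≤ b → ¬ P r := by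
  classical
  exact ⟨Nat.findGreatest P b, Nat.le_findGreatest hab ha, Nat.findGreatest_le b,
    Nat.findGreatest_spec hab ha, fun r hr hrb => Nat.findGreatest_is_greatest hr hrb⟩

namespace IsNonagon

variable {c : ℕ → V}

/-- In the absence of induced thetas, two successive attachments of an induced path to a nonagon
are equal or consecutive. -/
theorem step (hG : Nonagonal G) (hJ : ∀ (d : ℕ) (u v : V) (S A P : G.Walk u v), ¬ IsTheta d S A P)
    (hc : IsNonagon G c) {p : ℕ → V} {s t : ℕ} (hst : s ≤ t) (hp : IsInducedSeq G p s t)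
    (hF : ∀ i, s ≤ i → i ≤ t → p i ∉ Set.range c) {a b : ℕ} (ha : G.Adj (p s) (c a))
    (hb : G.Adj (p t) (c b)) (hno : ∀ r, s < r → r < t → ∀ j, ¬ G.Adj (p r) (c j)) :
    a % 9 = b % 9 ∨ (a + 1) % 9 = b % 9 ∨ (b + 1) % 9 = a % 9 := by
  by_cases hab : c a = c b
  · exact Or.inl ((hc.eq_iff _ _).1 hab)
  · obtain ⟨R, hR, -, -⟩ := IsAttached.of_seq (F := Set.range c) (Z := ∅) hst hp hF ⟨a, rfl⟩ ⟨b, rfl⟩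
      hab (by simp) (by simp) ha.symm hb (by
        rintro i hsi hit _ ⟨j, rfl⟩ hj
        rcases Nat.lt_or_ge s i with h1 | h1
        · rcases Nat.lt_or_ge i t with h2 | h2
          · exact (hno i h1 h2 j hj).elim
          · obtain rfl : i = t := by omega
            exact Or.inr (Or.inl ⟨rfl, hc.eq_of_adj hG (hF i hsi hit) hj hb⟩)
        · obtain rfl : i = s := by omega
          exact Or.inl ⟨rfl, hc.eq_of_adj hG (hF i hsi hit) hj ha⟩)
    exact Or.inr (hc.adj_of_isAttached hG hJ hR)

/-- A path outside the nonagon from a neighbour of `c 2` to a neighbour of `c 0`, otherwise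
attached to `c 1`, closes up to an odd closed walk, and so yields another nonagon. -/
theorem exists_isNonagon_of_fan (hG : Nonagonal G) (hc : IsNonagon G c) {p : ℕ → V} {k : ℕ}
    {U : Set V} (hp : IsInducedSeq G p 0 k) (hU : ∀ i ≤ k, p i ∈ U)
    (hF : ∀ i ≤ k, p i ∉ Set.range c) (h2 : G.Adj (p 0) (c 2)) (h0 : G.Adj (p k) (c 0))
    (hatt : ∀ i, 0 < i → i < k → ∀ j, G.Adj (p i) (c j) → j % 9 = 1) :
    ∃ c', IsNonagon G c' ∧ ∀ i, c' i ∈ U ∪ {c 0, c 1, c 2} := by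
  have h20 : c 2 ≠ c 0 := fun h => by simp [hc.eq_iff] at h
  obtain ⟨R, hR, hRl, hRs⟩ := IsAttached.of_seq (F := Set.range c) (Z := {c 1}) (Nat.zero_le k) hp
    (fun i _ hi => hF i hi) ⟨2, rfl⟩ ⟨0, rfl⟩ h20 (by simp [hc.eq_iff])
    (by simp [hc.eq_iff]) h2.symm h0 (by
      rintro i - hi _ ⟨j, rfl⟩ hj
      rcases Nat.eq_zero_or_pos i with rfl | hi0
      · exact Or.inl ⟨rfl, hc.eq_of_adj hG (hF 0 hi) hj h2⟩
      · rcases Nat.lt_or_ge i k with hik | hik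
        · exact Or.inr (Or.inr ((hc.eq_iff _ _).2 (by rw [hatt i hi0 hik j hj])))
        · obtain rfl : i = k := by omega
          exact Or.inr (Or.inl ⟨rfl, hc.eq_of_adj hG (hF i hi) hj h0⟩))
  have hpar := hc.odd_of_isAttached hG (i := 0) (m := 2) le_rfl (by omega) (R := R.reverse)
    (hR.reverse.mono (by rintro _ ⟨l, -, -, rfl⟩; exact ⟨_, rfl⟩)
      ⟨9, by omega, le_rfl, by simp [hc.eq_iff]⟩
      ⟨2, le_rfl, by omega, rfl⟩ (by
        rintro _ ⟨l, hl, hl', rfl⟩ h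
        rw [Set.mem_singleton_iff, hc.eq_iff] at h
        omega))
    ⟨p 0, by simpa using (hRs (p 0)).2 (Or.inr (Or.inr ⟨0, le_rfl, Nat.zero_le _, rfl⟩)),
      hF 0 (Nat.zero_le _)⟩
  rw [Walk.length_reverse, hRl] at hpar
  have hcc : ∀ i, G.Adj (c i) (c (i + 1)) := fun i => (hc.adj_iff _ _).2 (Or.inl rfl)
  refine hG.exists_isNonagon (n := k + 4)
    (f := fun t => if t ≤ k then p t else if t ≤ k + 3 then c (t - k - 1) else p 0) (by omega)
    (fun i hi => ?_) ?_ (fun i hi => ?_)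
  · rcases Nat.lt_trichotomy i k with h | rfl | h
    · rw [if_pos (by omega), if_pos (by omega)]
      exact hp.adj i (Nat.zero_le _) h
    · rw [if_pos le_rfl, if_neg (by omega), if_pos (by omega), show i + 1 - i - 1 = 0 by omega]
      exact h0
    · rw [if_neg (by omega), if_pos (by omega), if_neg (by omega)]
      split_ifs with h1
      · rw [show i + 1 - k - 1 = i - k - 1 + 1 by omega]
        exact hcc _
      · rw [show i - k - 1 = 2 by omega]
        exact h2.symm
  · rw [if_neg (by omega), if_neg (by omega), if_pos (by omega)]
  · split_ifs with h1 h2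
    · exact Or.inl (hU i h1)
    · have : i - k - 1 = 0 ∨ i - k - 1 = 1 ∨ i - k - 1 = 2 := by omega
      rcases this with h | h | h <;> rw [h] <;> simp
    · exact Or.inl (hU 0 (Nat.zero_le _))

theorem reachable (hc : IsNonagon G c) (i j : ℕ) : G.Reachable (c i) (c j) := by
  have h : ∀ i, G.Reachable (c 0) (c i) := fun i => by
    induction i with
    | zero => exact Reachable.rfl
    | succ i ih => exact ih.trans ((hc.adj_iff _ _).2 (Or.inl rfl)).reachable
  exact (h i).symm.trans (h j)

/-- In the absence of induced thetas and `P₃`-cuts, every component of `G - c` contains, together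
with three consecutive vertices of `c`, another nonagon. -/
theorem exists_isNonagon_outside (hG : Nonagonal G)
    (hJ : ∀ (d : ℕ) (u v : V) (S A P : G.Walk u v), ¬ IsTheta d S A P) (hP3 : ¬ HasP3Cut G)
    (hc : IsNonagon G c) {z : V} (hz : z ∉ Set.range c) (hz2 : G.Adj z (c 2)) :
    ∃ c' e, IsNonagon G c' ∧
      ∀ i, c' i ∈ outside G (Set.range c) z ∪ {c e, c (e + 1), c (e + 2)} := by
  obtain ⟨k, p, hp, hU, h2, ⟨_, ⟨j, rfl⟩, hjX, hj⟩, hp2, hpk⟩ := exists_escape hP3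
    (F := Set.range c) (x₁ := c 1) (x₂ := c 2) (x₃ := c 3) (b := c 5)
    (by simp [hc.adj_iff]) (by simp [hc.adj_iff]) (by simp [hc.eq_iff]) (by simp [hc.adj_iff])
    (by rintro _ (rfl | rfl | rfl) <;> exact ⟨_, rfl⟩) hz hz2 ⟨5, rfl⟩ (by simp [hc.eq_iff])
    (hc.reachable 2 5)
  have hF : ∀ i ≤ k, p i ∉ Set.range c := fun i hi => notMem_of_mem_outside (hU i hi)
  have hX : ∀ l, c l ∉ ({c 1, c 2, c 3} : Set V) ↔ l % 9 ≠ 1 ∧ l % 9 ≠ 2 ∧ l % 9 ≠ 3 := fun l => by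
    simp [hc.eq_iff]
  rw [hX] at hjX
  have hatt : ∀ i < k, ∀ l, G.Adj (p i) (c l) → l % 9 = 1 ∨ l % 9 = 3 ∨ (l % 9 = 2 ∧ i = 0) := by
    intro i hi l hl
    by_cases h : c l ∈ ({c 1, c 2, c 3} : Set V)
    · by_cases h2 : l % 9 = 2
      · exact Or.inr (Or.inr ⟨h2, hp2 i hi.le (by rwa [(hc.eq_iff 2 l).2 (by omega)])⟩)
      · have := mt (hX l).2 (not_not.2 h)
        omega
    · exact absurd (hpk i hi.le _ ⟨l, rfl⟩ h hl) (by omega)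
  have hk : 0 < k := by
    rcases Nat.eq_zero_or_pos k with rfl | h
    · have := (hc.eq_iff _ _).1 (hc.eq_of_adj hG (hF 0 le_rfl) h2 hj)
      omega
    · exact h
  obtain ⟨s, -, hsk, ⟨l, hl⟩, hs⟩ := exists_last (fun i => ∃ l, G.Adj (p i) (c l)) (a := 0)
    (b := k - 1) (by omega) ⟨2, h2⟩
  have hstep := hc.step hG hJ (s := s) (t := k) (by omega) (hp.mono (by omega) le_rfl)
    (fun i _ hi => hF i hi) hl hj fun r hr hrk m hm => hs r hr (by omega) ⟨m, hm⟩
  have hls := hatt s (by omega) l hl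
  -- After a reflection of the nonagon the path ends at `c 0`.
  suffices main : ∀ {c : ℕ → V}, IsNonagon G c → (∀ i ≤ k, p i ∉ Set.range c) →
      G.Adj (p 0) (c 2) → G.Adj (p k) (c 0) →
      (∀ i < k, ∀ l, G.Adj (p i) (c l) → l % 9 = 1 ∨ l % 9 = 3 ∨ (l % 9 = 2 ∧ i = 0)) →
      ∀ i, 0 < i → i < k → ∀ j, G.Adj (p i) (c j) → j % 9 = 1 by
    rcases (show j % 9 = 0 ∨ j % 9 = 4 by omega) with h0 | h4
    · have hj0 : G.Adj (p k) (c 0) := by rwa [(hc.eq_iff 0 j).2 (by omega)]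
      obtain ⟨c', hc', h⟩ := hc.exists_isNonagon_of_fan hG hp hU hF h2 hj0 (main hc hF h2 hj0 hatt)
      exact ⟨c', 0, hc', h⟩
    · have hd := hc.reflect.shift 5
      have hdr : Set.range (fun i => c (8 * (5 + i))) = Set.range c :=
        (hc.reflect.range_shift 5).trans hc.range_reflect
      have hd2 : G.Adj (p 0) (c (8 * (5 + 2))) := by rwa [(hc.eq_iff _ 2).2 (by omega)]
      have hd0 : G.Adj (p k) (c (8 * (5 + 0))) := by rwa [(hc.eq_iff _ j).2 (by omega)]
      have hdF : ∀ i ≤ k, p i ∉ Set.range (fun i => c (8 * (5 + i))) := by rwa [hdr]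
      obtain ⟨c', hc', h⟩ := hd.exists_isNonagon_of_fan hG hp hU hdF hd2 hd0
        (main hd hdF hd2 hd0 fun i hi l hl => by have := hatt i hi _ hl; omega)
      refine ⟨c', 2, hc', fun i => ?_⟩
      have h1 := h i
      rw [(hc.eq_iff (8 * (5 + 0)) 4).2 (by omega), (hc.eq_iff (8 * (5 + 1)) 3).2 (by omega),
        (hc.eq_iff (8 * (5 + 2)) 2).2 (by omega)] at h1
      simp only [Set.mem_union, Set.mem_insert_iff, Set.mem_singleton_iff] at h1 ⊢
      tauto
  clear hstep hls hs hl l hatt hj hjX hX hpk hp2 h2 hF hz2 hz j hU hc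
  intro c hc hF h2 h0 hatt
  by_contra hcon
  push Not at hcon
  obtain ⟨i, hi0, hik, m, hm, hm1⟩ := hcon
  have hm3 : m % 9 = 3 := by have := hatt i hik m hm; omega
  obtain ⟨r, hir, hrk, hr, hlast⟩ := exists_last (fun i => G.Adj (p i) (c 3)) (a := i)
    (b := k - 1) (by omega) (by rwa [(hc.eq_iff 3 m).2 (by omega)])
  obtain ⟨r', hrr', hr'k, ⟨m', hm'⟩, hfirst⟩ := exists_first (fun i => ∃ l, G.Adj (p i) (c l))
    (a := r + 1) (b := k) (by omega) ⟨0, h0⟩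
  have hstep := hc.step hG hJ (s := r) (t := r') (by omega) (hp.mono (by omega) hr'k)
    (fun i _ hi => hF i (by omega)) hr hm' fun q hq hq' l hl => hfirst q hq hq' ⟨l, hl⟩
  rcases Nat.lt_or_ge r' k with hlt | hge
  · have h1 := hatt r' hlt m' hm'
    have h2 : m' % 9 ≠ 3 := fun h => hlast r' (by omega) (by omega)
      (by rwa [(hc.eq_iff 3 m').2 (by omega)])
    omega
  · obtain rfl : r' = k := by omega
    have := (hc.eq_iff _ _).1 (hc.eq_of_adj hG (hF r' le_rfl) h0 hm')
    omega

/-- In the absence of induced thetas and `P₃`-cuts some nonagon has all its outside neighbours in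
one component of its complement: choose this component as large as possible. -/
theorem exists_outside_eq [Finite V] (hG : Nonagonal G)
    (hJ : ∀ (d : ℕ) (u v : V) (S A P : G.Walk u v), ¬ IsTheta d S A P) (hP3 : ¬ HasP3Cut G)
    (hc : IsNonagon G c) {z : V} (hz : z ∉ Set.range c) (hz0 : G.Reachable z (c 0)) :
    ∃ c z, IsNonagon G c ∧
      ∀ x ∉ Set.range c, ∀ j, G.Adj x (c j) → x ∈ outside G (Set.range c) z := by
  obtain ⟨n, -, -, ⟨c, z, hc, hz, hr, hn⟩, hmax⟩ := exists_last
    (fun n => ∃ c z, IsNonagon G c ∧ z ∉ Set.range c ∧ G.Reachable z (c 0) ∧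
      (outside G (Set.range c) z).ncard = n) (b := Nat.card V) (Set.ncard_le_card _)
    ⟨c, z, hc, hz, hz0, rfl⟩
  refine ⟨c, z, hc, fun x hx j hxj => ?_⟩
  by_contra hxz
  obtain ⟨c', e, hc', hc'X⟩ : ∃ c' e, IsNonagon G c' ∧
      ∀ i, c' i ∈ outside G (Set.range c) x ∪ {c e, c (e + 1), c (e + 2)} := by
    have hs := hc.shift (j + 7)
    obtain ⟨c', e, hc', h⟩ := hs.exists_isNonagon_outside hG hJ hP3 (z := x)
      (by rwa [hc.range_shift]) (by rwa [(hc.eq_iff _ j).2 (by omega)])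
    rw [hc.range_shift] at h
    exact ⟨c', j + 7 + e, hc', h⟩
  have hdisj : ∀ y ∈ outside G (Set.range c) z, y ∉ outside G (Set.range c) x := by
    rintro y ⟨w, hw⟩ ⟨w', hw'⟩
    refine hxz ⟨w.append w'.reverse, fun u hu => ?_⟩
    simp only [Walk.mem_support_append_iff, Walk.support_reverse, List.mem_reverse] at hu
    rcases hu with hu | hu
    · exact hw u hu
    · exact hw' u hu
  have hnot : ∀ y ∈ outside G (Set.range c) z, y ∉ Set.range c' := by
    rintro _ hy ⟨i, rfl⟩
    rcases hc'X i with h | h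
    · exact hdisj _ hy h
    · exact notMem_of_mem_outside hy (by rcases h with h | h | h <;> rw [h] <;> exact ⟨_, rfl⟩)
  have hzz := mem_outside_self (G := G) hz
  obtain ⟨w, hw⟩ := exists_walk_of_not_hasP3Cut hP3 (x₁ := c e) (x₂ := c (e + 1)) (x₃ := c (e + 2))
    (z := z) (b := c (e + 4)) ((hc.adj_iff _ _).2 (Or.inl rfl)) ((hc.adj_iff _ _).2 (Or.inl rfl))
    (by rw [Ne, hc.eq_iff]; omega) (by rw [hc.adj_iff]; omega)
    (by rintro (h | h | h) <;> exact hz ⟨_, h.symm⟩)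
    (by rintro (h | h | h) <;> [skip; skip; rw [Set.mem_singleton_iff] at h] <;>
          rw [hc.eq_iff] at h <;> omega)
    (hr.trans (hc.reachable _ _))
  obtain ⟨y, hy, f, ⟨t, rfl⟩, htX, hyt⟩ := exists_first_hit w hz ⟨e + 4, rfl⟩ hw
  have ht' : c t ∉ Set.range c' := by
    rintro ⟨i, hi⟩
    rcases hi ▸ hc'X i with h | h
    · exact notMem_of_mem_outside h ⟨t, rfl⟩
    · exact htX h
  have hsub : outside G (Set.range c) z ⊆ outside G (Set.range c') z := fun y hy => by
    obtain ⟨w, hw⟩ := outside_connected hzz hy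
    exact ⟨w, fun u hu => hnot u (hw u hu)⟩
  have hss : outside G (Set.range c) z ⊂ outside G (Set.range c') z :=
    ⟨hsub, fun h => notMem_of_mem_outside (h (mem_outside_of_adj (hsub hy) hyt ht')) ⟨t, rfl⟩⟩
  refine hmax _ (hn ▸ Set.ncard_lt_ncard hss) (Set.ncard_le_card _)
    ⟨c', z, hc', hnot z hzz, ?_, rfl⟩
  refine hr.trans ?_
  rcases hc'X 0 with ⟨w, -⟩ | h
  · exact (hc.reachable 0 j).trans (hxj.symm.reachable.trans w.reachable)
  · rcases h with h | h | h <;> rw [h] <;> exact hc.reachable _ _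

end IsNonagon

namespace IsNonagon

variable {c : ℕ → V}

/-- In the absence of induced thetas, no induced path from a neighbour of `c 0` to a neighbour of
`c 4` has all its inner attachments among `c 1, c 2, c 3, c 6, c 7`. Such a path would visit the
neighbourhoods of `c 1`, `c 2`, `c 3` in this order; the parities of its pieces from `c 0` to `c 2`
and from `c 2` to `c 4` contradict that of the path from `c 0` to `c 4` obtained from them. -/
theorem not_isInducedSeq (hG : Nonagonal G)
    (hJ : ∀ (d : ℕ) (u v : V) (S A P : G.Walk u v), ¬ IsTheta d S A P) (hc : IsNonagon G c)
    {p : ℕ → V} {k : ℕ} (hp : IsInducedSeq G p 0 k) (hF : ∀ i ≤ k, p i ∉ Set.range c)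
    (h0 : G.Adj (p 0) (c 0)) (h4 : G.Adj (p k) (c 4))
    (hatt : ∀ i, 0 < i → i < k → ∀ j, G.Adj (p i) (c j) →
      j % 9 = 1 ∨ j % 9 = 2 ∨ j % 9 = 3 ∨ j % 9 = 6 ∨ j % 9 = 7) : False := by
  have huniq : ∀ i ≤ k, ∀ a b, G.Adj (p i) (c a) → G.Adj (p i) (c b) → a % 9 = b % 9 :=
    fun i hi a b ha hb => (hc.eq_iff _ _).1 (hc.eq_of_adj hG (hF i hi) ha hb)
  -- the first vertex attached to `c 2`
  obtain ⟨f, -, hfk, ⟨a, ha, ha0, ha1⟩, hf⟩ := exists_first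
    (fun i => ∃ l, G.Adj (p i) (c l) ∧ l % 9 ≠ 0 ∧ l % 9 ≠ 1) (Nat.zero_le k) ⟨4, h4, by simp⟩
  have hf0 : 0 < f := by
    rcases Nat.eq_zero_or_pos f with rfl | h
    · exact (ha0 (huniq 0 hfk a 0 ha h0)).elim
    · exact h
  obtain ⟨s, -, hsf, ⟨b, hb⟩, hs⟩ := exists_last (fun i => ∃ l, G.Adj (p i) (c l)) (a := 0)
    (b := f - 1) (by omega) ⟨0, h0⟩
  have hstep := hc.step hG hJ (s := s) (t := f) (by omega) (hp.mono (by omega) hfk)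
    (fun i _ hi => hF i (by omega)) hb ha fun r hr hrk m hm => hs r hr (by omega) ⟨m, hm⟩
  have hb01 : b % 9 = 0 ∨ b % 9 = 1 := by
    by_contra hcon
    exact hf s (by omega) (by omega) ⟨b, hb, by omega, by omega⟩
  have hfk' : f < k := by
    rcases Nat.lt_or_ge f k with h | h
    · exact h
    · obtain rfl : f = k := by omega
      have := huniq f hfk a 4 ha h4
      omega
  have ha2 : a % 9 = 2 := by
    have := hatt f hf0 hfk' a ha
    omega
  clear hstep hs hsf hb01 hb
  have hlow : ∀ i, 0 < i → i < f → ∀ j, G.Adj (p i) (c j) → j % 9 = 1 := by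
    intro i hi hif j hj
    have h1 := hatt i hi (by omega) j hj
    by_contra hcon
    exact hf i (by omega) hif ⟨j, hj, by omega, hcon⟩
  have hf2 : G.Adj (p f) (c 2) := by rwa [(hc.eq_iff 2 a).2 (by omega)]
  clear hf ha ha0 ha1 ha2
  -- the last vertex attached to `c 2`
  obtain ⟨l, hfl, hlk, ⟨a, ha, ha3, ha4⟩, hl⟩ := exists_last
    (fun i => ∃ l, G.Adj (p i) (c l) ∧ l % 9 ≠ 3 ∧ l % 9 ≠ 4) hfk ⟨2, hf2, by simp⟩
  have hlk' : l < k := by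
    rcases Nat.lt_or_ge l k with h | h
    · exact h
    · obtain rfl : l = k := by omega
      exact (ha4 (huniq l hlk a 4 ha h4)).elim
  obtain ⟨s, hls, hsk, ⟨b, hb⟩, hs⟩ := exists_first (fun i => ∃ l, G.Adj (p i) (c l)) (a := l + 1)
    (b := k) (by omega) ⟨4, h4⟩
  have hstep := hc.step hG hJ (s := l) (t := s) (by omega) (hp.mono (by omega) hsk)
    (fun i _ hi => hF i (by omega)) ha hb fun r hr hrk m hm => hs r hr (by omega) ⟨m, hm⟩
  have hb01 : b % 9 = 3 ∨ b % 9 = 4 := by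
    by_contra hcon
    exact hl s (by omega) (by omega) ⟨b, hb, by omega, by omega⟩
  have ha2 : a % 9 = 2 := by
    have := hatt l (by omega) hlk' a ha
    omega
  clear hstep hs hsk hls hb01 hb
  have hhigh : ∀ i, l < i → i < k → ∀ j, G.Adj (p i) (c j) → j % 9 = 3 := by
    intro i hi hik j hj
    have h1 := hatt i (by omega) hik j hj
    by_contra hcon
    exact hl i hi hik.le ⟨j, hj, hcon, by omega⟩
  have hl2 : G.Adj (p l) (c 2) := by rwa [(hc.eq_iff 2 a).2 (by omega)]
  clear hl ha ha3 ha4 ha2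
  have arc : ∀ i m (Z : Set V), 1 ≤ m → m ≤ 8 → (∀ x ∈ Z, ∃ j, 0 < j ∧ j < m ∧ x = c (i + j)) →
      ∀ {R : G.Walk (c i) (c (i + m))}, IsAttached (Set.range c) Z R →
        IsAttached {x | ∃ k, m ≤ k ∧ k ≤ 9 ∧ x = c (i + k)} ∅ R := by
    intro i m Z h1 h8 hZ R hR
    refine hR.mono (by rintro _ ⟨l, -, -, rfl⟩; exact ⟨_, rfl⟩)
      ⟨9, by omega, le_rfl, (hc.eq_iff _ _).2 (by omega)⟩ ⟨m, le_rfl, by omega, rfl⟩ ?_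
    rintro _ ⟨t, ht, ht', rfl⟩ h
    obtain ⟨j, hj, hj', he⟩ := hZ _ h
    rw [hc.eq_iff] at he
    omega
  have hpar1 : f % 2 = 1 := by
    obtain ⟨R, hR, hRl, hRs⟩ := IsAttached.of_seq (F := Set.range c) (Z := {c 1}) (Nat.zero_le f)
      (hp.mono le_rfl hfk) (fun i _ hi => hF i (by omega)) ⟨0, rfl⟩ ⟨2, rfl⟩ (by simp [hc.eq_iff])
      (by simp [hc.eq_iff]) (by simp [hc.eq_iff]) h0.symm hf2 (by
        rintro i - hi _ ⟨j, rfl⟩ hj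
        rcases Nat.eq_zero_or_pos i with rfl | hi0
        · exact Or.inl ⟨rfl, hc.eq_of_adj hG (hF 0 (by omega)) hj h0⟩
        · rcases Nat.lt_or_ge i f with hik | hik
          · exact Or.inr (Or.inr ((hc.eq_iff _ _).2 (by rw [hlow i hi0 hik j hj])))
          · obtain rfl : i = f := by omega
            exact Or.inr (Or.inl ⟨rfl, hc.eq_of_adj hG (hF i hfk) hj hf2⟩))
    have := hc.odd_of_isAttached hG (i := 0) (m := 2) le_rfl (by omega) (R := R)
      (arc 0 2 _ (by omega) (by omega) (by rintro _ rfl; exact ⟨1, by omega, by omega, rfl⟩) hR)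
      ⟨p 0, (hRs _).2 (Or.inr (Or.inr ⟨0, le_rfl, Nat.zero_le _, rfl⟩)), hF 0 (Nat.zero_le _)⟩
    omega
  have hpar2 : (k - l) % 2 = 1 := by
    obtain ⟨R, hR, hRl, hRs⟩ := IsAttached.of_seq (F := Set.range c) (Z := {c 3}) hlk
      (hp.mono (Nat.zero_le _) le_rfl) (fun i _ hi => hF i hi) ⟨2, rfl⟩ ⟨4, rfl⟩ (by simp [hc.eq_iff])
      (by simp [hc.eq_iff]) (by simp [hc.eq_iff]) hl2.symm h4 (by
        rintro i hli hi _ ⟨j, rfl⟩ hj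
        rcases Nat.lt_or_ge l i with hi0 | hi0
        · rcases Nat.lt_or_ge i k with hik | hik
          · exact Or.inr (Or.inr ((hc.eq_iff _ _).2 (by rw [hhigh i hi0 hik j hj])))
          · obtain rfl : i = k := by omega
            exact Or.inr (Or.inl ⟨rfl, hc.eq_of_adj hG (hF i le_rfl) hj h4⟩)
        · obtain rfl : i = l := by omega
          exact Or.inl ⟨rfl, hc.eq_of_adj hG (hF i hlk) hj hl2⟩)
    have := hc.odd_of_isAttached hG (i := 2) (m := 2) le_rfl (by omega) (R := R)
      (arc 2 2 _ (by omega) (by omega) (by rintro _ rfl; exact ⟨1, by omega, by omega, rfl⟩) hR)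
      ⟨p l, (hRs _).2 (Or.inr (Or.inr ⟨l, le_rfl, hlk, rfl⟩)), hF l hlk⟩
    omega
  rcases Nat.lt_or_ge f l with hlt | hge
  · -- shortcut through `c 2`
    have h1 : ∀ i ≤ f, G.Adj (p i) (c 2) → i = f := by
      intro i hi h
      by_contra hne
      rcases Nat.eq_zero_or_pos i with rfl | hi0
      · have := huniq 0 (by omega) 0 2 h0 h; omega
      · have := hlow i hi0 (by omega) 2 h; omega
    have h2 : ∀ i, l ≤ i → i ≤ k → G.Adj (p i) (c 2) → i = l := by
      intro i hi hik h
      by_contra hne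
      rcases Nat.lt_or_ge i k with hlt | hge
      · have := hhigh i (by omega) hlt 2 h; omega
      · obtain rfl : i = k := by omega
        have := huniq i le_rfl 4 2 h4 h; omega
    have h3 : ∀ i j, i ≤ f → l ≤ j → j ≤ k → ¬ G.Adj (p i) (p j) := by
      intro i j hi hj hjk h
      have := hp.chord i j (Nat.zero_le _) (by omega) hjk h
      obtain rfl : i = f := by omega
      obtain rfl : j = l := by omega
      have := hG.nine_le_of_ne (p := Walk.cons hf2 hl2.symm.toWalk) (q := h.toWalk)
        (by simp [hf2.ne, hl2.ne.symm, h.ne]) (by simp [h.ne])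
        (fun he => by have := congrArg Walk.length he; simp at this)
      simp at this
    set q : ℕ → V := fun t => if t ≤ f then p t else if t = f + 1 then c 2 else p (t - f - 2 + l)
      with hq
    have hq1 : ∀ t ≤ f, q t = p t := fun t ht => by simp [hq, ht]
    have hq2 : q (f + 1) = c 2 := by simp [hq]
    have hq3 : ∀ t, f + 2 ≤ t → q t = p (t - f - 2 + l) := fun t ht => by
      simp [hq, show ¬ t ≤ f by omega, show t ≠ f + 1 by omega]
    have hcF : ∀ i ≤ k, p i ≠ c 2 := fun i hi h => hF i hi ⟨2, h.symm⟩
    have hqs : IsInducedSeq G q 0 (f + 2 + (k - l)) := by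
      have hpair : ∀ i j, i < j → j ≤ f + 2 + (k - l) →
          q i ≠ q j ∧ (G.Adj (q i) (q j) → j = i + 1) := by
        intro i j hij hj
        rcases Nat.lt_trichotomy i (f + 1) with hi | rfl | hi
        · rw [hq1 i (by omega)]
          rcases Nat.lt_trichotomy j (f + 1) with hj' | rfl | hj'
          · rw [hq1 j (by omega)]
            exact ⟨hp.ne i j (Nat.zero_le _) hij (by omega),
              hp.chord i j (Nat.zero_le _) hij (by omega)⟩
          · rw [hq2]
            exact ⟨hcF i (by omega), fun h => by rw [h1 i (by omega) h]⟩
          · rw [hq3 j (by omega)]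
            exact ⟨hp.ne i _ (Nat.zero_le _) (by omega) (by omega),
              fun h => (h3 i _ (by omega) (by omega) (by omega) h).elim⟩
        · rw [hq2, hq3 j (by omega)]
          exact ⟨(hcF _ (by omega)).symm, fun h => by
            have := h2 _ (by omega) (by omega) h.symm
            omega⟩
        · rw [hq3 i (by omega), hq3 j (by omega)]
          exact ⟨hp.ne _ _ (Nat.zero_le _) (by omega) (by omega), fun h => by
            have := hp.chord _ _ (Nat.zero_le _) (by omega) (by omega) h
            omega⟩
      refine ⟨fun i _ hi => ?_, fun i j _ hij hj => (hpair i j hij hj).1,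
        fun i j _ hij hj => (hpair i j hij hj).2⟩
      rcases Nat.lt_trichotomy i f with h | rfl | h
      · rw [hq1 i (by omega), hq1 (i + 1) (by omega)]
        exact hp.adj i (Nat.zero_le _) (by omega)
      · rw [hq1 i le_rfl, hq2]
        exact hf2
      · rw [hq3 (i + 1) (by omega)]
        rcases Nat.lt_or_ge (f + 1) i with h' | h'
        · rw [hq3 i (by omega), show i + 1 - f - 2 + l = i - f - 2 + l + 1 by omega]
          exact hp.adj _ (Nat.zero_le _) (by omega)
        · obtain rfl : i = f + 1 := by omega
          rw [hq2, show f + 1 + 1 - f - 2 + l = l by omega]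
          exact hl2.symm
    have hmem : ∀ j, c j ∈ {x | ∃ k, 4 ≤ k ∧ k ≤ 9 ∧ x = c (0 + k)} ↔ j % 9 = 0 ∨ 4 ≤ j % 9 := by
      intro j
      constructor
      · rintro ⟨k, hk, hk', he⟩
        rw [hc.eq_iff] at he
        omega
      · rintro (h | h)
        · exact ⟨9, by omega, le_rfl, (hc.eq_iff _ _).2 (by omega)⟩
        · exact ⟨j % 9, h, by omega, (hc.eq_iff _ _).2 (by omega)⟩
    have hsub : ∀ x ∈ {x | ∃ k, 4 ≤ k ∧ k ≤ 9 ∧ x = c (0 + k)}, ∃ j, x = c j := by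
      rintro _ ⟨k, -, -, rfl⟩; exact ⟨_, rfl⟩
    have hqk : q (f + 2 + (k - l)) = p k := by rw [hq3 _ (by omega)]; congr 1; omega
    obtain ⟨R, hR, hRl, hRs⟩ := IsAttached.of_seq
      (F := {x | ∃ k, 4 ≤ k ∧ k ≤ 9 ∧ x = c (0 + k)}) (Z := ∅) (Nat.zero_le _) hqs
      (by
        intro i _ hi h
        rcases Nat.lt_trichotomy i (f + 1) with hi' | rfl | hi'
        · rw [hq1 i (by omega)] at h
          obtain ⟨j, hj⟩ := hsub _ h
          exact hF i (by omega) ⟨j, hj.symm⟩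
        · rw [hq2, hmem] at h; omega
        · rw [hq3 i (by omega)] at h
          obtain ⟨j, hj⟩ := hsub _ h
          exact hF _ (by omega) ⟨j, hj.symm⟩)
      ((hmem 0).2 (by omega)) ((hmem 4).2 (by omega)) (by simp [hc.eq_iff]) (by simp) (by simp)
      (by rw [hq1 0 (Nat.zero_le _)]; exact h0.symm) (by rw [hqk]; exact h4) (by
        intro i _ hi x hx hix
        obtain ⟨j, rfl⟩ := hsub x hx
        rw [hmem] at hx
        rcases Nat.lt_trichotomy i (f + 1) with hi' | rfl | hi'
        · rw [hq1 i (by omega)] at hix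
          rcases Nat.eq_zero_or_pos i with rfl | hi0
          · exact Or.inl ⟨rfl, hc.eq_of_adj hG (hF 0 (Nat.zero_le _)) hix h0⟩
          · rcases Nat.lt_or_ge i f with hif | hif
            · have := hlow i hi0 hif j hix; omega
            · obtain rfl : i = f := by omega
              have := huniq i hfk j 2 hix hf2; omega
        · rw [hq2, hc.adj_iff] at hix; omega
        · rw [hq3 i (by omega)] at hix
          rcases Nat.lt_or_ge i (f + 2 + (k - l)) with hik | hik
          · rcases Nat.lt_or_ge (f + 2) i with hil | hil
            · have := hhigh _ (by omega) (by omega) j hix; omega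
            · obtain rfl : i = f + 2 := by omega
              rw [show f + 2 - f - 2 + l = l by omega] at hix
              have := huniq l hlk j 2 hix hl2; omega
          · obtain rfl : i = f + 2 + (k - l) := by omega
            rw [show f + 2 + (k - l) - f - 2 + l = k by omega] at hix
            exact Or.inr (Or.inl ⟨rfl, hc.eq_of_adj hG (hF k le_rfl) hix h4⟩))
    have := hc.odd_of_isAttached hG (i := 0) (m := 4) (by omega) le_rfl (R := R) hR
      ⟨p 0, (hRs _).2 (Or.inr (Or.inr ⟨0, le_rfl, Nat.zero_le _, (hq1 0 (Nat.zero_le _)).symm⟩)),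
        hF 0 (Nat.zero_le _)⟩
    omega
  · obtain rfl : f = l := by omega
    obtain ⟨R, hR, hRl, hRs⟩ := IsAttached.of_seq (F := Set.range c) (Z := {c 1, c 2, c 3})
      (Nat.zero_le k) hp (fun i _ hi => hF i (by omega)) ⟨0, rfl⟩ ⟨4, rfl⟩ (by simp [hc.eq_iff])
      (by simp [hc.eq_iff]) (by simp [hc.eq_iff]) h0.symm h4 (by
        rintro i - hi _ ⟨j, rfl⟩ hj
        rcases Nat.eq_zero_or_pos i with rfl | hi0
        · exact Or.inl ⟨rfl, hc.eq_of_adj hG (hF 0 (by omega)) hj h0⟩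
        · rcases Nat.lt_or_ge i k with hik | hik
          · refine Or.inr (Or.inr ?_)
            simp only [Set.mem_insert_iff, Set.mem_singleton_iff, hc.eq_iff]
            rcases Nat.lt_trichotomy i f with h | rfl | h
            · have := hlow i hi0 h j hj; omega
            · have := huniq i hfk j 2 hj hf2; omega
            · have := hhigh i h hik j hj; omega
          · obtain rfl : i = k := by omega
            exact Or.inr (Or.inl ⟨rfl, hc.eq_of_adj hG (hF i le_rfl) hj h4⟩))
    have := hc.odd_of_isAttached hG (i := 0) (m := 4) (by omega) le_rfl (R := R)
      (arc 0 4 _ (by omega) (by omega) (by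
        rintro _ (rfl | rfl | rfl)
        exacts [⟨1, by omega, by omega, rfl⟩, ⟨2, by omega, by omega, rfl⟩,
          ⟨3, by omega, by omega, rfl⟩]) hR)
      ⟨p 0, (hRs _).2 (Or.inr (Or.inr ⟨0, le_rfl, Nat.zero_le _, rfl⟩)), hF 0 (Nat.zero_le _)⟩
    omega

end IsNonagon

/-- If there is no `P₃`-cut and every vertex of a nonagon has a neighbour off this nonagon, then an
induced theta exists. -/
theorem exists_isTheta [Finite V] (hG : Nonagonal G) (hP3 : ¬ HasP3Cut G) {c : ℕ → V}
    (hc : IsNonagon G c)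
    (hdeg : ∀ c, IsNonagon G c → ∀ i, ∃ x ∉ Set.range c, G.Adj x (c i)) :
    ∃ (d : ℕ) (u v : V) (S A P : G.Walk u v), IsTheta d S A P := by
  by_contra hJ
  push Not at hJ
  obtain ⟨x, hx, hx0⟩ := hdeg c hc 0
  obtain ⟨c, z, hc, hz⟩ := hc.exists_outside_eq hG hJ hP3 hx hx0.reachable
  obtain ⟨x, hx, hx0⟩ := hdeg c hc 0
  obtain ⟨y, hy, hy4⟩ := hdeg c hc 4
  obtain ⟨w, hw⟩ := outside_connected (hz x hx 0 hx0) (hz y hy 4 hy4)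
  -- a shortest connection between neighbours of two vertices at distance `4` in the nonagon
  obtain ⟨k, p, hp, hU, ⟨i, j, hi, hj, hij⟩, hmin⟩ := exists_geodesic _
    (fun x y => ∃ i j, G.Adj x (c i) ∧ G.Adj y (c j) ∧ ((i + 4) % 9 = j % 9 ∨ (j + 4) % 9 = i % 9))
    w hw ⟨0, 4, hx0, hy4, by omega⟩
  have hF : ∀ i ≤ k, p i ∉ Set.range c := fun i hi => notMem_of_mem_outside (hU i hi)
  suffices main : ∀ {c : ℕ → V}, IsNonagon G c → (∀ i ≤ k, p i ∉ Set.range c) →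
      G.Adj (p 0) (c 0) → G.Adj (p k) (c 4) →
      (∀ a b, a ≤ b → b ≤ k → ∀ i j, G.Adj (p a) (c i) → G.Adj (p b) (c j) →
        ((i + 4) % 9 = j % 9 ∨ (j + 4) % 9 = i % 9) → a = 0 ∧ b = k) → False by
    rcases hij with hij | hij
    · have hcs := hc.shift i
      refine main hcs (by rwa [hc.range_shift]) hi (by rwa [(hc.eq_iff (i + 4) j).2 (by omega)])
        fun a b hab hb i' j' hi' hj' h => hmin a b hab hb ⟨_, _, hi', hj', by omega⟩
    · have hcs := hc.reflect.shift (8 * i)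
      refine main hcs (by rwa [hc.reflect.range_shift, hc.range_reflect])
        (by rwa [(hc.eq_iff _ i).2 (by omega)]) (by rwa [(hc.eq_iff _ j).2 (by omega)])
        fun a b hab hb i' j' hi' hj' h => hmin a b hab hb ⟨_, _, hi', hj', by omega⟩
  clear hmin hij hj hi j i hw w hy4 hy y hx0 hx x hU hF hz hc
  intro c hc hF h0 h4 hmin
  refine hc.not_isInducedSeq hG hJ hp hF h0 h4 fun i hi hik j hj => ?_
  have h1 := hmin 0 i (Nat.zero_le _) hik.le 0 j h0 hj
  have h2 := hmin i k hik.le le_rfl j 4 hj h4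
  omega

/-! ### Induced `K₄`-subdivisions -/

theorem isPath_append {a b c : V} {p : G.Walk a b} {q : G.Walk b c} (hp : p.IsPath) (hq : q.IsPath)
    (h : ∀ x ∈ p.support, x ∈ q.support → x = b) : (p.append q).IsPath := by
  rw [Walk.isPath_def, Walk.support_append, List.nodup_append']
  have hq' := hq.support_nodup
  rw [← Walk.cons_tail_support, List.nodup_cons] at hq'
  refine ⟨hp.support_nodup, hq'.2, List.disjoint_left.2 fun x hx hx' => ?_⟩
  obtain rfl := h x hx (List.mem_of_mem_tail hx')
  exact hq'.1 hx'

/-- Six paths between the pairs of four vertices meet only in common ends. -/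
structure MeetInEnds {u₁ u₂ u₃ u₄ : V} (P₁ : G.Walk u₁ u₂) (P₂ : G.Walk u₃ u₄) (Q₁ : G.Walk u₂ u₃)
    (Q₂ : G.Walk u₁ u₄) (L₁ : G.Walk u₁ u₃) (L₂ : G.Walk u₂ u₄) : Prop where
  P₁P₂ : ∀ x ∈ P₁.support, x ∉ P₂.support
  Q₁Q₂ : ∀ x ∈ Q₁.support, x ∉ Q₂.support
  L₁L₂ : ∀ x ∈ L₁.support, x ∉ L₂.support
  P₁Q₁ : ∀ x ∈ P₁.support, x ∈ Q₁.support → x = u₂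
  P₁Q₂ : ∀ x ∈ P₁.support, x ∈ Q₂.support → x = u₁
  P₁L₁ : ∀ x ∈ P₁.support, x ∈ L₁.support → x = u₁
  P₁L₂ : ∀ x ∈ P₁.support, x ∈ L₂.support → x = u₂
  P₂Q₁ : ∀ x ∈ P₂.support, x ∈ Q₁.support → x = u₃
  P₂Q₂ : ∀ x ∈ P₂.support, x ∈ Q₂.support → x = u₄
  P₂L₁ : ∀ x ∈ P₂.support, x ∈ L₁.support → x = u₃
  P₂L₂ : ∀ x ∈ P₂.support, x ∈ L₂.support → x = u₄
  Q₁L₁ : ∀ x ∈ Q₁.support, x ∈ L₁.support → x = u₃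
  Q₁L₂ : ∀ x ∈ Q₁.support, x ∈ L₂.support → x = u₂
  Q₂L₁ : ∀ x ∈ Q₂.support, x ∈ L₁.support → x = u₁
  Q₂L₂ : ∀ x ∈ Q₂.support, x ∈ L₂.support → x = u₄

namespace MeetInEnds

variable {u₁ u₂ u₃ u₄ : V} {P₁ : G.Walk u₁ u₂} {P₂ : G.Walk u₃ u₄} {Q₁ : G.Walk u₂ u₃}
  {Q₂ : G.Walk u₁ u₄} {L₁ : G.Walk u₁ u₃} {L₂ : G.Walk u₂ u₄}

theorem ne₁₂ (h : MeetInEnds P₁ P₂ Q₁ Q₂ L₁ L₂) : u₁ ≠ u₂ := by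
  rintro rfl; exact h.Q₁Q₂ _ Q₁.start_mem_support Q₂.start_mem_support

theorem ne₁₃ (h : MeetInEnds P₁ P₂ Q₁ Q₂ L₁ L₂) : u₁ ≠ u₃ := by
  rintro rfl; exact h.P₁P₂ _ P₁.start_mem_support P₂.start_mem_support

theorem ne₁₄ (h : MeetInEnds P₁ P₂ Q₁ Q₂ L₁ L₂) : u₁ ≠ u₄ := by
  rintro rfl; exact h.P₁P₂ _ P₁.start_mem_support P₂.end_mem_support

theorem ne₂₃ (h : MeetInEnds P₁ P₂ Q₁ Q₂ L₁ L₂) : u₂ ≠ u₃ := by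
  rintro rfl; exact h.P₁P₂ _ P₁.end_mem_support P₂.start_mem_support

theorem ne₂₄ (h : MeetInEnds P₁ P₂ Q₁ Q₂ L₁ L₂) : u₂ ≠ u₄ := by
  rintro rfl; exact h.P₁P₂ _ P₁.end_mem_support P₂.end_mem_support

theorem ne₃₄ (h : MeetInEnds P₁ P₂ Q₁ Q₂ L₁ L₂) : u₃ ≠ u₄ := by
  rintro rfl; exact h.Q₁Q₂ _ Q₁.end_mem_support Q₂.end_mem_support

end MeetInEnds

/-- The `K₄`-subdivision from six paths meeting only in common ends. -/
def K4Subdivision.ofMeetInEnds {u₁ u₂ u₃ u₄ : V} {P₁ : G.Walk u₁ u₂} {P₂ : G.Walk u₃ u₄}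
    {Q₁ : G.Walk u₂ u₃}
    {Q₂ : G.Walk u₁ u₄} {L₁ : G.Walk u₁ u₃} {L₂ : G.Walk u₂ u₄}
    (h : MeetInEnds P₁ P₂ Q₁ Q₂ L₁ L₂) (hP₁ : P₁.IsPath)
    (hP₂ : P₂.IsPath) (hQ₁ : Q₁.IsPath) (hQ₂ : Q₂.IsPath) (hL₁ : L₁.IsPath) (hL₂ : L₂.IsPath) :
    K4Subdivision G where
  u₁ := u₁
  u₂ := u₂
  u₃ := u₃
  u₄ := u₄
  P₁ := P₁
  P₂ := P₂
  Q₁ := Q₁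
  Q₂ := Q₂
  L₁ := L₁
  L₂ := L₂
  branch_nodup := by
    simp [h.ne₁₂, h.ne₁₃, h.ne₁₄, h.ne₂₃, h.ne₂₄, h.ne₃₄]
  isPath_P₁ := hP₁
  isPath_P₂ := hP₂
  isPath_Q₁ := hQ₁
  isPath_Q₂ := hQ₂
  isPath_L₁ := hL₁
  isPath_L₂ := hL₂
  internally_disjoint := by
    obtain ⟨h1, h2, h3, h4, h5, h6, h7, h8, h9, h10, h11, h12, h13, h14, h15⟩ := h
    have p1 := P₁.start_mem_support
    have p2 := P₁.end_mem_support
    have p3 := P₂.start_mem_support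
    have p4 := P₂.end_mem_support
    have q1 := Q₁.start_mem_support
    have q2 := Q₁.end_mem_support
    have q3 := Q₂.start_mem_support
    have q4 := Q₂.end_mem_support
    have l1 := L₁.start_mem_support
    have l2 := L₁.end_mem_support
    have l3 := L₂.start_mem_support
    have l4 := L₂.end_mem_support
    simp only [List.mem_cons, List.not_mem_nil, or_false,
      List.pairwise_cons, Set.disjoint_left, forall_eq_or_imp,
      pathInterior, Set.mem_ofPred_eq,
      Set.mem_insert_iff, Set.mem_singleton_iff]
    refine ⟨⟨?_, ?_, ?_, ?_, ?_, ?_⟩, ⟨?_, ?_, ?_, ?_, ?_⟩, ⟨?_, ?_, ?_, ?_⟩, ⟨?_, ?_, ?_⟩,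
      ⟨?_, ?_⟩, ?_, ?_⟩ <;> grind

/-- Six paths forming a subdivision of `K₄` that is an induced subgraph of `G`. -/
structure IsInducedK4 {u₁ u₂ u₃ u₄ : V} (P₁ : G.Walk u₁ u₂) (P₂ : G.Walk u₃ u₄) (Q₁ : G.Walk u₂ u₃)
    (Q₂ : G.Walk u₁ u₄) (L₁ : G.Walk u₁ u₃) (L₂ : G.Walk u₂ u₄) : Prop where
  meet : MeetInEnds P₁ P₂ Q₁ Q₂ L₁ L₂
  isPath_P₁ : P₁.IsPath
  isPath_P₂ : P₂.IsPath
  isPath_Q₁ : Q₁.IsPath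
  isPath_Q₂ : Q₂.IsPath
  isPath_L₁ : L₁.IsPath
  isPath_L₂ : L₂.IsPath
  chord : ∀ x y, x ∈ P₁.support ∨ x ∈ P₂.support ∨ x ∈ Q₁.support ∨ x ∈ Q₂.support ∨
      x ∈ L₁.support ∨ x ∈ L₂.support →
    y ∈ P₁.support ∨ y ∈ P₂.support ∨ y ∈ Q₁.support ∨ y ∈ Q₂.support ∨ y ∈ L₁.support ∨
      y ∈ L₂.support → G.Adj x y →
    s(x, y) ∈ P₁.edges ∨ s(x, y) ∈ P₂.edges ∨ s(x, y) ∈ Q₁.edges ∨ s(x, y) ∈ Q₂.edges ∨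
      s(x, y) ∈ L₁.edges ∨ s(x, y) ∈ L₂.edges

theorem Nonagonal.isHole_triangle (hG : Nonagonal G) {u v w : V} {p : G.Walk u v} {q : G.Walk v w}
    {r : G.Walk u w} (hp : p.IsPath) (hq : q.IsPath) (hr : r.IsPath)
    (huv : u ≠ v) (huw : u ≠ w) (hvw : v ≠ w)
    (hpq : ∀ x ∈ p.support, x ∈ q.support → x = v) (hpr : ∀ x ∈ p.support, x ∈ r.support → x = u)
    (hqr : ∀ x ∈ q.support, x ∈ r.support → x = w)
    (hc : ∀ x y, x ∈ p.support ∨ x ∈ q.support ∨ x ∈ r.support →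
      y ∈ p.support ∨ y ∈ q.support ∨ y ∈ r.support → G.Adj x y →
      s(x, y) ∈ p.edges ∨ s(x, y) ∈ q.edges ∨ s(x, y) ∈ r.edges) :
    IsHole ((p.append q).append r.reverse) := by
  have h1 : p.length ≠ 0 := fun h => huv (Walk.eq_of_length_eq_zero h)
  have h2 : q.length ≠ 0 := fun h => hvw (Walk.eq_of_length_eq_zero h)
  have h3 : r.length ≠ 0 := fun h => huw (Walk.eq_of_length_eq_zero h)
  refine hG.isHole_append_reverse (isPath_append hp hq hpq) hr huw (fun x hx hx' => ?_)
    (by rw [Walk.length_append]; omega) fun x y hx hy hxy => ?_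
  · rw [Walk.mem_support_append_iff] at hx
    rcases hx with hx | hx
    · exact Or.inl (hpr x hx hx')
    · exact Or.inr (hqr x hx hx')
  · simp only [Walk.mem_support_append_iff, Walk.edges_append, List.mem_append, or_assoc] at hx hy ⊢
    exact hc x y hx hy hxy

theorem notMem_edges_of_subsingleton {a b x y v : V} {r : G.Walk a b} {X : V → Prop}
    (h : ∀ z ∈ r.support, X z → z = v) (hx : X x) (hy : X y) : s(x, y) ∉ r.edges := fun he =>
  (r.adj_of_mem_edges he).ne ((h _ (r.fst_mem_support_of_mem_edges he) hx).trans
    (h _ (r.snd_mem_support_of_mem_edges he) hy).symm)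

namespace IsInducedK4

variable {u₁ u₂ u₃ u₄ : V} {P₁ : G.Walk u₁ u₂} {P₂ : G.Walk u₃ u₄} {Q₁ : G.Walk u₂ u₃}
  {Q₂ : G.Walk u₁ u₄} {L₁ : G.Walk u₁ u₃} {L₂ : G.Walk u₂ u₄}

/-- The subdivision, as a member of the type `K4Subdivision G`. -/
def toK4 (h : IsInducedK4 P₁ P₂ Q₁ Q₂ L₁ L₂) : K4Subdivision G :=
  .ofMeetInEnds h.meet h.isPath_P₁ h.isPath_P₂ h.isPath_Q₁ h.isPath_Q₂ h.isPath_L₁ h.isPath_L₂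

theorem swap₃₄ (h : IsInducedK4 P₁ P₂ Q₁ Q₂ L₁ L₂) : IsInducedK4 P₁ P₂.reverse L₂ L₁ Q₂ Q₁ := by
  obtain ⟨⟨h1, h2, h3, h4, h5, h6, h7, h8, h9, h10, h11, h12, h13, h14, h15⟩,
    i1, i2, i3, i4, i5, i6, hc⟩ := h
  refine ⟨⟨?_, ?_, ?_, ?_, ?_, ?_, ?_, ?_, ?_, ?_, ?_, ?_, ?_, ?_, ?_⟩,
    i1, i2.reverse, i6, i5, i4, i3, ?_⟩
  on_goal 16 =>
    intro x y hx hy hxy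
    simp only [Walk.support_reverse, List.mem_reverse, Walk.edges_reverse] at hx hy ⊢
    have key := hc x y (by rcases hx with h | h | h | h | h | h <;> simp only [h, true_or, or_true])
      (by rcases hy with h | h | h | h | h | h <;> simp only [h, true_or, or_true]) hxy
    rcases key with h | h | h | h | h | h <;> simp only [h, true_or, or_true]
  all_goals
    try simp only [Walk.support_reverse, List.mem_reverse]
    intros
    solve_by_elim

theorem swap₁₂ (h : IsInducedK4 P₁ P₂ Q₁ Q₂ L₁ L₂) : IsInducedK4 P₁.reverse P₂ L₁ L₂ Q₁ Q₂ := by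
  obtain ⟨⟨h1, h2, h3, h4, h5, h6, h7, h8, h9, h10, h11, h12, h13, h14, h15⟩,
    i1, i2, i3, i4, i5, i6, hc⟩ := h
  refine ⟨⟨?_, ?_, ?_, ?_, ?_, ?_, ?_, ?_, ?_, ?_, ?_, ?_, ?_, ?_, ?_⟩,
    i1.reverse, i2, i5, i6, i3, i4, ?_⟩
  on_goal 16 =>
    intro x y hx hy hxy
    simp only [Walk.support_reverse, List.mem_reverse, Walk.edges_reverse] at hx hy ⊢
    have key := hc x y (by rcases hx with h | h | h | h | h | h <;> simp only [h, true_or, or_true])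
      (by rcases hy with h | h | h | h | h | h <;> simp only [h, true_or, or_true]) hxy
    rcases key with h | h | h | h | h | h <;> simp only [h, true_or, or_true]
  all_goals
    try simp only [Walk.support_reverse, List.mem_reverse]
    intros
    solve_by_elim

theorem isHole_C₁ (hG : Nonagonal G) (h : IsInducedK4 P₁ P₂ Q₁ Q₂ L₁ L₂) :
    IsHole ((P₁.append Q₁).append L₁.reverse) := by
  have m := h.meet
  refine hG.isHole_triangle h.isPath_P₁ h.isPath_Q₁ h.isPath_L₁ m.ne₁₂ m.ne₁₃ m.ne₂₃ m.P₁Q₁ m.P₁L₁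
    m.Q₁L₁ fun x y hx hy hxy => ?_
  have e1 := notMem_edges_of_subsingleton (r := P₂) (v := u₃)
    (X := fun x => x ∈ P₁.support ∨ x ∈ Q₁.support ∨ x ∈ L₁.support) (fun z hz hz' => by
      rcases hz' with h | h | h
      exacts [(m.P₁P₂ z h hz).elim, m.P₂Q₁ z hz h, m.P₂L₁ z hz h]) hx hy
  have e2 := notMem_edges_of_subsingleton (r := Q₂) (v := u₁)
    (X := fun x => x ∈ P₁.support ∨ x ∈ Q₁.support ∨ x ∈ L₁.support) (fun z hz hz' => by
      rcases hz' with h | h | h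
      exacts [m.P₁Q₂ z h hz, (m.Q₁Q₂ z h hz).elim, m.Q₂L₁ z hz h]) hx hy
  have e3 := notMem_edges_of_subsingleton (r := L₂) (v := u₂)
    (X := fun x => x ∈ P₁.support ∨ x ∈ Q₁.support ∨ x ∈ L₁.support) (fun z hz hz' => by
      rcases hz' with h | h | h
      exacts [m.P₁L₂ z h hz, m.Q₁L₂ z h hz, (m.L₁L₂ z h hz).elim]) hx hy
  have := h.chord x y (by tauto) (by tauto) hxy
  tauto

theorem isHole_C₄ (hG : Nonagonal G) (h : IsInducedK4 P₁ P₂ Q₁ Q₂ L₁ L₂) :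
    IsHole ((L₁.append P₂).append Q₂.reverse) := by
  have m := h.meet
  refine hG.isHole_triangle h.isPath_L₁ h.isPath_P₂ h.isPath_Q₂ m.ne₁₃ m.ne₁₄ m.ne₃₄
    (fun x h h' => m.P₂L₁ x h' h) (fun x h h' => m.Q₂L₁ x h' h) m.P₂Q₂ fun x y hx hy hxy => ?_
  have e1 := notMem_edges_of_subsingleton (r := P₁) (v := u₁)
    (X := fun x => x ∈ L₁.support ∨ x ∈ P₂.support ∨ x ∈ Q₂.support) (fun z hz hz' => by
      rcases hz' with h | h | h
      exacts [m.P₁L₁ z hz h, (m.P₁P₂ z hz h).elim, m.P₁Q₂ z hz h]) hx hy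
  have e2 := notMem_edges_of_subsingleton (r := Q₁) (v := u₃)
    (X := fun x => x ∈ L₁.support ∨ x ∈ P₂.support ∨ x ∈ Q₂.support) (fun z hz hz' => by
      rcases hz' with h | h | h
      exacts [m.Q₁L₁ z hz h, m.P₂Q₁ z h hz, (m.Q₁Q₂ z hz h).elim]) hx hy
  have e3 := notMem_edges_of_subsingleton (r := L₂) (v := u₄)
    (X := fun x => x ∈ L₁.support ∨ x ∈ P₂.support ∨ x ∈ Q₂.support) (fun z hz hz' => by
      rcases hz' with h | h | h
      exacts [(m.L₁L₂ z h hz).elim, m.P₂L₂ z h hz, m.Q₂L₂ z h hz]) hx hy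
  have := h.chord x y (by tauto) (by tauto) hxy
  tauto

/-- The four-arris cycle avoiding `Q₁` and `Q₂` has length nine if it is odd and neither of these
arrises is a single edge. -/
theorem quad_eq_nine (hG : Nonagonal G) (h : IsInducedK4 P₁ P₂ Q₁ Q₂ L₁ L₂) (h1 : Q₁.length ≠ 1)
    (h2 : Q₂.length ≠ 1) (hodd : (P₁.length + L₂.length + (L₁.length + P₂.length)) % 2 = 1) :
    P₁.length + L₂.length + (L₁.length + P₂.length) = 9 := by
  have m := h.meet
  have := hG.add_length_eq_nine (isPath_append h.isPath_P₁ h.isPath_L₂ m.P₁L₂)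
    (isPath_append h.isPath_L₁ h.isPath_P₂ fun x h h' => m.P₂L₁ x h' h) m.ne₁₄ ?_ ?_
    (by simpa using hodd)
  · simpa using this
  · intro x hx hx'
    simp only [Walk.mem_support_append_iff] at hx hx'
    rcases hx with hx | hx <;> rcases hx' with hx' | hx'
    · exact Or.inl (m.P₁L₁ x hx hx')
    · exact (m.P₁P₂ x hx hx').elim
    · exact (m.L₁L₂ x hx' hx).elim
    · exact Or.inr (m.P₂L₂ x hx' hx)
  · intro x y hx hy hxy
    simp only [Walk.mem_support_append_iff, Walk.edges_append, List.mem_append] at hx hy ⊢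
    have key : ∀ x, (x ∈ P₁.support ∨ x ∈ L₂.support) ∨ x ∈ L₁.support ∨ x ∈ P₂.support →
        (x ∈ Q₁.support → x = u₂ ∨ x = u₃) ∧ (x ∈ Q₂.support → x = u₁ ∨ x = u₄) := by
      rintro x ((h | h) | h | h)
      · exact ⟨fun h' => Or.inl (m.P₁Q₁ x h h'), fun h' => Or.inl (m.P₁Q₂ x h h')⟩
      · exact ⟨fun h' => Or.inl (m.Q₁L₂ x h' h), fun h' => Or.inr (m.Q₂L₂ x h' h)⟩
      · exact ⟨fun h' => Or.inr (m.Q₁L₁ x h' h), fun h' => Or.inl (m.Q₂L₁ x h' h)⟩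
      · exact ⟨fun h' => Or.inr (m.P₂Q₁ x h h'), fun h' => Or.inr (m.P₂Q₂ x h h')⟩
    have e1 : s(x, y) ∉ Q₁.edges := fun he => h1 <| length_eq_one_of_edge_ends h.isPath_Q₁ he
      ((key x hx).1 (Q₁.fst_mem_support_of_mem_edges he))
      ((key y hy).1 (Q₁.snd_mem_support_of_mem_edges he))
    have e2 : s(x, y) ∉ Q₂.edges := fun he => h2 <| length_eq_one_of_edge_ends h.isPath_Q₂ he
      ((key x hx).2 (Q₂.fst_mem_support_of_mem_edges he))
      ((key y hy).2 (Q₂.snd_mem_support_of_mem_edges he))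
    have := h.chord x y (by tauto) (by tauto) hxy
    tauto

theorem isHole_C₂ (hG : Nonagonal G) (h : IsInducedK4 P₁ P₂ Q₁ Q₂ L₁ L₂) :
    IsHole ((P₁.append L₂).append Q₂.reverse) :=
  h.swap₃₄.isHole_C₁ hG

theorem isHole_C₃ (hG : Nonagonal G) (h : IsInducedK4 P₁ P₂ Q₁ Q₂ L₁ L₂) :
    IsHole ((Q₁.append P₂).append L₂.reverse) :=
  h.swap₁₂.isHole_C₄ hG

theorem isBalancedOneTwo (hG : Nonagonal G) (h : IsInducedK4 P₁ P₂ Q₁ Q₂ L₁ L₂)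
    (h1 : (P₁.length + Q₁.length + L₁.length) % 2 = 1)
    (h2 : (P₁.length + Q₂.length + L₂.length) % 2 = 1)
    (h4 : (P₂.length + Q₂.length + L₁.length) % 2 = 0) (hQ : Q₁.length = 1)
    (hL : L₂.length ≠ 1) : h.toK4.IsBalancedOneTwo := by
  have hL0 : L₂.length ≠ 0 := fun hl => h.meet.ne₂₄ (Walk.eq_of_length_eq_zero hl)
  refine ⟨⟨h.isHole_C₁ hG, ?_⟩, ⟨h.isHole_C₂ hG, ?_⟩, ⟨h.isHole_C₃ hG, ?_⟩, ⟨h.isHole_C₄ hG, ?_⟩, hQ,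
    show 2 ≤ L₂.length by omega⟩
  · rw [Nat.odd_iff]
    simp [toK4, K4Subdivision.C₁, K4Subdivision.ofMeetInEnds]; omega
  · rw [Nat.odd_iff]
    simp [toK4, K4Subdivision.C₂, K4Subdivision.ofMeetInEnds]; omega
  · rw [Nat.even_iff]
    simp [toK4, K4Subdivision.C₃, K4Subdivision.ofMeetInEnds]; omega
  · rw [Nat.even_iff]
    simp [toK4, K4Subdivision.C₄, K4Subdivision.ofMeetInEnds]; omega

theorem isOdd (hG : Nonagonal G) (h : IsInducedK4 P₁ P₂ Q₁ Q₂ L₁ L₂)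
    (h1 : (P₁.length + Q₁.length + L₁.length) % 2 = 1)
    (h2 : (P₁.length + Q₂.length + L₂.length) % 2 = 1)
    (h4 : (P₂.length + Q₂.length + L₁.length) % 2 = 1) : h.toK4.IsOdd := by
  refine ⟨⟨h.isHole_C₁ hG, ?_⟩, ⟨h.isHole_C₂ hG, ?_⟩, ⟨h.isHole_C₃ hG, ?_⟩, ⟨h.isHole_C₄ hG, ?_⟩⟩ <;>
    rw [Nat.odd_iff] <;>
    simp [toK4, K4Subdivision.C₁, K4Subdivision.C₂, K4Subdivision.C₃, K4Subdivision.C₄,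
      K4Subdivision.ofMeetInEnds] <;> omega

/-- An induced subdivision of `K₄` with two odd faces is odd, or balanced of type `(1, 2)` after
relabelling, unless two opposite edges at the common arris of these faces are not subdivided.
If all arrises `Q₁, Q₂, L₁, L₂` were subdivided, then the odd cycles consisting of four arrises
would be holes of length nine, too, and `P₂` would have length zero. -/
theorem odd_or_balanced (hG : Nonagonal G) (h : IsInducedK4 P₁ P₂ Q₁ Q₂ L₁ L₂)
    (h1 : P₁.length + Q₁.length + L₁.length = 9)
    (h2 : P₁.length + Q₂.length + L₂.length = 9)
    (hQL : ¬ (Q₁.length = 1 ∧ L₂.length = 1)) (hLQ : ¬ (Q₂.length = 1 ∧ L₁.length = 1)) :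
    (∃ H : K4Subdivision G, H.IsOdd) ∨ ∃ H : K4Subdivision G, H.IsBalancedOneTwo := by
  by_cases h4 : (P₂.length + Q₂.length + L₁.length) % 2 = 1
  · exact Or.inl ⟨_, h.isOdd hG (by omega) (by omega) h4⟩
  right
  by_cases c1 : Q₁.length = 1
  · exact ⟨_, h.isBalancedOneTwo hG (by omega) (by omega) (by omega) c1 (by omega)⟩
  by_cases c2 : L₂.length = 1
  · exact ⟨_, h.swap₃₄.isBalancedOneTwo hG (by omega) (by omega)
      (by rw [Walk.length_reverse]; omega) c2 (by omega)⟩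
  by_cases c3 : L₁.length = 1
  · exact ⟨_, h.swap₁₂.isBalancedOneTwo hG (by rw [Walk.length_reverse]; omega)
      (by rw [Walk.length_reverse]; omega) (by omega) c3 (by omega)⟩
  by_cases c4 : Q₂.length = 1
  · exact ⟨_, h.swap₁₂.swap₃₄.isBalancedOneTwo hG (by rw [Walk.length_reverse]; omega)
      (by rw [Walk.length_reverse]; omega) (by rw [Walk.length_reverse]; omega) c4 (by omega)⟩
  have k1 := h.quad_eq_nine hG c1 c4 (by omega)
  have k2 := h.swap₃₄.quad_eq_nine hG c2 c3 (by rw [Walk.length_reverse]; omega)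
  rw [Walk.length_reverse] at k2
  exact (h.meet.ne₃₄ (Walk.eq_of_length_eq_zero (p := P₂) (by omega))).elim

end IsInducedK4

/-! ### Splitting the paths of an induced theta -/

theorem eq_of_mem_append {a b c x : V} {p : G.Walk a b} {q : G.Walk b c}
    (h : (p.append q).IsPath) (hp : x ∈ p.support) (hq : x ∈ q.support) : x = b := by
  rw [Walk.isPath_def, Walk.support_append, List.nodup_append'] at h
  rw [← Walk.cons_tail_support, List.mem_cons] at hq
  exact hq.resolve_right fun h' => List.disjoint_left.1 h.2.2 hp h'

theorem exists_split {a b : V} (p : G.Walk a b) {i : ℕ} (hi : i ≤ p.length) :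
    ∃ (q : G.Walk a (p.getVert i)) (r : G.Walk (p.getVert i) b), p = q.append r ∧ q.length = i ∧
      r.length = p.length - i :=
  ⟨p.take i, p.drop i, (p.append_take_drop_eq i).symm, by simpa using hi, by simp⟩

theorem exists_split₃ {a b : V} (p : G.Walk a b) {i j : ℕ} (hij : i ≤ j) (hj : j ≤ p.length) :
    ∃ (q : G.Walk a (p.getVert i)) (r : G.Walk (p.getVert i) (p.getVert j))
      (s : G.Walk (p.getVert j) b), p = q.append (r.append s) ∧ q.length = i ∧ r.length = j - i ∧
      s.length = p.length - j := by
  obtain ⟨q, r, h, hq, hr⟩ := exists_split p (hij.trans hj)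
  obtain ⟨s, t, h', hs, ht⟩ := exists_split r (i := j - i) (by omega)
  have hv : r.getVert (j - i) = p.getVert j := by
    conv_rhs => rw [h]
    rw [Walk.getVert_append, if_neg (by omega), hq]
  refine ⟨q, s.copy rfl hv, t.copy hv rfl, ?_, hq, by simpa using hs, by simp; omega⟩
  rw [Walk.append_copy_copy, Walk.copy_rfl_rfl]
  exact h.trans (congrArg q.append h')

theorem exists_split_of_mem {a b x : V} (p : G.Walk a b) (hx : x ∈ p.support) :
    ∃ (q : G.Walk a x) (r : G.Walk x b), p = q.append r :=
  Walk.mem_support_iff_exists_append.1 hx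

/-- The vertex set of the union of three walks with common ends. -/
def thetaSet {u v : V} (S A P : G.Walk u v) : Set V :=
  {x | x ∈ S.support ∨ x ∈ A.support ∨ x ∈ P.support}

namespace IsTheta

variable {d : ℕ} {u v : V} {S A P : G.Walk u v}

theorem swap (h : IsTheta d S A P) : IsTheta d S P A := by
  refine ⟨h.two_le, h.le_four, h.isPath_S, h.isPath_P, h.isPath_A, h.length_S, h.length_P, h.length_A,
    h.disj_SP, h.disj_SA, fun x hx hx' => h.disj_AP x hx' hx, fun x y hx hy hxy => ?_⟩
  have := h.chord x y (by tauto) (by tauto) hxy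
  tauto

theorem reverse (h : IsTheta d S A P) : IsTheta d S.reverse A.reverse P.reverse := by
  obtain ⟨h1, h2, h3, h4, h5, h6, h7, h8, h9, h10, h11, h12⟩ := h
  refine ⟨h1, h2, h3.reverse, h4.reverse, h5.reverse, ?_, ?_, ?_, ?_, ?_, ?_, ?_⟩ <;>
    simp only [Walk.length_reverse, Walk.support_reverse, List.mem_reverse, Walk.edges_reverse] <;>
    first | assumption | skip
  · exact fun x hx hx' => (h9 x hx hx').symm
  · exact fun x hx hx' => (h10 x hx hx').symm
  · exact fun x hx hx' => (h11 x hx hx').symm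

theorem thetaSet_swap : thetaSet S P A = thetaSet S A P := by
  ext x; simp only [thetaSet, Set.mem_ofPred_eq]; tauto

theorem thetaSet_reverse : thetaSet S.reverse A.reverse P.reverse = thetaSet S A P := by
  ext x; simp [thetaSet]

/-- A path attached to a theta whose ends are inner vertices of the short path and of a
long path completes an induced subdivision of `K₄`. -/
theorem isInducedK4_of_short (h : IsTheta d S A P) {x y : V} {S₁ : G.Walk u x} {S₂ : G.Walk x v}
    {A₁ : G.Walk u y} {A₂ : G.Walk y v} (hS : S = S₁.append S₂) (hA : A = A₁.append A₂)
    (hx : x ∉ A.support) (hy : y ∉ S.support) {R : G.Walk x y}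
    (hR : IsAttached (thetaSet S A P) ∅ R) : IsInducedK4 S₁ A₂.reverse S₂ A₁ P R := by
  obtain ⟨-, -, h3, h4, h5, h6, h7, h8, h9, h10, h11, h12⟩ := h
  have hm := hR.meets
  have he := fun x y hx hy hxy => hR.mem_edges_or (x := x) (y := y) hx hy hxy
  have hRp := hR.isPath
  have a1 : ∀ z, z ∈ S₁.support → z ∈ S₂.support → z = x := fun z => eq_of_mem_append (hS ▸ h3)
  have a2 : ∀ z, z ∈ A₁.support → z ∈ A₂.support → z = y := fun z => eq_of_mem_append (hA ▸ h4)
  subst hS hA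
  have b1 := h3.of_append_left
  have b2 := h3.of_append_right
  have b3 := h4.of_append_left
  have b4 := h4.of_append_right
  have c1 := S₁.start_mem_support
  have c2 := S₂.end_mem_support
  have c3 := A₁.start_mem_support
  have c4 := A₂.end_mem_support
  have c5 := P.start_mem_support
  have c6 := P.end_mem_support
  have c7 := S₁.end_mem_support
  have c8 := A₁.end_mem_support
  simp only [thetaSet, Set.mem_ofPred_eq, Walk.mem_support_append_iff, Walk.edges_append,
    List.mem_append, not_or] at *
  have d1 : u ∉ S₂.support := fun h => hx.1 ((a1 u c1 h) ▸ c3)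
  have d2 : v ∉ S₁.support := fun h => hx.2 ((a1 v h c2) ▸ c4)
  have d3 : u ∉ A₂.support := fun h => hy.1 ((a2 u c3 h) ▸ c1)
  have d4 : v ∉ A₁.support := fun h => hy.2 ((a2 v h c4) ▸ c2)
  have e1 : x ∉ P.support := fun h => by rcases h10 x (Or.inl c7) h with rfl | rfl <;> tauto
  have e2 : y ∉ P.support := fun h => by rcases h11 y (Or.inl c8) h with rfl | rfl <;> tauto
  refine ⟨⟨?_, ?_, ?_, ?_, ?_, ?_, ?_, ?_, ?_, ?_, ?_, ?_, ?_, ?_, ?_⟩,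
    b1, b4.reverse, b2, b3, h5, hRp, ?_⟩
  on_goal 16 =>
    clear hR h9 h10 h11 hm a1 a2 hx hy
    simp only [Walk.support_reverse, List.mem_reverse, Walk.edges_reverse]
    intro z w hz hw hzw
    have key := he z w (by rcases hz with h | h | h | h | h | h <;> simp only [h, true_or, or_true])
      (by rcases hw with h | h | h | h | h | h <;> simp only [h, true_or, or_true]) hzw
    rcases key with h | ⟨k1, k2⟩
    · simp only [h, or_true]
    · rcases h12 z w k1 k2 hzw with (h | h) | (h | h) | h <;> simp only [h, true_or, or_true]
  all_goals
    clear h12 he hR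
    try simp only [Walk.support_reverse, List.mem_reverse]
    intro z hz
    grind

end IsTheta

/-- `G` has a `K₄`-subdivision that is odd or balanced of type `(1, 2)`. -/
def HasOddOrBalancedK4 (G : SimpleGraph V) : Prop :=
  (∃ H : K4Subdivision G, H.IsOdd) ∨ ∃ H : K4Subdivision G, H.IsBalancedOneTwo

/-! ### Paths attached to an induced theta by their ends -/

namespace IsTheta

variable {d : ℕ} {u v : V} {S A P : G.Walk u v}

theorem not_isAttached_short_of_odd (hG : Nonagonal G) (hbad : ¬ HasOddOrBalancedK4 G)
    (h : IsTheta d S A P) {x y : V} {S₁ : G.Walk u x} {S₂ : G.Walk x v}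
    {A₁ : G.Walk u y} {A₂ : G.Walk y v} (hS : S = S₁.append S₂) (hA : A = A₁.append A₂)
    (hx : x ∉ A.support) (hy : y ∉ S.support) {R : G.Walk x y}
    (hR : IsAttached (thetaSet S A P) ∅ R) : (S₁.length + A₁.length + R.length) % 2 ≠ 1 := by
  intro hodd
  have hK := h.isInducedK4_of_short hS hA hx hy hR
  have hl := hG.eq_nine_of_isOddHole _ _ ⟨hK.isHole_C₂ hG, by
    rw [Nat.odd_iff]; simpa using (by omega : (S₁.length + R.length + A₁.length) % 2 = 1)⟩
  have hS' := congrArg Walk.length hS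
  have hA' := congrArg Walk.length hA
  have hA₂ : A₂.length ≠ 0 := fun h0 => by
    obtain rfl := Walk.eq_of_length_eq_zero h0
    exact hy S.end_mem_support
  have h1 := h.length_S
  have h2 := h.length_A
  have h3 := h.length_P
  have h4 := h.le_four
  simp only [Walk.length_append, Walk.length_reverse] at hl hS' hA'
  exact hbad (hK.odd_or_balanced hG (by omega) (by omega) (by omega) (by omega))

/-- A path attached to a theta whose ends are inner vertices of the short path and of a
long path gives an odd or balanced subdivision of `K₄`: the path closes one of two cycles through
the ends of the theta to an odd one. -/
theorem not_isAttached_short (hG : Nonagonal G) (hbad : ¬ HasOddOrBalancedK4 G)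
    (h : IsTheta d S A P) {x y : V} (hxS : x ∈ S.support) (hyA : y ∈ A.support)
    (hx : x ∉ A.support) (hy : y ∉ S.support) {R : G.Walk x y} :
    ¬ IsAttached (thetaSet S A P) ∅ R := by
  intro hR
  obtain ⟨S₁, S₂, hS⟩ := exists_split_of_mem S hxS
  obtain ⟨A₁, A₂, hA⟩ := exists_split_of_mem A hyA
  have k1 := h.not_isAttached_short_of_odd hG hbad hS hA hx hy hR
  have k2 := h.reverse.not_isAttached_short_of_odd hG hbad
    ((congrArg Walk.reverse hS).trans (Walk.reverse_append _ _))
    ((congrArg Walk.reverse hA).trans (Walk.reverse_append _ _)) (by simpa using hx)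
    (by simpa using hy) (thetaSet_reverse (S := S) ▸ hR)
  have hS' := congrArg Walk.length hS
  have hA' := congrArg Walk.length hA
  have h1 := h.length_S
  have h2 := h.length_A
  have h4 := h.le_four
  simp only [Walk.length_append, Walk.length_reverse] at k2 hS' hA'
  omega

/-- A path attached to a theta at inner vertices of both long paths completes an induced
subdivision of `K₄`. -/
theorem isInducedK4_of_long (h : IsTheta d S A P) {x y : V} {A₁ : G.Walk u x} {A₂ : G.Walk x v}
    {P₁ : G.Walk u y} {P₂ : G.Walk y v} (hA : A = A₁.append A₂) (hP : P = P₁.append P₂)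
    (hx : x ∉ P.support) (hy : y ∉ A.support) {R : G.Walk x y}
    (hR : IsAttached (thetaSet S A P) ∅ R) : IsInducedK4 S R A₂.reverse P₁ A₁ P₂.reverse := by
  obtain ⟨-, -, h3, h4, h5, h6, h7, h8, h9, h10, h11, h12⟩ := h
  have hm := hR.meets
  have he := fun x y hx hy hxy => hR.mem_edges_or (x := x) (y := y) hx hy hxy
  have hRp := hR.isPath
  have a1 : ∀ z, z ∈ A₁.support → z ∈ A₂.support → z = x := fun z => eq_of_mem_append (hA ▸ h4)
  have a2 : ∀ z, z ∈ P₁.support → z ∈ P₂.support → z = y := fun z => eq_of_mem_append (hP ▸ h5)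
  subst hA hP
  have b1 := h4.of_append_left
  have b2 := h4.of_append_right
  have b3 := h5.of_append_left
  have b4 := h5.of_append_right
  have c1 := A₁.start_mem_support
  have c2 := A₂.end_mem_support
  have c3 := P₁.start_mem_support
  have c4 := P₂.end_mem_support
  have c5 := S.start_mem_support
  have c6 := S.end_mem_support
  have c7 := A₁.end_mem_support
  have c8 := P₁.end_mem_support
  simp only [thetaSet, Set.mem_ofPred_eq, Walk.mem_support_append_iff, Walk.edges_append,
    List.mem_append, not_or] at *
  have d1 : u ∉ A₂.support := fun h => hx.1 ((a1 u c1 h) ▸ c3)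
  have d2 : v ∉ A₁.support := fun h => hx.2 ((a1 v h c2) ▸ c4)
  have d3 : u ∉ P₂.support := fun h => hy.1 ((a2 u c3 h) ▸ c1)
  have d4 : v ∉ P₁.support := fun h => hy.2 ((a2 v h c4) ▸ c2)
  have e1 : x ∉ S.support := fun h => by rcases h9 x h (Or.inl c7) with rfl | rfl <;> tauto
  have e2 : y ∉ S.support := fun h => by rcases h10 y h (Or.inl c8) with rfl | rfl <;> tauto
  refine ⟨⟨?_, ?_, ?_, ?_, ?_, ?_, ?_, ?_, ?_, ?_, ?_, ?_, ?_, ?_, ?_⟩, h3, hRp, b2.reverse, b3, b1,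
    b4.reverse, ?_⟩
  on_goal 16 =>
    clear hR h9 h10 h11 hm a1 a2 hx hy
    simp only [Walk.support_reverse, List.mem_reverse, Walk.edges_reverse]
    intro z w hz hw hzw
    have key := he z w (by rcases hz with h | h | h | h | h | h <;> simp only [h, true_or, or_true])
      (by rcases hw with h | h | h | h | h | h <;> simp only [h, true_or, or_true]) hzw
    rcases key with h | ⟨k1, k2⟩
    · simp only [h, true_or, or_true]
    · rcases h12 z w k1 k2 hzw with h | (h | h) | (h | h) <;> simp only [h, true_or, or_true]
  all_goals
    clear h12 he hR
    try simp only [Walk.support_reverse, List.mem_reverse]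
    intro z hz
    grind

theorem not_isAttached_long (hG : Nonagonal G) (hbad : ¬ HasOddOrBalancedK4 G)
    (h : IsTheta d S A P) {x y : V} {A₁ : G.Walk u x} {A₂ : G.Walk x v}
    {P₁ : G.Walk u y} {P₂ : G.Walk y v} (hA : A = A₁.append A₂) (hP : P = P₁.append P₂)
    (hx : x ∉ P.support) (hy : y ∉ A.support) (hu : ¬ (A₁.length = 1 ∧ P₁.length = 1))
    (hv : ¬ (A₂.length = 1 ∧ P₂.length = 1)) {R : G.Walk x y} :
    ¬ IsAttached (thetaSet S A P) ∅ R := by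
  intro hR
  have hK := h.isInducedK4_of_long hA hP hx hy hR
  have hA' := congrArg Walk.length hA
  have hP' := congrArg Walk.length hP
  have h1 := h.length_S
  have h2 := h.length_A
  have h3 := h.length_P
  have h4 := h.le_four
  simp only [Walk.length_append] at hA' hP'
  refine hbad (hK.odd_or_balanced hG ?_ ?_ ?_ ?_) <;> try simp only [Walk.length_reverse]
  all_goals omega

/-- A connection between inner vertices of the two long paths, other than between neighbours of
the same end of the theta, gives an odd or balanced subdivision of `K₄`. -/
theorem eq_one_or_of_isAttached (hG : Nonagonal G) (hbad : ¬ HasOddOrBalancedK4 G)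
    (h : IsTheta d S A P) {i j : ℕ} (hi : i ≤ A.length) (hj : j ≤ P.length)
    (hx : A.getVert i ∉ P.support) (hy : P.getVert j ∉ A.support)
    {R : G.Walk (A.getVert i) (P.getVert j)} (hR : IsAttached (thetaSet S A P) ∅ R) :
    i = 1 ∧ j = 1 ∨ i + 1 = A.length ∧ j + 1 = P.length := by
  obtain ⟨A₁, A₂, hA, h1, h2⟩ := exists_split A hi
  obtain ⟨P₁, P₂, hP, h3, h4⟩ := exists_split P hj
  by_contra hcon
  exact h.not_isAttached_long hG hbad hA hP hx hy (by omega) (by omega) hR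

end IsTheta

/-- A path attached at `a` and `b` forms a hole with the detour from `a` back along `A₁` to `u`, along
`X` to `v`, and back along `A₃` to `b`. -/
theorem IsAttached.detour_length_eq_nine (hG : Nonagonal G) {F Z : Set V} {u a b v : V}
    {A₁ : G.Walk u a} {A₃ : G.Walk b v} {X : G.Walk u v} {R : G.Walk a b}
    (hR : IsAttached F Z R) (hq : ((A₁.reverse.append X).append A₃.reverse).IsPath)
    (hF : ∀ x, x ∈ X.support ∨ x ∈ A₁.support ∨ x ∈ A₃.support → x ∈ F ∧ x ∉ Z)
    (hc : ∀ x y, x ∈ X.support ∨ x ∈ A₁.support ∨ x ∈ A₃.support →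
      y ∈ X.support ∨ y ∈ A₁.support ∨ y ∈ A₃.support → G.Adj x y →
      s(x, y) ∈ X.edges ∨ s(x, y) ∈ A₁.edges ∨ s(x, y) ∈ A₃.edges)
    (hodd : (R.length + (A₁.length + X.length + A₃.length)) % 2 = 1) :
    R.length + (A₁.length + X.length + A₃.length) = 9 := by
  have key : ∀ x ∈ ((A₁.reverse.append X).append A₃.reverse).support,
      x ∈ X.support ∨ x ∈ A₁.support ∨ x ∈ A₃.support := fun x hx => by
    simp only [Walk.mem_support_append_iff, Walk.support_reverse, List.mem_reverse] at hx
    tauto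
  have := hR.add_length_eq_nine hG hq (fun x hx => (hF x (key x hx)).1)
    (fun x hx => (hF x (key x hx)).2) (fun x hx y hy hxy => ?_) (by simpa using hodd)
  · simpa using this
  · have := hc x y (key x hx) (key y hy) hxy
    simp only [Walk.edges_append, List.mem_append, Walk.edges_reverse, List.mem_reverse]
    tauto

theorem isPath_detour {u a b v : V} {A₁ : G.Walk u a} {B : G.Walk a b} {A₃ : G.Walk b v}
    {X : G.Walk u v} (hX : X.IsPath) (hA : (A₁.append (B.append A₃)).IsPath) (hab : a ≠ b)
    (hd : ∀ x ∈ X.support, x ∈ (A₁.append (B.append A₃)).support → x = u ∨ x = v) :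
    ((A₁.reverse.append X).append A₃.reverse).IsPath := by
  have h1 := hA.of_append_left
  have h2 := hA.of_append_right.of_append_right
  have e1 : ∀ x ∈ A₁.support, x ∉ A₃.support := fun x hx hx' => by
    obtain rfl := eq_of_mem_append hA hx (by simp [hx'])
    exact hab (eq_of_mem_append hA.of_append_right B.start_mem_support hx')
  have c1 := A₁.start_mem_support
  have c2 := A₃.end_mem_support
  refine isPath_append (isPath_append h1.reverse hX fun x hx hx' => ?_) h2.reverse fun x hx hx' => ?_
  · rw [Walk.support_reverse, List.mem_reverse] at hx
    refine (hd x hx' (by simp [hx])).resolve_right ?_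
    rintro rfl
    exact e1 _ hx c2
  · simp only [Walk.mem_support_append_iff, Walk.support_reverse, List.mem_reverse] at hx hx'
    rcases hx with hx | hx
    · exact (e1 x hx hx').elim
    · refine (hd x hx (by simp [hx'])).resolve_left ?_
      rintro rfl
      exact e1 _ c1 hx'

namespace IsTheta

variable {d : ℕ} {u v : V} {S A P : G.Walk u v}

theorem chord_detour_short (h : IsTheta d S A P) {a b : V} {A₁ : G.Walk u a} {B : G.Walk a b}
    {A₃ : G.Walk b v} (hA : A = A₁.append (B.append A₃)) (hB : 2 ≤ B.length) (x y : V)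
    (hx : x ∈ S.support ∨ x ∈ A₁.support ∨ x ∈ A₃.support)
    (hy : y ∈ S.support ∨ y ∈ A₁.support ∨ y ∈ A₃.support) (hxy : G.Adj x y) :
    s(x, y) ∈ S.edges ∨ s(x, y) ∈ A₁.edges ∨ s(x, y) ∈ A₃.edges := by
  subst hA
  have hAp := h.isPath_A
  have hl := h.length_P
  have h4 := h.le_four
  have k1 : s(x, y) ∉ B.edges := fun he => by
    have key : ∀ z ∈ B.support, z ∈ S.support ∨ z ∈ A₁.support ∨ z ∈ A₃.support → z = a ∨ z = b := by
      rintro z hz (hz' | hz' | hz')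
      · rcases h.disj_SA z hz' (by simp [hz]) with rfl | rfl
        · exact Or.inl (eq_of_mem_append hAp A₁.start_mem_support (by simp [hz]))
        · exact Or.inr (eq_of_mem_append hAp.of_append_right hz A₃.end_mem_support)
      · exact Or.inl (eq_of_mem_append hAp hz' (by simp [hz]))
      · exact Or.inr (eq_of_mem_append hAp.of_append_right hz hz')
    have := length_eq_one_of_edge_ends hAp.of_append_right.of_append_left he
      (key x (B.fst_mem_support_of_mem_edges he) hx) (key y (B.snd_mem_support_of_mem_edges he) hy)
    omega
  have k2 : s(x, y) ∉ P.edges := fun he => by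
    have key : ∀ z ∈ P.support, z ∈ S.support ∨ z ∈ A₁.support ∨ z ∈ A₃.support → z = u ∨ z = v := by
      rintro z hz (hz' | hz' | hz')
      · exact h.disj_SP z hz' hz
      · exact h.disj_AP z (by simp [hz']) hz
      · exact h.disj_AP z (by simp [hz']) hz
    have := length_eq_one_of_edge_ends h.isPath_P he
      (key x (P.fst_mem_support_of_mem_edges he) hx) (key y (P.snd_mem_support_of_mem_edges he) hy)
    omega
  have := h.chord x y (by simp; tauto) (by simp; tauto) hxy
  simp only [Walk.edges_append, List.mem_append] at this
  tauto

theorem chord_detour_long (h : IsTheta d S A P) {a b : V} {A₁ : G.Walk u a} {B : G.Walk a b}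
    {A₃ : G.Walk b v} (hA : A = A₁.append (B.append A₃)) (hB : 2 ≤ B.length) (x y : V)
    (hx : x ∈ P.support ∨ x ∈ A₁.support ∨ x ∈ A₃.support)
    (hy : y ∈ P.support ∨ y ∈ A₁.support ∨ y ∈ A₃.support) (hxy : G.Adj x y) :
    s(x, y) ∈ P.edges ∨ s(x, y) ∈ A₁.edges ∨ s(x, y) ∈ A₃.edges := by
  subst hA
  have hAp := h.isPath_A
  have hl := h.length_S
  have h4 := h.two_le
  have k1 : s(x, y) ∉ B.edges := fun he => by
    have key : ∀ z ∈ B.support, z ∈ P.support ∨ z ∈ A₁.support ∨ z ∈ A₃.support → z = a ∨ z = b := by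
      rintro z hz (hz' | hz' | hz')
      · rcases h.disj_AP z (by simp [hz]) hz' with rfl | rfl
        · exact Or.inl (eq_of_mem_append hAp A₁.start_mem_support (by simp [hz]))
        · exact Or.inr (eq_of_mem_append hAp.of_append_right hz A₃.end_mem_support)
      · exact Or.inl (eq_of_mem_append hAp hz' (by simp [hz]))
      · exact Or.inr (eq_of_mem_append hAp.of_append_right hz hz')
    have := length_eq_one_of_edge_ends hAp.of_append_right.of_append_left he
      (key x (B.fst_mem_support_of_mem_edges he) hx) (key y (B.snd_mem_support_of_mem_edges he) hy)
    omega
  have k2 : s(x, y) ∉ S.edges := fun he => by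
    have key : ∀ z ∈ S.support, z ∈ P.support ∨ z ∈ A₁.support ∨ z ∈ A₃.support → z = u ∨ z = v := by
      rintro z hz (hz' | hz' | hz')
      · exact h.disj_SP z hz hz'
      · exact h.disj_SA z hz (by simp [hz'])
      · exact h.disj_SA z hz (by simp [hz'])
    have := length_eq_one_of_edge_ends h.isPath_S he
      (key x (S.fst_mem_support_of_mem_edges he) hx) (key y (S.snd_mem_support_of_mem_edges he) hy)
    omega
  have := h.chord x y (by simp; tauto) (by simp; tauto) hxy
  simp only [Walk.edges_append, List.mem_append] at this
  tauto

/-- A path attached to a theta at two vertices of a long path at distance `2`, `3` or `4`, and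
possibly at vertices between them, cannot exist: parity fails for the two detours along the short
and the other long path. -/
theorem not_isAttached_near (hG : Nonagonal G) (h : IsTheta d S A P) {a b : V} {A₁ : G.Walk u a}
    {B : G.Walk a b} {A₃ : G.Walk b v} (hA : A = A₁.append (B.append A₃)) (h2 : 2 ≤ B.length)
    (hB4 : B.length ≤ 4) {Z : Set V} (hZ : ∀ x, x ∈ S.support ∨ x ∈ P.support ∨ x ∈ A₁.support ∨
      x ∈ A₃.support → x ∉ Z) {R : G.Walk a b} : ¬ IsAttached (thetaSet S A P) Z R := by
  intro hR
  have hAp : (A₁.append (B.append A₃)).IsPath := hA ▸ h.isPath_A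
  have hT : ∀ x, x ∈ A₁.support ∨ x ∈ B.support ∨ x ∈ A₃.support → x ∈ A.support := fun x hx => by
    rw [hA]; simpa using hx
  have hRB := hG.nine_le_of_ne hR.isPath hAp.of_append_right.of_append_left
    (hR.ne_walk (fun x hx => Or.inr (Or.inl (hT x (by tauto)))) h2)
  have hl := congrArg Walk.length hA
  simp only [Walk.length_append] at hl
  have l1 := h.length_S
  have l2 := h.length_A
  have l3 := h.length_P
  have l4 := h.le_four
  by_cases hpar : (R.length + (A₁.length + S.length + A₃.length)) % 2 = 1
  · have := hR.detour_length_eq_nine hG (isPath_detour h.isPath_S hAp hR.ne (hA ▸ h.disj_SA))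
      (fun x hx => ⟨?_, hZ x (by tauto)⟩) (h.chord_detour_short hA h2) hpar
    · omega
    · rcases hx with hx | hx
      · exact Or.inl hx
      · exact Or.inr (Or.inl (hT x (by tauto)))
  · have := hR.detour_length_eq_nine hG (isPath_detour h.isPath_P hAp hR.ne
      (hA ▸ fun x hx hx' => h.disj_AP x hx' hx))
      (fun x hx => ⟨?_, hZ x (by tauto)⟩) (h.chord_detour_long hA h2) (by omega)
    · omega
    · rcases hx with hx | hx
      · exact Or.inr (Or.inr hx)
      · exact Or.inr (Or.inl (hT x (by tauto)))

/-- A path attached to a theta at two vertices of a long path at distance at least `5`, other than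
both its ends, gives a theta with a longer short path. -/
theorem exists_larger (hG : Nonagonal G) (h : IsTheta d S A P) {a b : V} {A₁ : G.Walk u a}
    {B : G.Walk a b} {A₃ : G.Walk b v} (hA : A = A₁.append (B.append A₃)) (h5 : 5 ≤ B.length)
    (hlt : B.length < A.length) {R : G.Walk a b} (hR : IsAttached (thetaSet S A P) ∅ R) :
    ∃ d' > d, ∃ S' A' P' : G.Walk a b, IsTheta d' S' A' P' := by
  have hAp : (A₁.append (B.append A₃)).IsPath := hA ▸ h.isPath_A
  have hT : ∀ x, x ∈ A₁.support ∨ x ∈ B.support ∨ x ∈ A₃.support → x ∈ A.support := fun x hx => by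
    rw [hA]; simpa using hx
  have hl := congrArg Walk.length hA
  simp only [Walk.length_append] at hl
  have l1 := h.length_S
  have l2 := h.length_A
  have l4 := h.two_le
  have hSA := h.disj_SA
  have hch := h.chord
  refine ⟨9 - B.length, by omega, _, B, R, IsTheta.of_isAttached hG (by omega) (by omega)
    (isPath_detour h.isPath_S hAp hR.ne (hA ▸ h.disj_SA)) hAp.of_append_right.of_append_left
    (by simp; omega) (by omega) ?_ ?_ (hR.mono ?_ (by simp) (by simp) (by simp))⟩
  · intro z hz' hz
    simp only [Walk.mem_support_append_iff, Walk.support_reverse, List.mem_reverse] at hz'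
    rcases hz' with (hz' | hz') | hz'
    · exact Or.inl (eq_of_mem_append hAp hz' (by simp [hz]))
    · rcases hSA z hz' (hT z (by tauto)) with rfl | rfl
      · exact Or.inl (eq_of_mem_append hAp A₁.start_mem_support (by simp [hz]))
      · exact Or.inr (eq_of_mem_append hAp.of_append_right hz A₃.end_mem_support)
    · exact Or.inr (eq_of_mem_append hAp.of_append_right hz hz')
  · have key : ∀ z, (z ∈ ((A₁.reverse.append S).append A₃.reverse).support ∨ z ∈ B.support) →
        z ∈ S.support ∨ z ∈ A.support := fun z hz => by
      simp only [Walk.mem_support_append_iff, Walk.support_reverse, List.mem_reverse] at hz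
      have := hT z
      tauto
    intro x y hx hy hxy
    have k2 : s(x, y) ∉ P.edges := fun he => by
      have key' : ∀ z ∈ P.support, z ∈ S.support ∨ z ∈ A.support → z = u ∨ z = v := by
        rintro z hz (hz' | hz')
        · exact h.disj_SP z hz' hz
        · exact h.disj_AP z hz' hz
      have := length_eq_one_of_edge_ends h.isPath_P he
        (key' x (P.fst_mem_support_of_mem_edges he) (key x hx))
        (key' y (P.snd_mem_support_of_mem_edges he) (key y hy))
      have := h.length_P
      have := h.le_four
      omega
    have := hch x y (by have := key x hx; tauto) (by have := key y hy; tauto) hxy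
    rw [hA] at this
    simp only [Walk.edges_append, List.mem_append, Walk.edges_reverse, List.mem_reverse] at this ⊢
    tauto
  · intro z hz
    simp only [Set.mem_ofPred_eq, Walk.mem_support_append_iff, Walk.support_reverse,
      List.mem_reverse] at hz
    have := hT z
    simp only [thetaSet, Set.mem_ofPred_eq]
    tauto

end IsTheta

/-! ### Neighbours of an induced theta -/

theorem Nonagonal.seven_le_of_adj (hG : Nonagonal G) {z x y : V} (hxy : x ≠ y) (hx : G.Adj z x)
    (hy : G.Adj z y) (B : G.Walk x y) (hz : z ∉ B.support) : 7 ≤ B.length := by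
  classical
  have := hG.nine_le_of_ne (p := Walk.cons hx.symm hy.toWalk) (q := B.bypass)
    (by simp [hx.ne.symm, hy.ne, hxy]) B.bypass_isPath (fun h => hz (B.support_bypass_subset_support (by
      rw [← h]; simp)))
  have h2 := B.length_bypass_le_length
  simp only [Walk.length_cons, Walk.length_nil] at this
  omega

/-- A vertex off a closed walk of length at most nine has at most one neighbour on it. -/
theorem Nonagonal.eq_of_adj (hG : Nonagonal G) {u z x y : V} {c : G.Walk u u} (hc : c.length ≤ 9)
    (hz : z ∉ c.support) (hx : x ∈ c.support) (hy : y ∈ c.support) (hzx : G.Adj z x)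
    (hzy : G.Adj z y) : x = y := by
  classical
  by_contra hne
  obtain ⟨B, B', hB⟩ := exists_split_of_mem (c.rotate x hx) ((c.mem_support_rotate_iff x hx).2 hy)
  have hz' : z ∉ (B.append B').support := by rwa [← hB, c.mem_support_rotate_iff x hx]
  have hl := congrArg Walk.length hB
  rw [Walk.mem_support_append_iff, not_or] at hz'
  rw [Walk.length_append, Walk.length_rotate] at hl
  have h1 := hG.seven_le_of_adj hne hzx hzy B hz'.1
  have h2 := hG.seven_le_of_adj (Ne.symm hne) hzy hzx B' hz'.2
  omega

namespace IsTheta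

variable {d : ℕ} {u v : V} {S A P : G.Walk u v}

theorem eq_of_adj_left (hG : Nonagonal G) (h : IsTheta d S A P) {z x y : V}
    (hz : z ∉ thetaSet S A P) (hx : x ∈ S.support ∨ x ∈ A.support)
    (hy : y ∈ S.support ∨ y ∈ A.support) (hzx : G.Adj z x) (hzy : G.Adj z y) : x = y := by
  have h1 := h.length_S
  have h2 := h.length_A
  have h3 := h.le_four
  refine hG.eq_of_adj (c := S.append A.reverse) (by simp; omega) (fun hz' => hz ?_) (by simpa using hx)
    (by simpa using hy) hzx hzy
  simp only [thetaSet, Set.mem_ofPred_eq, Walk.mem_support_append_iff, Walk.support_reverse,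
    List.mem_reverse] at hz' ⊢
  tauto

theorem eq_of_adj_long (hG : Nonagonal G) (hbad : ¬ HasOddOrBalancedK4 G) (h : IsTheta d S A P)
    {z x y : V} (hz : z ∉ thetaSet S A P) (hx : x ∈ A.support) (hy : y ∈ P.support)
    (hzx : G.Adj z x) (hzy : G.Adj z y) : x = y := by
  have hz' : z ∉ thetaSet S P A := by rwa [thetaSet_swap]
  by_contra hne
  have hxP : x ∉ P.support := fun hx' =>
    hne (h.swap.eq_of_adj_left hG hz' (Or.inr hx') (Or.inr hy) hzx hzy)
  have hyA : y ∉ A.support := fun hy' =>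
    hne (h.eq_of_adj_left hG hz (Or.inr hx) (Or.inr hy') hzx hzy)
  obtain ⟨R, hR, -⟩ := IsAttached.of_seq (G := G) (F := thetaSet S A P) (Z := ∅) (p := fun _ => z)
    (s := 0) (t := 0) (f := x) (g := y) le_rfl ⟨by omega, by omega, by omega⟩ (fun _ _ _ => hz)
    (Or.inr (Or.inl hx)) (Or.inr (Or.inr hy)) hne (by simp) (by simp) hzx.symm hzy (by
      rintro i - hi t (ht | ht | ht) hzt
      · exact Or.inl ⟨by omega, (h.eq_of_adj_left hG hz (Or.inr hx) (Or.inl ht) hzx hzt).symm⟩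
      · exact Or.inl ⟨by omega, (h.eq_of_adj_left hG hz (Or.inr hx) (Or.inr ht) hzx hzt).symm⟩
      · exact Or.inr (Or.inl ⟨by omega,
          (h.swap.eq_of_adj_left hG hz' (Or.inr hy) (Or.inr ht) hzy hzt).symm⟩))
  obtain ⟨A₁, A₂, hA⟩ := exists_split_of_mem A hx
  obtain ⟨P₁, P₂, hP⟩ := exists_split_of_mem P hy
  have hzA : z ∉ A.support := fun h => hz (Or.inr (Or.inl h))
  have hzP : z ∉ P.support := fun h => hz (Or.inr (Or.inr h))
  rw [hA, Walk.mem_support_append_iff, not_or] at hzA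
  rw [hP, Walk.mem_support_append_iff, not_or] at hzP
  refine h.not_isAttached_long hG hbad hA hP hxP hyA ?_ ?_ hR
  · have := hG.seven_le_of_adj hne hzx hzy (A₁.reverse.append P₁) (by simp; tauto)
    simp only [Walk.length_append, Walk.length_reverse] at this
    omega
  · have := hG.seven_le_of_adj hne hzx hzy (A₂.append P₂.reverse) (by simp; tauto)
    simp only [Walk.length_append, Walk.length_reverse] at this
    omega

/-- In the absence of odd and balanced subdivisions of `K₄`, a vertex off a theta has at most one
neighbour on it. -/
theorem eq_of_adj (hG : Nonagonal G) (hbad : ¬ HasOddOrBalancedK4 G) (h : IsTheta d S A P)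
    {z x y : V} (hz : z ∉ thetaSet S A P) (hx : x ∈ thetaSet S A P) (hy : y ∈ thetaSet S A P)
    (hzx : G.Adj z x) (hzy : G.Adj z y) : x = y := by
  have hz' : z ∉ thetaSet S P A := by rwa [thetaSet_swap]
  rcases hx with hx | hx | hx <;> rcases hy with hy | hy | hy
  · exact h.eq_of_adj_left hG hz (Or.inl hx) (Or.inl hy) hzx hzy
  · exact h.eq_of_adj_left hG hz (Or.inl hx) (Or.inr hy) hzx hzy
  · exact h.swap.eq_of_adj_left hG hz' (Or.inl hx) (Or.inr hy) hzx hzy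
  · exact h.eq_of_adj_left hG hz (Or.inr hx) (Or.inl hy) hzx hzy
  · exact h.eq_of_adj_left hG hz (Or.inr hx) (Or.inr hy) hzx hzy
  · exact h.eq_of_adj_long hG hbad hz hx hy hzx hzy
  · exact h.swap.eq_of_adj_left hG hz' (Or.inr hx) (Or.inl hy) hzx hzy
  · exact (h.eq_of_adj_long hG hbad hz hy hx hzy hzx).symm
  · exact h.swap.eq_of_adj_left hG hz' (Or.inr hx) (Or.inr hy) hzx hzy

end IsTheta

/-! ### Paths between neighbouring corners of a theta -/

namespace IsTheta

variable {d : ℕ} {u v : V} {S A P : G.Walk u v}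

theorem chord_split (h : IsTheta d S A P) {x y : V} {A₁ : G.Walk u x} {A₂ : G.Walk x v}
    {P₁ : G.Walk u y} {P₂ : G.Walk y v} (hA : A = A₁.append A₂) (hP : P = P₁.append P₂) {z t : V}
    (hz : z ∈ S.support ∨ z ∈ A₁.support ∨ z ∈ A₂.support ∨ z ∈ P₁.support ∨ z ∈ P₂.support)
    (ht : t ∈ S.support ∨ t ∈ A₁.support ∨ t ∈ A₂.support ∨ t ∈ P₁.support ∨ t ∈ P₂.support)
    (hzt : G.Adj z t) : s(z, t) ∈ S.edges ∨ s(z, t) ∈ A₁.edges ∨ s(z, t) ∈ A₂.edges ∨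
      s(z, t) ∈ P₁.edges ∨ s(z, t) ∈ P₂.edges := by
  subst hA hP
  have := h.chord z t (by simpa [or_assoc] using hz) (by simpa [or_assoc] using ht) hzt
  simpa [or_assoc] using this

theorem meet_split (h : IsTheta d S A P) {x y : V} {A₁ : G.Walk u x} {A₂ : G.Walk x v}
    {P₁ : G.Walk u y} {P₂ : G.Walk y v} (hA : A = A₁.append A₂) (hP : P = P₁.append P₂)
    (hux : u ≠ x) (huy : u ≠ y) (hvx : v ≠ x) (hvy : v ≠ y) :
    (∀ z ∈ S.support, z ∈ A₁.support → z = u) ∧ (∀ z ∈ S.support, z ∈ A₂.support → z = v) ∧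
    (∀ z ∈ S.support, z ∈ P₁.support → z = u) ∧ (∀ z ∈ S.support, z ∈ P₂.support → z = v) ∧
    (∀ z ∈ A₁.support, z ∈ P₁.support → z = u) ∧ (∀ z ∈ A₁.support, z ∉ P₂.support) ∧
    (∀ z ∈ A₂.support, z ∉ P₁.support) ∧ (∀ z ∈ A₂.support, z ∈ P₂.support → z = v) ∧
    (∀ z ∈ A₁.support, z ∈ A₂.support → z = x) ∧ ∀ z ∈ P₁.support, z ∈ P₂.support → z = y := by
  have hSA := h.disj_SA
  have hSP := h.disj_SP
  have hAP := h.disj_AP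
  have a1 : ∀ z, z ∈ A₁.support → z ∈ A₂.support → z = x := fun z =>
    eq_of_mem_append (hA ▸ h.isPath_A)
  have a2 : ∀ z, z ∈ P₁.support → z ∈ P₂.support → z = y := fun z =>
    eq_of_mem_append (hP ▸ h.isPath_P)
  have d1 : u ∉ A₂.support := fun h => hux (a1 u A₁.start_mem_support h)
  have d2 : v ∉ A₁.support := fun h => hvx (a1 v h A₂.end_mem_support)
  have d3 : u ∉ P₂.support := fun h => huy (a2 u P₁.start_mem_support h)
  have d4 : v ∉ P₁.support := fun h => hvy (a2 v h P₂.end_mem_support)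
  subst hA hP
  clear h
  simp only [Walk.mem_support_append_iff] at hSA hSP hAP
  refine ⟨?_, ?_, ?_, ?_, ?_, ?_, ?_, ?_, a1, a2⟩ <;> intro z hz <;> grind

/-- A path from the second vertex of a long path of a theta to the first vertex of the other long
path cannot be attached to the theta at its ends and at the first vertex of the long path only:
both holes through it that avoid this vertex would have to be nonagons. -/
theorem not_isAttached_corner (hG : Nonagonal G) (h : IsTheta d S A P) {x y : V}
    {A₁ : G.Walk u x} {A₂ : G.Walk x v} {P₁ : G.Walk u y} {P₂ : G.Walk y v}
    (hA : A = A₁.append A₂) (hP : P = P₁.append P₂) (hA₁ : A₁.length = 2) (hP₁ : P₁.length = 1)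
    {w : V} (hw : w ∈ A.support) (hwA : w ∉ A₂.support) (hwu : w ≠ u) {R : G.Walk x y} :
    ¬ IsAttached (thetaSet S A P) {w} R := by
  intro hR
  have hAp : (A₁.append A₂).IsPath := hA ▸ h.isPath_A
  have hPp : (P₁.append P₂).IsPath := hP ▸ h.isPath_P
  have l1 := h.length_S
  have l2 := hA ▸ h.length_A
  have l3 := hP ▸ h.length_P
  have l4 := h.le_four
  have l5 := h.two_le
  rw [Walk.length_append] at l2 l3
  have hlen : ∀ {a b : V} {p : G.Walk a b}, p.IsPath → p.length ≠ 0 → a ≠ b := by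
    rintro a b p hp hl rfl
    exact hl (Walk.length_eq_zero_iff.2 (Walk.isPath_iff_nil.1 hp))
  have p1 := hAp.of_append_left
  have p2 := hAp.of_append_right
  have p3 := hPp.of_append_left
  have p4 := hPp.of_append_right
  obtain ⟨m1, m2, m3, m4, m5, m6, m7, m8, m9, m10⟩ := h.meet_split hA hP (hlen p1 (by omega))
    (hlen p3 (by omega)) (hlen p2 (by omega)).symm (hlen p4 (by omega)).symm
  have hwS : w ∉ S.support := fun hw' => by
    rcases h.disj_SA w hw' hw with rfl | rfl
    · exact hwu rfl
    · exact hwA A₂.end_mem_support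
  have hwP : w ∉ P.support := fun hw' => by
    rcases h.disj_AP w hw hw' with rfl | rfl
    · exact hwu rfl
    · exact hwA A₂.end_mem_support
  have hF : ∀ z, z ∈ S.support ∨ z ∈ A₂.support ∨ z ∈ P₁.support ∨ z ∈ P₂.support →
      z ∈ thetaSet S A P ∧ z ∉ ({w} : Set V) := fun z hz => by
    rw [hP, Walk.mem_support_append_iff, not_or] at hwP
    simp only [thetaSet, Set.mem_ofPred_eq, hA, hP, Walk.mem_support_append_iff,
      Set.mem_singleton_iff]
    rcases hz with hz | hz | hz | hz
    · exact ⟨Or.inl hz, by rintro rfl; exact hwS hz⟩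
    · exact ⟨Or.inr (Or.inl (Or.inr hz)), by rintro rfl; exact hwA hz⟩
    · exact ⟨Or.inr (Or.inr (Or.inl hz)), by rintro rfl; exact hwP.1 hz⟩
    · exact ⟨Or.inr (Or.inr (Or.inr hz)), by rintro rfl; exact hwP.2 hz⟩
  -- girth and the path from `x` to `y` through `u`
  have hR6 : 6 ≤ R.length := by
    have := hG.nine_le_of_ne (p := R) (q := A₁.reverse.append P₁) hR.isPath
      (isPath_append p1.reverse p3 fun z hz hz' => m5 z (by simpa using hz) hz')
      (hR.ne_walk (fun z hz => by
        simp only [Walk.mem_support_append_iff, Walk.support_reverse, List.mem_reverse] at hz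
        simp only [thetaSet, Set.mem_ofPred_eq, hA, hP, Walk.mem_support_append_iff]
        rcases hz with hz | hz <;> simp only [hz, true_or, or_true])
        (by rw [Walk.length_append, Walk.length_reverse]; omega))
    rw [Walk.length_append, Walk.length_reverse] at this
    omega
  by_cases hpar : R.length % 2 = 0
  · have key : ∀ z, z ∈ (A₂.append P₂.reverse).support → z ∈ A₂.support ∨ z ∈ P₂.support :=
      fun z hz => by simpa using hz
    have hkF := fun z hz => hF z ((key z hz).elim (fun h => Or.inr (Or.inl h))
      fun h => Or.inr (Or.inr (Or.inr h)))
    have := hR.add_length_eq_nine hG (q := A₂.append P₂.reverse)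
      (isPath_append p2 p4.reverse fun z hz hz' => m8 z hz (by simpa using hz'))
      (fun z hz => (hkF z hz).1) (fun z hz => (hkF z hz).2) (fun z hz t ht hzt => ?_)
      (by rw [Walk.length_append, Walk.length_reverse]; omega)
    · rw [Walk.length_append, Walk.length_reverse] at this
      omega
    · let X : V → Prop := fun z => z ∈ A₂.support ∨ z ∈ P₂.support
      have k1 := notMem_edges_of_subsingleton (r := S) (v := v) (X := X)
        (fun z hz (hz' : X z) => hz'.elim (m2 z hz) (m4 z hz)) (key z hz) (key t ht)
      have k2 := notMem_edges_of_subsingleton (r := A₁) (v := x) (X := X)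
        (fun z hz (hz' : X z) => hz'.elim (m9 z hz) fun h => (m6 z hz h).elim) (key z hz) (key t ht)
      have k3 := notMem_edges_of_subsingleton (r := P₁) (v := y) (X := X)
        (fun z hz (hz' : X z) => hz'.elim (fun h => (m7 z h hz).elim) (m10 z hz)) (key z hz) (key t ht)
      have kT : ∀ z, z ∈ A₂.support ∨ z ∈ P₂.support → z ∈ S.support ∨ z ∈ A₁.support ∨
          z ∈ A₂.support ∨ z ∈ P₁.support ∨ z ∈ P₂.support := by
        rintro z (hz | hz) <;> simp only [hz, true_or, or_true]
      rw [Walk.edges_append, List.mem_append, Walk.edges_reverse, List.mem_reverse]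
      rcases h.chord_split hA hP (kT z (key z hz)) (kT t (key t ht)) hzt with e | e | e | e | e
      exacts [(k1 e).elim, (k2 e).elim, Or.inl e, (k3 e).elim, Or.inr e]
  · have key : ∀ z, z ∈ ((A₂.append S.reverse).append P₁).support →
        z ∈ A₂.support ∨ z ∈ S.support ∨ z ∈ P₁.support := fun z hz => by
      simpa [or_assoc] using hz
    have hkF := fun z hz => hF z (by
      rcases key z hz with h | h | h <;> simp only [h, true_or, or_true])
    have := hR.add_length_eq_nine hG (q := (A₂.append S.reverse).append P₁)
      (isPath_append (isPath_append p2 h.isPath_S.reverse fun z hz hz' =>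
        m2 z (by simpa using hz') hz) p3 fun z hz hz' => ?_)
      (fun z hz => (hkF z hz).1) (fun z hz => (hkF z hz).2) (fun z hz t ht hzt => ?_)
      (by simp only [Walk.length_append, Walk.length_reverse]; omega)
    · simp only [Walk.length_append, Walk.length_reverse] at this
      omega
    · simp only [Walk.mem_support_append_iff, Walk.support_reverse, List.mem_reverse] at hz
      exact hz.elim (fun h => (m7 z h hz').elim) fun h => m3 z h hz'
    · have k1 : s(z, t) ∉ A₁.edges := fun he => by
        have key' : ∀ z ∈ A₁.support, z ∈ A₂.support ∨ z ∈ S.support ∨ z ∈ P₁.support →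
            z = u ∨ z = x := by
          rintro z hz (hz' | hz' | hz')
          exacts [Or.inr (m9 z hz hz'), Or.inl (m1 z hz' hz), Or.inl (m5 z hz hz')]
        have := length_eq_one_of_edge_ends p1 he
          (key' z (A₁.fst_mem_support_of_mem_edges he) (key z hz))
          (key' t (A₁.snd_mem_support_of_mem_edges he) (key t ht))
        omega
      have k2 : s(z, t) ∉ P₂.edges := fun he => by
        have key' : ∀ z ∈ P₂.support, z ∈ A₂.support ∨ z ∈ S.support ∨ z ∈ P₁.support →
            z = y ∨ z = v := by
          rintro z hz (hz' | hz' | hz')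
          exacts [Or.inr (m8 z hz' hz), Or.inr (m4 z hz' hz), Or.inl (m10 z hz' hz)]
        have := length_eq_one_of_edge_ends p4 he
          (key' z (P₂.fst_mem_support_of_mem_edges he) (key z hz))
          (key' t (P₂.snd_mem_support_of_mem_edges he) (key t ht))
        omega
      have kT : ∀ z, z ∈ A₂.support ∨ z ∈ S.support ∨ z ∈ P₁.support → z ∈ S.support ∨
          z ∈ A₁.support ∨ z ∈ A₂.support ∨ z ∈ P₁.support ∨ z ∈ P₂.support := by
        rintro z (hz | hz | hz) <;> simp only [hz, true_or, or_true]
      simp only [Walk.edges_append, List.mem_append, Walk.edges_reverse, List.mem_reverse]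
      rcases h.chord_split hA hP (kT z (key z hz)) (kT t (key t ht)) hzt with e | e | e | e | e
      exacts [Or.inl (Or.inr e), (k1 e).elim, Or.inl (Or.inl e), Or.inr e, (k2 e).elim]

end IsTheta

/-! ### Thetas with a longest short path -/

theorem Nonagonal.not_adj_getVert (hG : Nonagonal G) {u v : V} (A : G.Walk u v) {i : ℕ}
    (hi : i + 2 ≤ A.length) : ¬ G.Adj (A.getVert i) (A.getVert (i + 2)) := by
  intro hadj
  have h1 := A.adj_getVert_succ (i := i) (by omega)
  have h2 := A.adj_getVert_succ (i := i + 1) (by omega)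
  have := hG.seven_le_of_adj hadj.ne h1.symm h2 hadj.toWalk (by simp [h1.ne.symm, h2.ne])
  simp at this

namespace IsTheta

variable {d : ℕ} {u v : V} {S A P : G.Walk u v}

theorem notMem_of_pos (h : IsTheta d S A P) {i : ℕ} (h0 : 0 < i) (hi : i < A.length) :
    A.getVert i ∉ S.support ∧ A.getVert i ∉ P.support := by
  have key : ¬ (A.getVert i = u ∨ A.getVert i = v) := by
    rw [h.isPath_A.getVert_eq_start_iff hi.le, h.isPath_A.getVert_eq_end_iff hi.le]
    omega
  exact ⟨fun hS => key (h.disj_SA _ hS (A.getVert_mem_support i)),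
    fun hP => key (h.disj_AP _ (A.getVert_mem_support i) hP)⟩

theorem getVert_inj (h : IsTheta d S A P) {i j : ℕ} (hi : i ≤ A.length) (hj : j ≤ A.length) :
    A.getVert i = A.getVert j ↔ i = j :=
  ⟨fun h' => h.isPath_A.getVert_injOn hi hj h', fun h' => by rw [h']⟩

theorem not_isAttached_getVert_near (hG : Nonagonal G) (h : IsTheta d S A P) {i j : ℕ}
    (h2 : i + 2 ≤ j) (h4 : j ≤ i + 4) (hj : j ≤ A.length) {Z : Set V}
    (hZ : ∀ x ∈ Z, ∃ r, i < r ∧ r < j ∧ x = A.getVert r) {R : G.Walk (A.getVert i) (A.getVert j)} :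
    ¬ IsAttached (thetaSet S A P) Z R := by
  obtain ⟨A₁, B, A₃, hA, l1, l2, l3⟩ := exists_split₃ A (i := i) (j := j) (by omega) hj
  have hAp : (A₁.append (B.append A₃)).IsPath := hA ▸ h.isPath_A
  refine h.not_isAttached_near hG hA (by omega) (by omega) fun x hx hxZ => ?_
  obtain ⟨r, hir, hrj, rfl⟩ := hZ x hxZ
  have hB : A.getVert r ∈ B.support := by
    have : A.getVert r = B.getVert (r - i) := by
      conv_lhs => rw [show A.getVert r = (A₁.append (B.append A₃)).getVert r from
        congrArg (fun w => Walk.getVert w r) hA]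
      rw [Walk.getVert_append, if_neg (by omega), Walk.getVert_append, if_pos (by omega), l1]
    rw [this]
    exact B.getVert_mem_support _
  have h0 := h.notMem_of_pos (i := r) (by omega) (by omega)
  rcases hx with hx | hx | hx | hx
  · exact h0.1 hx
  · exact h0.2 hx
  · have := (h.getVert_inj (by omega) (by omega)).1
      (eq_of_mem_append hAp hx (by rw [Walk.mem_support_append_iff]; exact Or.inl hB))
    omega
  · have := (h.getVert_inj (by omega) (by omega)).1 (eq_of_mem_append hAp.of_append_right hB hx)
    omega

theorem not_isAttached_getVert (hG : Nonagonal G) (h : IsTheta d S A P)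
    (hmax : ∀ d' > d, ∀ (u v : V) (S A P : G.Walk u v), ¬ IsTheta d' S A P) {i j : ℕ}
    (h2 : i + 2 ≤ j) (hj : j ≤ A.length) (h0 : i = 0 → j < A.length)
    {R : G.Walk (A.getVert i) (A.getVert j)} : ¬ IsAttached (thetaSet S A P) ∅ R := by
  intro hR
  by_cases h4 : j ≤ i + 4
  · exact h.not_isAttached_getVert_near hG h2 h4 hj (by simp) hR
  · obtain ⟨A₁, B, A₃, hA, l1, l2, l3⟩ := exists_split₃ A (i := i) (j := j) (by omega) hj
    obtain ⟨d', hd', S', A', P', h'⟩ := h.exists_larger hG hA (by omega) (by omega) hR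
    exact hmax d' hd' _ _ S' A' P' h'

/-- No path attached by its ends leads from one of the vertices `a₁`, `a₂`, `a₃` of a long path to
another vertex of a theta whose short path is as long as possible, provided that, if it does not
start at `a₂`, there is also a path from `a₂` to the same vertex with additional attachments only
at the start of the first path. The second path is needed where the ends of the first one are
neighbours, or neighbours of the same end of the theta. -/
theorem false_of_isAttached (hG : Nonagonal G) (hbad : ¬ HasOddOrBalancedK4 G)
    (h : IsTheta d S A P)
    (hmax : ∀ d' > d, ∀ (u v : V) (S A P : G.Walk u v), ¬ IsTheta d' S A P) {w : ℕ} (h1 : 1 ≤ w)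
    (h3 : w ≤ 3) {y : V} (hy : y ∈ thetaSet S A P)
    (hyX : y ∉ ({A.getVert 1, A.getVert 2, A.getVert 3} : Set V)) {R : G.Walk (A.getVert w) y}
    (hR : IsAttached (thetaSet S A P) ∅ R)
    (hloc : w = 2 ∨ ∃ R' : G.Walk (A.getVert 2) y, IsAttached (thetaSet S A P) {A.getVert w} R') :
    False := by
  have l2 := h.length_A
  have l4 := h.le_four
  have hw := h.notMem_of_pos (i := w) (by omega) (by omega)
  by_cases hyA : y ∈ A.support
  · obtain ⟨j, rfl, hj⟩ := Walk.mem_support_iff_exists_getVert.1 hyA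
    have hj' : j ≠ 1 ∧ j ≠ 2 ∧ j ≠ 3 := by
      refine ⟨?_, ?_, ?_⟩ <;> rintro rfl <;> simp at hyX
    have hZ : ∀ x ∈ ({A.getVert w} : Set V), ∃ r, w - 1 < r ∧ r < w + 1 ∧ x = A.getVert r :=
      fun x hx => ⟨w, by omega, by omega, hx⟩
    by_cases c1 : w + 2 ≤ j
    · exact h.not_isAttached_getVert hG hmax c1 hj (by omega) hR
    by_cases c2 : j + 2 ≤ w
    · exact h.not_isAttached_getVert hG hmax c2 (by omega) (by omega) hR.reverse
    obtain ⟨R', hR'⟩ := hloc.resolve_left (by omega)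
    by_cases c3 : j = 0
    · obtain rfl : w = 1 := by omega
      subst c3
      exact h.not_isAttached_getVert_near hG (i := 0) (j := 2) le_rfl (by omega) (by omega)
        hZ hR'.reverse
    · obtain rfl : w = 3 := by omega
      obtain rfl : j = 4 := by omega
      exact h.not_isAttached_getVert_near hG (i := 2) (j := 4) le_rfl (by omega) (by omega) hZ hR'
  rcases hy with hyS | hy | hyP
  · exact h.not_isAttached_short hG hbad hyS (A.getVert_mem_support w) hyA hw.1 hR.reverse
  · exact hyA hy
  · obtain ⟨j, rfl, hj⟩ := Walk.mem_support_iff_exists_getVert.1 hyP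
    obtain ⟨rfl, rfl⟩ := (h.eq_one_or_of_isAttached hG hbad (by omega) hj hw.2 hyA hR).resolve_right
      (by omega)
    obtain ⟨R', hR'⟩ := hloc.resolve_left (by omega)
    obtain ⟨A₁, A₂, hA, k1, k2⟩ := exists_split A (i := 2) (by omega)
    obtain ⟨P₁, P₂, hP, k3, k4⟩ := exists_split P hj
    refine h.not_isAttached_corner hG hA hP k1 k3 (A.getVert_mem_support 1) (fun h1 => ?_) ?_ hR'
    · have hA1 : A.getVert 1 ∈ A₁.support := by
        rw [show A.getVert 1 = A₁.getVert 1 by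
          rw [show A.getVert 1 = (A₁.append A₂).getVert 1 from
            congrArg (fun w => Walk.getVert w 1) hA, Walk.getVert_append, if_pos (by omega)]]
        exact A₁.getVert_mem_support 1
      have hAp : (A₁.append A₂).IsPath := hA ▸ h.isPath_A
      have := (h.getVert_inj (by omega) (by omega)).1 (eq_of_mem_append hAp hA1 h1)
      omega
    · rw [Ne, h.isPath_A.getVert_eq_start_iff (by omega)]
      omega

/-- From a theta whose short path is as long as possible, a path leaving it at the second inner
vertex of a long path leads to an odd or balanced subdivision of `K₄`. -/
theorem false_of_forall_gt (hG : Nonagonal G) (hbad : ¬ HasOddOrBalancedK4 G) (hP3 : ¬ HasP3Cut G)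
    (h : IsTheta d S A P)
    (hmax : ∀ d' > d, ∀ (u v : V) (S A P : G.Walk u v), ¬ IsTheta d' S A P) {z : V}
    (hz2 : G.Adj z (A.getVert 2)) (hz1 : z ≠ A.getVert 1) (hz3 : z ≠ A.getVert 3) : False := by
  have l2 := h.length_A
  have l4 := h.le_four
  have m2 := h.notMem_of_pos (i := 2) (by omega) (by omega)
  have hzF : z ∉ thetaSet S A P := by
    intro hz
    rcases h.chord _ _ hz (Or.inr (Or.inl (A.getVert_mem_support 2))) hz2 with he | he | he
    · exact m2.1 (S.snd_mem_support_of_mem_edges he)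
    · have hnb : z ∈ A.toSubgraph.neighborSet (A.getVert 2) := by
        rw [Subgraph.mem_neighborSet, ← Subgraph.mem_edgeSet, Walk.mem_edges_toSubgraph, Sym2.eq_swap]
        exact he
      rw [h.isPath_A.neighborSet_toSubgraph_internal (by omega) (by omega)] at hnb
      rcases hnb with hnb | hnb
      exacts [hz1 hnb, hz3 hnb]
    · exact m2.2 (P.snd_mem_support_of_mem_edges he)
  have hAF : ∀ i, A.getVert i ∈ thetaSet S A P := fun i => Or.inr (Or.inl (A.getVert_mem_support i))
  obtain ⟨k, q, hq, hU, hq0, ⟨y, hyF, hyX, hky⟩, hk2, hk⟩ := exists_escape hP3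
    (F := thetaSet S A P) (x₁ := A.getVert 1) (x₂ := A.getVert 2) (x₃ := A.getVert 3)
    (A.adj_getVert_succ (i := 1) (by omega)) (A.adj_getVert_succ (i := 2) (by omega))
    (fun he => by have := (h.getVert_inj (by omega) (by omega)).1 he; omega)
    (hG.not_adj_getVert A (i := 1) (by omega))
    (by rintro x (rfl | rfl | rfl) <;> exact hAF _) hzF hz2 (b := v) (Or.inl S.end_mem_support)
    (by
      have key : ∀ i < 5, v ≠ A.getVert i := fun i hi he => by
        have := (h.isPath_A.getVert_eq_end_iff (i := i) (by omega)).1 he.symm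
        omega
      simp [key])
    (A.drop 2).reachable
  have hout : ∀ i ≤ k, q i ∉ thetaSet S A P := fun i hi => notMem_of_mem_outside (hU i hi)
  have hnb : ∀ i ≤ k, ∀ x ∈ thetaSet S A P, G.Adj (q i) x → (i = 0 ∧ x = A.getVert 2) ∨
      (i = k ∧ x = y) ∨ x = A.getVert 1 ∨ x = A.getVert 3 := by
    intro i hi x hx hix
    by_cases hxX : x ∈ ({A.getVert 1, A.getVert 2, A.getVert 3} : Set V)
    · rcases hxX with rfl | rfl | rfl
      exacts [Or.inr (Or.inr (Or.inl rfl)), Or.inl ⟨hk2 i hi hix, rfl⟩, Or.inr (Or.inr (Or.inr rfl))]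
    · obtain rfl := hk i hi x hx hxX hix
      exact Or.inr (Or.inl ⟨rfl, h.eq_of_adj hG hbad (hout _ le_rfl) hx hyF hix hky⟩)
  have hyne : y ≠ A.getVert 1 ∧ y ≠ A.getVert 2 ∧ y ≠ A.getVert 3 := by
    simpa [not_or] using hyX
  have hinj : ∀ i j, i ≤ 3 → j ≤ 3 → i ≠ j → A.getVert i ≠ A.getVert j := fun i j hi hj hij he =>
    hij ((h.getVert_inj (by omega) (by omega)).1 he)
  -- since vertices off the theta have at most one neighbour on it, a segment of `q` is cleanly
  -- attached as soon as no vertex strictly inside it has a neighbour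
  have hseg : ∀ (s t : ℕ) (f g : V), s ≤ t → t ≤ k → f ∈ thetaSet S A P → g ∈ thetaSet S A P →
      f ≠ g → G.Adj (q s) f → G.Adj (q t) g →
      (∀ r, s ≤ r → r ≤ t → ∀ x ∈ thetaSet S A P, G.Adj (q r) x → r = s ∨ r = t) →
      ∃ R : G.Walk f g, IsAttached (thetaSet S A P) ∅ R := by
    intro s t f g hst htk hf hg hfg hsf htg hr
    obtain ⟨R, hR, -⟩ := IsAttached.of_seq (Z := ∅) hst (hq.mono (by omega) htk)
      (fun i _ hi => hout i (by omega)) hf hg hfg (by simp) (by simp) hsf.symm htg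
      fun r hsr hrt x hx hrx => by
        rcases hr r hsr hrt x hx hrx with rfl | rfl
        · exact Or.inl ⟨rfl, h.eq_of_adj hG hbad (hout _ (by omega)) hx hf hrx hsf⟩
        · exact Or.inr (Or.inl ⟨rfl, h.eq_of_adj hG hbad (hout _ (by omega)) hx hg hrx htg⟩)
    exact ⟨R, hR⟩
  have hone : ∀ w, w = 1 ∨ w = 3 → (∃ i ≤ k, G.Adj (q i) (A.getVert w)) →
      (∀ i ≤ k, ∀ x, x = A.getVert 1 ∨ x = A.getVert 3 → G.Adj (q i) x → x = A.getVert w) →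
      False := by
    rintro w hw ⟨i, hi, hiw⟩ honly
    have hyw : y ≠ A.getVert w := by rcases hw with rfl | rfl; exacts [hyne.1, hyne.2.2]
    obtain ⟨s, his, hsk, hsw, hslast⟩ := exists_last (fun i => G.Adj (q i) (A.getVert w)) hi hiw
    obtain ⟨R, hR⟩ := hseg s k (A.getVert w) y hsk le_rfl (hAF w) hyF hyw.symm hsw hky
      fun r hsr hrk x hx hrx => by
        rcases hnb r hrk x hx hrx with h1 | h1 | h1
        · omega
        · omega
        · obtain rfl := honly r hrk x h1 hrx
          by_contra hcon
          exact hslast r (by omega) hrk hrx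
    obtain ⟨R', hR', -⟩ := IsAttached.of_seq (Z := {A.getVert w}) (Nat.zero_le k) hq
      (fun i _ hi => hout i hi) (hAF 2) hyF hyne.2.1.symm
      (by rw [Set.mem_singleton_iff]; exact hinj 2 w (by omega) (by omega) (by omega))
      (by rwa [Set.mem_singleton_iff]) hq0.symm hky fun r _ hrk x hx hrx => by
        rcases hnb r hrk x hx hrx with h1 | h1 | h1
        · exact Or.inl h1
        · exact Or.inr (Or.inl h1)
        · exact Or.inr (Or.inr (honly r hrk x h1 hrx))
    exact h.false_of_isAttached hG hbad hmax (by omega) (by omega) hyF hyX hR (Or.inr ⟨R', hR'⟩)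
  by_cases e1 : ∃ i ≤ k, G.Adj (q i) (A.getVert 1)
  · by_cases e3 : ∃ i ≤ k, G.Adj (q i) (A.getVert 3)
    · have hpair : ∀ f g, f = A.getVert 1 ∧ g = A.getVert 3 ∨ f = A.getVert 3 ∧ g = A.getVert 1 →
          ∀ i j, i ≤ j → j ≤ k → G.Adj (q i) f → G.Adj (q j) g →
          ∃ R : G.Walk f g, IsAttached (thetaSet S A P) ∅ R := by
        intro f g hfg i j hij hjk hif hjg
        obtain ⟨t, hit, htj, htg, htfirst⟩ := exists_first (fun i => G.Adj (q i) g) hij hjg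
        obtain ⟨s, his, hst, hsf, hslast⟩ := exists_last (fun i => G.Adj (q i) f) hit hif
        refine hseg s t f g hst (by omega) ?_ ?_ ?_ hsf htg fun r hsr hrt x hx hrx => ?_
        · rcases hfg with ⟨rfl, -⟩ | ⟨rfl, -⟩ <;> exact hAF _
        · rcases hfg with ⟨-, rfl⟩ | ⟨-, rfl⟩ <;> exact hAF _
        · have := hinj 1 3 (by omega) (by omega) (by omega)
          rcases hfg with ⟨rfl, rfl⟩ | ⟨rfl, rfl⟩
          exacts [this, this.symm]
        · rcases hnb r (by omega) x hx hrx with h1 | h1 | h1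
          · omega
          · omega
          · have hx : x = f ∨ x = g := by
              rcases hfg with ⟨rfl, rfl⟩ | ⟨rfl, rfl⟩
              exacts [h1, h1.symm]
            by_contra hcon
            rcases hx with rfl | rfl
            · exact hslast r (by omega) hrt hrx
            · exact htfirst r (by omega) (by omega) hrx
      obtain ⟨R, hR⟩ : ∃ R : G.Walk (A.getVert 1) (A.getVert 3),
          IsAttached (thetaSet S A P) ∅ R := by
        obtain ⟨i, hi, hi1⟩ := e1
        obtain ⟨j, hj, hj3⟩ := e3
        rcases le_total i j with hij | hij
        · exact hpair _ _ (Or.inl ⟨rfl, rfl⟩) i j hij hj hi1 hj3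
        · obtain ⟨R, hR⟩ := hpair _ _ (Or.inr ⟨rfl, rfl⟩) j i hij hi hj3 hi1
          exact ⟨R.reverse, hR.reverse⟩
      exact h.not_isAttached_getVert hG hmax le_rfl (by omega) (by omega) hR
    · refine hone 1 (Or.inl rfl) e1 fun i hi x hx hix => hx.resolve_right ?_
      rintro rfl
      exact e3 ⟨i, hi, hix⟩
  · by_cases e3 : ∃ i ≤ k, G.Adj (q i) (A.getVert 3)
    · refine hone 3 (Or.inr rfl) e3 fun i hi x hx hix => hx.resolve_left ?_
      rintro rfl
      exact e1 ⟨i, hi, hix⟩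
    · obtain ⟨R, hR⟩ := hseg 0 k (A.getVert 2) y (Nat.zero_le k) le_rfl (hAF 2) hyF hyne.2.1.symm
        hq0 hky fun r _ hrk x hx hrx => by
          rcases hnb r hrk x hx hrx with h1 | h1 | rfl | rfl
          · exact Or.inl h1.1
          · exact Or.inr h1.1
          · exact (e1 ⟨r, hrk, hrx⟩).elim
          · exact (e3 ⟨r, hrk, hrx⟩).elim
      exact h.false_of_isAttached hG hbad hmax (by omega) (by omega) hyF hyX hR (Or.inl rfl)

/-- In the absence of vertices of degree `2` and `P₃`-cuts, a theta whose short path is as long as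
possible yields an odd or balanced subdivision of `K₄`. -/
theorem hasOddOrBalancedK4 (hG : Nonagonal G) (hP3 : ¬ HasP3Cut G)
    (hdeg : ∀ a x b : V, G.Adj x a → G.Adj x b → a ≠ b → ∃ z, G.Adj z x ∧ z ≠ a ∧ z ≠ b)
    (h : IsTheta d S A P) : HasOddOrBalancedK4 G := by
  by_contra hbad
  induction hm : 4 - d using Nat.strong_induction_on generalizing d u v with
  | _ m ih =>
    have l2 := h.length_A
    have l4 := h.le_four
    obtain ⟨z, hz2, hz1, hz3⟩ := hdeg (A.getVert 1) (A.getVert 2) (A.getVert 3)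
      (A.adj_getVert_succ (i := 1) (by omega)).symm (A.adj_getVert_succ (i := 2) (by omega))
      (fun he => by have := (h.getVert_inj (by omega) (by omega)).1 he; omega)
    refine h.false_of_forall_gt hG hbad hP3 (fun d' hd' u v S A P h' => ?_) hz2 hz1 hz3
    have := h'.le_four
    exact ih (4 - d') (by omega) h' rfl

end IsTheta

theorem exists_adj_of_degree_ne_two [Fintype V] [DecidableRel G.Adj] {x a b : V}
    (hx : G.degree x ≠ 2) (ha : G.Adj x a) (hb : G.Adj x b) (hab : a ≠ b) :
    ∃ z, G.Adj z x ∧ z ≠ a ∧ z ≠ b := by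
  classical
  by_contra! hcon
  refine hx ?_
  rw [← card_neighborFinset_eq_degree, ← Finset.card_pair hab]
  congr 1
  ext z
  rw [mem_neighborFinset, Finset.mem_insert, Finset.mem_singleton]
  constructor
  · intro hz
    by_cases hza : z = a
    · exact Or.inl hza
    · exact Or.inr (hcon z hz.symm hza)
  · rintro (rfl | rfl) <;> assumption

end OddHoles

theorem theorem3p3 {V : Type*} [Fintype V] (G : SimpleGraph V) [DecidableRel G.Adj]
    (hG : OddHoles.InFamily 4 G)
    (hedge : ¬ OddHoles.HasTwoEdgeCut G)
    (hK2 : ¬ OddHoles.HasK2Cut G) :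
    (∃ H : OddHoles.K4Subdivision G, H.IsOdd) ∨
    (∃ H : OddHoles.K4Subdivision G, H.IsBalancedOneTwo) ∨
    OddHoles.HasP3Cut G ∨
    (∃ v : V, G.degree v = 2) := by
  by_cases hP3 : OddHoles.HasP3Cut G
  · exact Or.inr (Or.inr (Or.inl hP3))
  by_cases hdeg : ∃ v, G.degree v = 2
  · exact Or.inr (Or.inr (Or.inr hdeg))
  push Not at hdeg
  have hN := hG.nonagonal
  obtain ⟨v, c₀, -, hl⟩ := hG.exists_isCycle
  obtain ⟨c, hc, -⟩ := hN.exists_isNonagon (X := Set.univ) (f := c₀.getVert) (n := 9) rfl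
    (fun i hi => c₀.adj_getVert_succ (by omega)) (by rw [← hl]; simp) (fun _ _ => trivial)
  obtain ⟨d, a, b, S, A, P, h⟩ := OddHoles.exists_isTheta hN hP3 hc fun c hc i => by
    obtain ⟨z, hz, h1, h8⟩ := OddHoles.exists_adj_of_degree_ne_two (hdeg (c i))
      ((hc.adj_iff i (i + 1)).2 (Or.inl rfl)) ((hc.adj_iff i (i + 8)).2 (Or.inr (by omega)))
      fun he => by rw [hc.eq_iff] at he; omega
    refine ⟨z, ?_, hz⟩
    rintro ⟨j, rfl⟩
    rw [Ne, hc.eq_iff] at h1 h8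
    have := (hc.adj_iff _ _).1 hz
    omega
  rcases h.hasOddOrBalancedK4 hN hP3
    (fun a x b => OddHoles.exists_adj_of_degree_ne_two (hdeg x)) with hK | hK
  · exact Or.inl hK
  · exact Or.inr (Or.inl hK)
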